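/- Let $n\ge 1$, let $B^0=(b^0_{ij})$ be an $n\times n$ integer matrix and let $D=\mathrm{diag}(d_1,\dots,d_n)$ have positive integer entries with $DB^0$ skew-symmetric. Let $t_0$ be a vertex of the $n$-regular tree $\mathbb T_n$ with edges labelled by $1,\dots,n$, let $t\in\mathbb T_n$ and $j\in[1,n]$. Let $R$ be the based quantum torus over $\mathbb Z[q^{\pm 1/2}]$ with generators $Z_1^{\pm1},\dots,Z_n^{\pm1}$ and relations $Z_iZ_k=q^{d_ib^0_{ik}}Z_kZ_i$, let $Z^{\mathbf c}=q^{\frac12\sum_{i<k}d_kb^0_{ki}c_ic_k}Z_1^{c_1}\cdots Z_n^{c_n}$ for $\mathbf c\in\mathbb Z^n$, and let $F\mapsto\overline F$ be the $\mathbb Z$-linear map on $R$ with $\overline{q^{r/2}Z^{\mathbf c}}=q^{-r/2}Z^{\mathbf c}$ for $r\in\mathbb Z$, $\mathbf c\in\mathbb Z^n$. For $m\ge n$ we consider quantum cluster algebras $\mathcal A$ (in the sense of Berenstein and Zelevinsky) whose initial quantum seed $(M_0,\tilde B^0)$ at $t_0$ has an $m\times n$ exchange matrix $\tilde B^0$ with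 principal part $B^0$, and whose skew-symmetric integer matrix $\Lambda_0$ of initial quasi-commutation exponents satisfies $(\tilde B^0)^T\Lambda_0=(D\,|\,0)$. Write $X_{j;t}$ for the cluster variables of $\mathcal A$, $\hat Y_k=M_0(\tilde{\mathbf b}^k)$ where $\tilde{\mathbf b}^k$ is the $k$-th column of $\tilde B^0$, and $F(\hat Y)$ for the result of substituting $\hat Y_k$ for $Z_k$ in $F\in R$. For a skew-symmetric $n\times n$ integer matrix $\Lambda$, let $\mathcal A_\bullet(B^0,D,\Lambda,t_0)$ be such an algebra with principal coefficients, i.e. with $m=2n$, $\tilde B^0=\binom{B^0}{I}$ and $\Lambda_0=\begin{pmatrix}\Lambda&-\Lambda B^0-D\\-(B^0)^T\Lambda+D&(B^0)^T\Lambda B^0+(B^0)^TD\end{pmatrix}$. Let $F^{\rm cl}_{j;t}\in\mathbb Z[u_1,\dots,u_n]$ be the classical (Fomin–Zelevinsky) $F$-polynomial, and let $\mathbf g_{j;t}\in\mathbb Z^n$ be the $\mathbf g$-vector, that is, the degree of the cluster variable $x_{j;t}$ of the classical cluster algebra with principal coefficients in the grading of $\mathbb Z[x_1^{\pm1},\dots,x_n^{\pm1},y_1^{\pm1},\dots,y_n^{\pm1}]$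 with $\deg x_i=\mathbf e_i$ and $\deg y_k=-(k\text{-th column of }B^0)$; in $\mathbb Z^{2n}$ it is extended by $n$ zeros. For $\tilde B^0$ as above let $\tilde{\mathbf g}_{j;t}\in\mathbb Z^m$ be the extended $\mathbf g$-vector: in the classical cluster algebra with initial exchange matrix $\tilde B^0$ and initial extended cluster $(x_1,\dots,x_m)$, $x_{j;t}=F^{\rm cl}_{j;t}(\hat y_1,\dots,\hat y_n)\,x_1^{\tilde g_1}\cdots x_m^{\tilde g_m}$ with $\hat y_k=\prod_i x_i^{b^0_{ik}}$. Then there is a polynomial $F_{j;t}$ in $Z_1,\dots,Z_n$ with coefficients in $\mathbb Z[q^{\pm1/2}]$, the left quantum $F$-polynomial, such that for every $\Lambda$ it is the unique such polynomial for which $X_{j;t}=F_{j;t}(\hat Y)M_0(\mathbf g_{j;t})$ in $\mathcal A_\bullet(B^0,D,\Lambda,t_0)$, and it has the following properties. 1. For every $\Lambda$, $\overline{F_{j;t}}$ is the unique polynomial in $Z_1,\dots,Z_n$ with coefficients in $\mathbb Z[q^{\pm1/2}]$ such that $X_{j;t}=M_0(\mathbf g_{j;t})\,\overline{F_{j;t}}(\hat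 Y)$ in $\mathcal A_\bullet(B^0,D,\Lambda,t_0)$. 2. For every $m\times n$ integer matrix $\tilde B^0$ with principal part $B^0$ there is $\lambda_{j;t}\in\frac12\mathbb Z$ such that in every quantum cluster algebra $\mathcal A$ as above with initial exchange matrix $\tilde B^0$ $$X_{j;t}=q^{\lambda_{j;t}}F_{j;t}(\hat Y)M_0(\tilde{\mathbf g}_{j;t})\quad\text{and}\quad X_{j;t}=q^{-\lambda_{j;t}}M_0(\tilde{\mathbf g}_{j;t})\,\overline{F_{j;t}}(\hat Y).$$ 3. Setting $q=1$ and $Z_i=u_i$ in $\overline{F_{j;t}}$ gives $F^{\rm cl}_{j;t}(u_1,\dots,u_n)$. -/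

import Mathlib

open scoped nonZeroDivisors Pointwise

/-! ### The based quantum torus

The based quantum torus of the lattice `ℤ^ι` with the form `Λ` is the free
`ℤ[q^(±1/2)]`-module with basis `X^e`, `e ∈ ℤ^ι`, and multiplication
`X^e X^f = q^(Λ(e,f)/2) X^(e+f)`. Over `ℤ` it has the basis `q^(a/2) X^e`, and these elements form
a group under multiplication; the torus is the integral group ring of this group. -/

/-- The group of monomials `q^(half/2) X^vec`, with
`X^e X^f = q^(Λ(e,f)/2) X^(e+f)`, where `Λ(e,f) = ∑ e_i Λ_{ij} f_j`. -/
@[ext]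
structure HeisenbergGroup {ι : Type} [Fintype ι] (Λ : Matrix ι ι ℤ) where
  half : ℤ
  vec : ι → ℤ

namespace HeisenbergGroup

variable {ι : Type} [Fintype ι] {Λ : Matrix ι ι ℤ}

instance : Mul (HeisenbergGroup Λ) :=
  ⟨fun x y => ⟨x.half + y.half + x.vec ⬝ᵥ (Λ.mulVec y.vec), x.vec + y.vec⟩⟩

instance : One (HeisenbergGroup Λ) := ⟨⟨0, 0⟩⟩

instance : Inv (HeisenbergGroup Λ) :=
  ⟨fun x => ⟨-x.half + x.vec ⬝ᵥ (Λ.mulVec x.vec), -x.vec⟩⟩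

@[simp] theorem mul_half (x y : HeisenbergGroup Λ) :
    (x * y).half = x.half + y.half + x.vec ⬝ᵥ (Λ.mulVec y.vec) := rfl
@[simp] theorem mul_vec (x y : HeisenbergGroup Λ) : (x * y).vec = x.vec + y.vec := rfl
@[simp] theorem one_half : (1 : HeisenbergGroup Λ).half = 0 := rfl
@[simp] theorem one_vec : (1 : HeisenbergGroup Λ).vec = 0 := rfl
@[simp] theorem inv_half (x : HeisenbergGroup Λ) :
    (x⁻¹).half = -x.half + x.vec ⬝ᵥ (Λ.mulVec x.vec) := rfl
@[simp] theorem inv_vec (x : HeisenbergGroup Λ) : (x⁻¹).vec = -x.vec := rfl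

instance : Group (HeisenbergGroup Λ) :=
  Group.ofLeftAxioms
    (fun x y z => by
      ext1
      · simp [Matrix.mulVec_add]; ring
      · simp [add_assoc])
    (fun x => by ext1 <;> simp)
    (fun x => by ext1 <;> simp)

instance : UniqueProds (HeisenbergGroup Λ) where
  uniqueMul_of_nonempty {A B} hA hB := by
    classical
    let f : HeisenbergGroup Λ →ₙ* Multiplicative (ι → ℤ) :=
      ⟨fun x => Multiplicative.ofAdd x.vec, fun _ _ => rfl⟩
    obtain ⟨u, hu, w, hw, h⟩ := UniqueProds.uniqueMul_of_nonempty (hA.image f) (hB.image f)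
    obtain ⟨a', ha', rfl⟩ := Finset.mem_image.1 hu
    obtain ⟨b', hb', rfl⟩ := Finset.mem_image.1 hw
    set A' := A.filter (f · = f a') with hA'
    set B' := B.filter (f · = f b') with hB'
    obtain ⟨a, ha, hamin⟩ := A'.exists_min_image half ⟨a', by simp [hA', ha']⟩
    obtain ⟨b, hb, hbmin⟩ := B'.exists_min_image half ⟨b', by simp [hB', hb']⟩
    refine ⟨a, (Finset.mem_filter.1 ha).1, b, (Finset.mem_filter.1 hb).1,
      UniqueMul.of_image_filter f (Finset.mem_filter.1 ha).2 (Finset.mem_filter.1 hb).2 h ?_⟩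
    intro x y hx hy hxy
    have hxv : x.vec = a.vec := by
      have h1 : f x = f a' := (Finset.mem_filter.1 hx).2
      have h2 : f a = f a' := (Finset.mem_filter.1 ha).2
      exact Multiplicative.ofAdd.injective (h1.trans h2.symm)
    have hyv : y.vec = b.vec := by
      have h1 : f y = f b' := (Finset.mem_filter.1 hy).2
      have h2 : f b = f b' := (Finset.mem_filter.1 hb).2
      exact Multiplicative.ofAdd.injective (h1.trans h2.symm)
    have h1 := congrArg half hxy
    simp only [mul_half, hxv, hyv] at h1
    have h2 := hamin x hx
    have h3 := hbmin y hy
    exact ⟨HeisenbergGroup.ext (by omega) hxv, HeisenbergGroup.ext (by omega) hyv⟩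

theorem exists_pow_lt (c p : ℕ) : ∃ N : ℕ, c * (N + 1) ^ p < 2 ^ N := by
  have h := tendsto_pow_const_div_const_pow_of_one_lt p (r := (2 : ℝ)) (by norm_num)
  have h' := (h.comp (Filter.tendsto_add_atTop_nat 1)).const_mul (2 * c : ℝ)
  rw [mul_zero] at h'
  obtain ⟨N, hN⟩ := (h'.eventually (gt_mem_nhds (zero_lt_one' ℝ))).exists
  refine ⟨N, ?_⟩
  simp only [Function.comp] at hN
  rw [← mul_div_assoc, div_lt_one (by positivity), pow_succ] at hN
  have : (c : ℝ) * ((N + 1 : ℕ) : ℝ) ^ p < 2 ^ N := by linarith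
  exact_mod_cast this

/-- Polynomial growth of the group of monomials. -/
theorem exists_small_doubling (T : Finset (HeisenbergGroup Λ)) :
    ∃ A : Finset (HeisenbergGroup Λ), ∀ C : Finset (HeisenbergGroup Λ),
      (∀ c ∈ C, ∃ a ∈ A, ∃ s ∈ T, c = a * s) → C.card < 2 * A.card := by
  classical
  obtain ⟨k, hk⟩ : ∃ k : ℕ, ∀ s ∈ T, |s.half| ≤ k ∧ ∀ i, |s.vec i| ≤ k := by
    refine ⟨∑ s ∈ T, (s.half.natAbs + ∑ i, (s.vec i).natAbs), fun s hs => ?_⟩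
    have h1 : s.half.natAbs + ∑ i, (s.vec i).natAbs ≤
        ∑ s ∈ T, (s.half.natAbs + ∑ i, (s.vec i).natAbs) :=
      Finset.single_le_sum (f := fun s : HeisenbergGroup Λ =>
        s.half.natAbs + ∑ i, (s.vec i).natAbs) (fun _ _ => Nat.zero_le _) hs
    refine ⟨by rw [Int.abs_eq_natAbs]; omega, fun i => ?_⟩
    have h2 : (s.vec i).natAbs ≤ ∑ i, (s.vec i).natAbs :=
      Finset.single_le_sum (f := fun i => (s.vec i).natAbs) (fun _ _ => Nat.zero_le _)
        (Finset.mem_univ i)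
    rw [Int.abs_eq_natAbs]
    omega
  let c : ℕ := ∑ i, ∑ j, (Λ i j).natAbs
  have hc : (c : ℤ) = ∑ i, ∑ j, |Λ i j| := by simp [c]
  have hform : ∀ (e f : ι → ℤ) (a b : ℤ), 0 ≤ a → 0 ≤ b → (∀ i, |e i| ≤ a) → (∀ i, |f i| ≤ b) →
      |e ⬝ᵥ (Λ.mulVec f)| ≤ c * (a * b) := by
    intro e f a b ha hb he hf
    rw [hc, Finset.sum_mul]
    refine (Finset.abs_sum_le_sum_abs _ _).trans (Finset.sum_le_sum fun i _ => ?_)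
    rw [abs_mul, Finset.sum_mul]
    have h1 : |(Λ.mulVec f) i| ≤ ∑ j, |Λ i j| * b := by
      refine (Finset.abs_sum_le_sum_abs _ _).trans (Finset.sum_le_sum fun j _ => ?_)
      rw [abs_mul]
      exact mul_le_mul_of_nonneg_left (hf j) (abs_nonneg _)
    calc |e i| * |(Λ.mulVec f) i| ≤ a * ∑ j, |Λ i j| * b :=
          mul_le_mul (he i) h1 (abs_nonneg _) ha
      _ = ∑ j, |Λ i j| * (a * b) := by rw [Finset.mul_sum]; congr 1; ext j; ring
  let K : ℕ := k + c * k ^ 2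
  let D : ℕ → Finset (HeisenbergGroup Λ) := fun N =>
    ((Finset.Icc (-(K * N ^ 2 : ℤ)) (K * N ^ 2)) ×ˢ
      Fintype.piFinset fun _ : ι => Finset.Icc (-(k * N : ℤ)) (k * N)).image fun p => ⟨p.1, p.2⟩
  have hD : ∀ N x, x ∈ D N ↔ |x.half| ≤ K * N ^ 2 ∧ ∀ i, |x.vec i| ≤ k * N := by
    intro N x
    simp only [D, Finset.mem_image, Finset.mem_product, Fintype.mem_piFinset, Finset.mem_Icc,
      Prod.exists, abs_le]
    constructor
    · rintro ⟨a, b, h, rfl⟩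
      exact h
    · intro h
      exact ⟨x.half, x.vec, h, rfl⟩
  have hstep : ∀ N (C : Finset (HeisenbergGroup Λ)),
      (∀ y ∈ C, ∃ a ∈ D N, ∃ s ∈ T, y = a * s) → C ⊆ D (N + 1) := by
    intro N C hC y hy
    obtain ⟨a, ha, s, hs, rfl⟩ := hC y hy
    obtain ⟨ha1, ha2⟩ := (hD N a).1 ha
    obtain ⟨hs1, hs2⟩ := hk s hs
    refine (hD _ _).2 ⟨?_, fun i => ?_⟩
    · have h1 := hform a.vec s.vec (k * N) k (by positivity) (by positivity) ha2 hs2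
      have h2 := abs_add_le (a.half + s.half) (a.vec ⬝ᵥ (Λ.mulVec s.vec))
      have h3 := abs_add_le a.half s.half
      have h4 : (0 : ℤ) ≤ k * N := by positivity
      have h5 : (0 : ℤ) ≤ c * k ^ 2 * N := by positivity
      have h6 : (0 : ℤ) ≤ c * k ^ 2 := by positivity
      rw [mul_half]
      push_cast [K] at ha1 ⊢
      nlinarith
    · have h1 := abs_add_le (a.vec i) (s.vec i)
      have h2 := ha2 i
      have h3 := hs2 i
      simp only [mul_vec, Pi.add_apply]
      push_cast
      linarith
  by_contra hcon
  push Not at hcon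
  have hgrow : ∀ N, 2 ^ N ≤ (D N).card := by
    intro N
    induction N with
    | zero =>
      have : (1 : HeisenbergGroup Λ) ∈ D 0 := (hD _ _).2 (by simp)
      simpa using Finset.card_pos.2 ⟨_, this⟩
    | succ N ih =>
      obtain ⟨C, hC, hle⟩ := hcon (D N)
      have := Finset.card_le_card (hstep N C hC)
      rw [pow_succ]
      omega
  obtain ⟨N, hN⟩ := exists_pow_lt ((2 * K + 1) * (2 * k + 1) ^ Fintype.card ι)
    (2 + Fintype.card ι)
  have hcard : (D N).card ≤ (2 * (K * N ^ 2) + 1) * (2 * (k * N) + 1) ^ Fintype.card ι := by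
    refine Finset.card_image_le.trans (le_of_eq ?_)
    rw [Finset.card_product, Fintype.card_piFinset]
    simp only [Int.card_Icc, Finset.prod_const, Finset.card_univ]
    have e0 : ∀ a : ℕ, ((a : ℤ) + 1 - -(a : ℤ)).toNat = 2 * a + 1 := by intro a; omega
    have e1 := e0 (K * N ^ 2)
    have e2 := e0 (k * N)
    push_cast at e1 e2
    rw [e1, e2]
  have hb1 : 2 * (K * N ^ 2) + 1 ≤ (2 * K + 1) * (N + 1) ^ 2 := by nlinarith [Nat.zero_le (K * N)]
  have hb2 : 2 * (k * N) + 1 ≤ (2 * k + 1) * (N + 1) := by nlinarith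
  have hb3 := Nat.pow_le_pow_left hb2 (Fintype.card ι)
  have := (hgrow N).trans (hcard.trans (Nat.mul_le_mul hb1 hb3))
  rw [mul_pow] at this
  rw [pow_add] at hN
  nlinarith

end HeisenbergGroup

/-- The based quantum torus: finite `ℤ`-linear combinations of the monomials `q^(a/2) X^e`. For
`Λ(e_i, e_j) = d_i b_{ij}` this is the algebra with generators `Z_i^(±1)` and relations
`Z_i Z_j = q^(d_i b_{ij}) Z_j Z_i`, and `X^c` is the monomial written `Z^c`. -/
abbrev QuantumTorus {ι : Type} [Fintype ι] (Λ : Matrix ι ι ℤ) : Type :=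
  MonoidAlgebra ℤ (HeisenbergGroup Λ)

/-- The quantum torus, which is a domain, satisfies the Ore condition. -/
theorem QuantumTorus.ore {ι : Type} [Fintype ι] {Λ : Matrix ι ι ℤ} (r s : QuantumTorus Λ)
    (hs : s ≠ 0) : ∃ r' s' : QuantumTorus Λ, s' ≠ 0 ∧ s' * r = r' * s := by
  classical
  obtain ⟨A, hA⟩ := HeisenbergGroup.exists_small_doubling (r.coeff.support ∪ s.coeff.support)
  let T := r.coeff.support ∪ s.coeff.support
  let e : (A → ℤ) →ₗ[ℤ] QuantumTorus Λ :=
    ∑ a : A, (LinearMap.toSpanSingleton ℤ (QuantumTorus Λ) (MonoidAlgebra.single a.1 1)).comp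
      (LinearMap.proj a)
  have he : ∀ f (x : A), (e f).coeff x.1 = f x := by
    intro f x
    simp [e, LinearMap.sum_apply, MonoidAlgebra.coeff_sum, Finsupp.finsetSum_apply,
      Finsupp.single_apply]
  have he' : ∀ f x, x ∉ A → (e f).coeff x = 0 := by
    intro f x hx
    simp only [e, LinearMap.sum_apply, MonoidAlgebra.coeff_sum, Finsupp.finsetSum_apply]
    refine Finset.sum_eq_zero fun a _ => ?_
    have : a.1 ≠ x := fun h => hx (h ▸ a.2)
    simp [this]
  have hinj : ∀ f, e f = 0 → f = 0 := fun f h => by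
    ext x; rw [← he f x, h]; rfl
  let φ : (A → ℤ) × (A → ℤ) →ₗ[ℤ] QuantumTorus Λ :=
    ((LinearMap.mulRight ℤ r).comp e).coprod (-((LinearMap.mulRight ℤ s).comp e))
  let ψ : (A → ℤ) × (A → ℤ) →ₗ[ℤ] ((A * T : Finset (HeisenbergGroup Λ)) → ℤ) :=
    { toFun := fun p x => (φ p).coeff x.1
      map_add' := fun p q => by ext x; simp [MonoidAlgebra.coeff_add]
      map_smul' := fun c p => by ext x; simp only [map_smul]; rfl }
  have hker : ∃ p, p ≠ 0 ∧ ψ p = 0 := by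
    by_contra hcon
    push Not at hcon
    have hψ : Function.Injective ψ := by
      rw [← LinearMap.ker_eq_bot, LinearMap.ker_eq_bot']
      intro p hp
      by_contra h
      exact hcon p h hp
    have := LinearMap.finrank_le_finrank_of_injective hψ
    have hlt := hA (A * T) (fun c hc => by
      obtain ⟨a, ha, t, ht, rfl⟩ := Finset.mem_mul.1 hc
      exact ⟨a, ha, t, ht, rfl⟩)
    simp only [Module.finrank_prod, Module.finrank_pi, Fintype.card_coe] at this
    omega
  obtain ⟨p, hp, hpz⟩ := hker
  have hsub : ∀ (u : QuantumTorus Λ) (f : A → ℤ) (x), u.coeff.support ⊆ T → x ∉ A * T →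
      (e f * u).coeff x = 0 := by
    intro u f x hu hx
    by_contra h
    have h1 := MonoidAlgebra.support_coeff_mul_subset (e f) u (Finsupp.mem_support_iff.2 h)
    obtain ⟨a, ha, b, hb, rfl⟩ := Finset.mem_mul.1 h1
    refine hx (Finset.mul_mem_mul ?_ (hu hb))
    by_contra ha'
    exact (Finsupp.mem_support_iff.1 ha) (he' f a ha')
  have hφ : φ p = 0 := by
    ext x
    by_cases hx : x ∈ A * T
    · exact congrFun hpz ⟨x, hx⟩
    · simp [φ, hsub r p.1 x Finset.subset_union_left hx,
        hsub s p.2 x Finset.subset_union_right hx]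
  have heq : e p.1 * r = e p.2 * s := by
    have : e p.1 * r + -(e p.2 * s) = 0 := by simpa [φ] using hφ
    exact (eq_neg_of_add_eq_zero_left this).trans (neg_neg _)
  refine ⟨e p.2, e p.1, fun h0 => hp ?_, heq⟩
  have h2 : e p.2 = 0 := by
    rw [h0, zero_mul] at heq
    exact (mul_eq_zero.1 heq.symm).resolve_right hs
  exact Prod.ext (hinj _ h0) (hinj _ h2)

noncomputable instance {ι : Type} [Fintype ι] {Λ : Matrix ι ι ℤ} :
    OreLocalization.OreSet (QuantumTorus Λ)⁰ :=
  Classical.choice <| OreLocalization.nonempty_oreSet_iff_of_noZeroDivisors.2 fun r s => by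
    obtain ⟨r', s', hs', h⟩ := QuantumTorus.ore r s.1 (nonZeroDivisors.coe_ne_zero s)
    exact ⟨r', ⟨s', mem_nonZeroDivisors_of_ne_zero hs'⟩, h⟩

/-! ### The ambient skew-field -/

/-- The skew-field of fractions of the based quantum torus. -/
abbrev QuantumField {ι : Type} [Fintype ι] (Λ : Matrix ι ι ℤ) : Type :=
  OreLocalization (QuantumTorus Λ)⁰ (QuantumTorus Λ)

namespace QuantumField

variable {ι : Type} [Fintype ι]

/-- The central element `q^(1/2)`. -/
noncomputable def qHalf (Λ : Matrix ι ι ℤ) : QuantumField Λ :=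
  OreLocalization.numeratorHom (MonoidAlgebra.single (⟨1, 0⟩ : HeisenbergGroup Λ) (1 : ℤ))

/-- The basis element `X^e` of the based quantum torus, as an element of the skew-field. -/
noncomputable def X (Λ : Matrix ι ι ℤ) (e : ι → ℤ) : QuantumField Λ :=
  OreLocalization.numeratorHom (MonoidAlgebra.single (⟨0, e⟩ : HeisenbergGroup Λ) (1 : ℤ))

end QuantumField

/-! ### Elements of the torus with generators `Z₁, …, Zₙ` -/

namespace QuantumTorus

variable {n : ℕ} {Λ : Matrix (Fin n) (Fin n) ℤ}

/-- `F` is a polynomial in `Z₁, …, Zₙ` with coefficients in `ℤ[q^(±1/2)]`: only monomials `Z^c`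
with `c ≥ 0` occur. -/
def IsPolynomial (F : QuantumTorus Λ) : Prop :=
  ∀ h ∈ F.coeff.support, ∀ i, 0 ≤ h.vec i

/-- The bar-involution: the `ℤ`-linear map `q^(r/2) Z^c ↦ q^(-r/2) Z^c`. -/
noncomputable def bar (F : QuantumTorus Λ) : QuantumTorus Λ :=
  MonoidAlgebra.ofCoeff (F.coeff.mapDomain fun h => ⟨-h.half, h.vec⟩)

/-- `F(Y₁, …, Yₙ)`: the element of a skew-field `K` obtained from `F` by replacing `q^(1/2)` by `v`
and each `Zᵢ` by `Yᵢ`, using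
`Z^c = q^((1/2) ∑_{i<j} Λ_{ji} c_i c_j) Z₁^{c₁} ⋯ Zₙ^{cₙ}`. -/
noncomputable def eval {K : Type} [DivisionRing K] (v : K) (Y : Fin n → K)
    (F : QuantumTorus Λ) : K :=
  F.coeff.sum fun h z =>
    (z : K) * v ^ (h.half + ∑ i, ∑ j, if i < j then Λ j i * h.vec i * h.vec j else 0) *
      (List.ofFn fun i => Y i ^ h.vec i).prod

end QuantumTorus

/-! ### Matrix mutation and the regular tree -/

/-- The vertices of the `n`-regular tree with edges labelled by `Fin n`, seen from a fixed vertex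
`t₀`: a vertex is the sequence of labels along the unique path from `t₀` to it, a word without two
equal consecutive letters. The head of the list is the last edge of the path; `t₀` is the empty
list, and `w` and `k :: w` are joined by an edge with label `k`. -/
abbrev TreeVertex (n : ℕ) : Type := {w : List (Fin n) // w.IsChain (· ≠ ·)}

/-- Mutation in direction `k` of an `m × n` matrix, `m = n + r`; the rows are indexed by
`Fin n ⊕ Fin r`, the principal part being the top `n × n` submatrix. -/
def mutateMatrix {n r : ℕ} (k : Fin n) (B : Matrix (Fin n ⊕ Fin r) (Fin n) ℤ) :
    Matrix (Fin n ⊕ Fin r) (Fin n) ℤ :=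
  Matrix.of fun i j =>
    if i = Sum.inl k ∨ j = k then -B i j
    else B i j + (B i k).sign * max (B i k * B (Sum.inl k) j) 0

/-- The principal part (top `n × n` submatrix) of an exchange matrix. -/
def principalPart {n r : ℕ} (B : Matrix (Fin n ⊕ Fin r) (Fin n) ℤ) : Matrix (Fin n) (Fin n) ℤ :=
  B.submatrix Sum.inl id

/-- The principal matrix corresponding to `B⁰`: `B⁰` on top of the identity matrix. -/
def principalMatrix {n : ℕ} (B0 : Matrix (Fin n) (Fin n) ℤ) :
    Matrix (Fin n ⊕ Fin n) (Fin n) ℤ :=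
  Matrix.fromRows B0 1

/-! ### Classical cluster variables, F-polynomials and g-vectors -/

/-- An extended cluster in a field together with an exchange matrix. -/
structure ClassicalSeed (K : Type) (n r : ℕ) where
  cluster : Fin n ⊕ Fin r → K
  matrix : Matrix (Fin n ⊕ Fin r) (Fin n) ℤ

namespace ClassicalSeed

variable {K : Type} [Field K] {n r : ℕ}

/-- Seed mutation in direction `k`. -/
def mutate (k : Fin n) (S : ClassicalSeed K n r) : ClassicalSeed K n r where
  cluster := Function.update S.cluster (Sum.inl k)
    ((S.cluster (Sum.inl k))⁻¹ *
      (∏ i, S.cluster i ^ (max (S.matrix i k) 0).toNat +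
        ∏ i, S.cluster i ^ (max (-S.matrix i k) 0).toNat))
  matrix := mutateMatrix k S.matrix

/-- The seed obtained from `S` by the successive mutations along a path (last one first). -/
def along (S : ClassicalSeed K n r) : List (Fin n) → ClassicalSeed K n r
  | [] => S
  | k :: w => (S.along w).mutate k

end ClassicalSeed

/-- The value at `x` of the subtraction-free rational expression of the cluster variable `x_{j;t}`
in terms of the initial extended cluster, obtained by iterating the exchange relations from the
initial exchange matrix `B`. -/
def clusterVariable {K : Type} [Field K] {n r : ℕ} (B : Matrix (Fin n ⊕ Fin r) (Fin n) ℤ)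
    (t : TreeVertex n) (j : Fin n) (x : Fin n ⊕ Fin r → K) : K :=
  ((ClassicalSeed.mk x B).along t.1).cluster (Sum.inl j)

/-- The field of rational functions over `ℚ` in variables indexed by `σ`, as the field of
fractions of the integral polynomial ring. -/
abbrev RatFunField (σ : Type) : Type := FractionRing (MvPolynomial σ ℤ)

/-- The `i`-th variable. -/
noncomputable def RatFunField.var {σ : Type} (i : σ) : RatFunField σ :=
  algebraMap (MvPolynomial σ ℤ) (RatFunField σ) (MvPolynomial.X i)

/-- The classical `F`-polynomial as a rational function: put `x_i = 1`, `y_i = u_i` in the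
expression of the cluster variable of the cluster algebra with principal coefficients. -/
noncomputable def classicalF {n : ℕ} (B0 : Matrix (Fin n) (Fin n) ℤ) (t : TreeVertex n)
    (j : Fin n) : RatFunField (Fin n) :=
  clusterVariable (principalMatrix B0) t j (Sum.elim (fun _ => 1) RatFunField.var)

/-- `x` lies in the ring of integral Laurent polynomials and is homogeneous of degree `g` in it,
where the `i`-th variable has degree `w i`. -/
def IsLaurentHomogeneous {σ : Type} {n : ℕ} (w : σ → Fin n → ℤ) (x : RatFunField σ)
    (g : Fin n → ℤ) : Prop :=
  ∃ (N : σ →₀ ℕ) (P : MvPolynomial σ ℤ),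
    P.IsWeightedHomogeneous w (g + Finsupp.weight w N) ∧
      x * algebraMap (MvPolynomial σ ℤ) (RatFunField σ) (MvPolynomial.monomial N 1) =
        algebraMap (MvPolynomial σ ℤ) (RatFunField σ) P

/-- `g` is the g-vector `g_{j;t}`: the degree of the cluster variable `x_{j;t}` of the cluster
algebra with principal coefficients, where `deg x_i = e_i` and `deg y_j` is minus the `j`-th
column of `B⁰`. -/
def IsGVector {n : ℕ} (B0 : Matrix (Fin n) (Fin n) ℤ) (t : TreeVertex n) (j : Fin n)
    (g : Fin n → ℤ) : Prop :=
  IsLaurentHomogeneous (Sum.elim (fun i => Pi.single i 1) (fun k => -fun i => B0 i k))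
    (clusterVariable (principalMatrix B0) t j RatFunField.var) g

/-- `g` is the extended g-vector of `x_{j;t}` with respect to the initial exchange matrix `B`:
`x_{j;t} = F_{j;t}(ŷ₁, …, ŷₙ) x₁^{g₁} ⋯ x_m^{g_m}`, where `F_{j;t}` is the classical F-polynomial
of the principal part and `ŷ_k = ∏ x_i^{b_{ik}}`. -/
def IsExtendedGVector {n r : ℕ} (B : Matrix (Fin n ⊕ Fin r) (Fin n) ℤ) (t : TreeVertex n)
    (j : Fin n) (g : Fin n ⊕ Fin r → ℤ) : Prop :=
  ∃ P : MvPolynomial (Fin n) ℤ,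
    algebraMap (MvPolynomial (Fin n) ℤ) (RatFunField (Fin n)) P =
        classicalF (principalPart B) t j ∧
      clusterVariable B t j RatFunField.var =
        MvPolynomial.aeval (fun k => ∏ i, (RatFunField.var i : RatFunField (Fin n ⊕ Fin r)) ^ B i k)
          P * ∏ i, RatFunField.var i ^ g i

/-- Setting `q = 1` and `Z_i = u_i` in an element of the torus with generators `Z₁, …, Zₙ`. -/
noncomputable def QuantumTorus.classicalLimit {n : ℕ} {Λ : Matrix (Fin n) (Fin n) ℤ}
    (F : QuantumTorus Λ) : RatFunField (Fin n) :=
  F.coeff.sum fun h z => (z : RatFunField (Fin n)) * ∏ i, RatFunField.var i ^ h.vec i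

/-! ### Quantum seeds and quantum cluster variables -/

/-- `M` is a toric frame in the skew-field of fractions of the based quantum torus with form `L`,
and `Λ` is its matrix of quasi-commutation exponents: `M(c) = φ(X^{η(c)})` for an automorphism `φ`
of the skew-field fixing `q^(1/2)` and a lattice automorphism `η`, and `Λ` is `L` transferred
along `η`. -/
def IsToricFrame {ι : Type} [Fintype ι] [DecidableEq ι] (L : Matrix ι ι ℤ)
    (M : (ι → ℤ) → QuantumField L) (Λ : Matrix ι ι ℤ) : Prop :=
  ∃ (φ : QuantumField L ≃+* QuantumField L) (η : (ι → ℤ) ≃+ (ι → ℤ)),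
    φ (QuantumField.qHalf L) = QuantumField.qHalf L ∧
      (∀ c, M c = φ (QuantumField.X L (η c))) ∧
      ∀ i j, Λ i j = η (Pi.single i 1) ⬝ᵥ (L.mulVec (η (Pi.single j 1)))

/-- `(Λ, B)` is a compatible pair with constants `d`: `Bᵀ Λ = (D | 0)`. -/
def IsCompatible {n r : ℕ} (d : Fin n → ℤ) (Λ : Matrix (Fin n ⊕ Fin r) (Fin n ⊕ Fin r) ℤ)
    (B : Matrix (Fin n ⊕ Fin r) (Fin n) ℤ) : Prop :=
  B.transpose * Λ = Matrix.fromCols (Matrix.diagonal d) 0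

/-- `(M, B)` is a quantum seed, with constants `d` in the compatibility condition, in the
skew-field attached to the skew-symmetric form `L`; `Λ` is the matrix of quasi-commutation
exponents of `M`. -/
def IsQuantumSeed {n r : ℕ} (d : Fin n → ℤ) (L : Matrix (Fin n ⊕ Fin r) (Fin n ⊕ Fin r) ℤ)
    (M : (Fin n ⊕ Fin r → ℤ) → QuantumField L) (B : Matrix (Fin n ⊕ Fin r) (Fin n) ℤ)
    (Λ : Matrix (Fin n ⊕ Fin r) (Fin n ⊕ Fin r) ℤ) : Prop :=
  L.transpose = -L ∧ IsToricFrame L M Λ ∧ IsCompatible d Λ B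

/-- The `t`-binomial coefficient
`((t^r - t^(-r)) ⋯ (t^(r-p+1) - t^(-r+p-1))) / ((t^p - t^(-p)) ⋯ (t - t⁻¹))`. -/
def tBinomial {K : Type} [DivisionRing K] (t : K) (r : ℕ) : ℕ → K
  | 0 => 1
  | p + 1 => tBinomial t r p *
      ((t ^ ((r : ℤ) - p) - t ^ (-((r : ℤ) - p))) / (t ^ ((p : ℤ) + 1) - t ^ (-((p : ℤ) + 1))))

/-- The matrix `E_ε` for the sign `ε = +` (mutation does not depend on the sign). -/
def matrixE {n r : ℕ} (k : Fin n) (B : Matrix (Fin n ⊕ Fin r) (Fin n) ℤ) :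
    Matrix (Fin n ⊕ Fin r) (Fin n ⊕ Fin r) ℤ :=
  Matrix.of fun i j =>
    if j ≠ Sum.inl k then (if i = j then 1 else 0)
    else if i = Sum.inl k then -1 else max 0 (-B i k)

/-- A map `ℤ^m → K` together with an exchange matrix. -/
structure FrameSeed (K : Type) (n r : ℕ) where
  frame : (Fin n ⊕ Fin r → ℤ) → K
  matrix : Matrix (Fin n ⊕ Fin r) (Fin n) ℤ

namespace FrameSeed

variable {K : Type} [DivisionRing K] {n r : ℕ}

/-- The formula for the mutated toric frame at `c` with `c_k ≥ 0`:
`∑_{p=0}^{c_k} binom(c_k, p)_{q^(d_k/2)} M(E c + p b^k)`. Here `v` stands for `q^(1/2)`. -/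
noncomputable def mutateFrameAux (v : K) (d : Fin n → ℤ) (k : Fin n) (S : FrameSeed K n r)
    (c : Fin n ⊕ Fin r → ℤ) : K :=
  ∑ p ∈ Finset.range ((c (Sum.inl k)).toNat + 1),
    tBinomial (v ^ d k) (c (Sum.inl k)).toNat p *
      S.frame ((matrixE k S.matrix).mulVec c + (p : ℤ) • fun i => S.matrix i k)

/-- Mutation of quantum seeds in direction `k`. -/
noncomputable def mutate (v : K) (d : Fin n → ℤ) (k : Fin n) (S : FrameSeed K n r) :
    FrameSeed K n r where
  frame c := if 0 ≤ c (Sum.inl k) then S.mutateFrameAux v d k c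
    else (S.mutateFrameAux v d k (-c))⁻¹
  matrix := mutateMatrix k S.matrix

/-- The seed obtained from `S` by the successive mutations along a path (last one first). -/
noncomputable def along (v : K) (d : Fin n → ℤ) (S : FrameSeed K n r) :
    List (Fin n) → FrameSeed K n r
  | [] => S
  | k :: w => (S.along v d w).mutate v d k

end FrameSeed

/-- The quantum cluster variable `X_{j;t} = M_t(e_j)` of the quantum cluster algebra with initial
quantum seed `(M, B)`. -/
noncomputable def quantumClusterVariable {n r : ℕ} (d : Fin n → ℤ)
    {L : Matrix (Fin n ⊕ Fin r) (Fin n ⊕ Fin r) ℤ} (M : (Fin n ⊕ Fin r → ℤ) → QuantumField L)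
    (B : Matrix (Fin n ⊕ Fin r) (Fin n) ℤ) (t : TreeVertex n) (j : Fin n) : QuantumField L :=
  ((FrameSeed.mk M B).along (QuantumField.qHalf L) d t.1).frame (Pi.single (Sum.inl j) 1)

/-- `F(Ŷ)`, where `Ŷ_k = M(b^k)` for the `k`-th column `b^k` of the initial exchange matrix. -/
noncomputable def evalYHat {n r : ℕ} {Λ : Matrix (Fin n) (Fin n) ℤ}
    {L : Matrix (Fin n ⊕ Fin r) (Fin n ⊕ Fin r) ℤ} (M : (Fin n ⊕ Fin r → ℤ) → QuantumField L)
    (B : Matrix (Fin n ⊕ Fin r) (Fin n) ℤ) (F : QuantumTorus Λ) : QuantumField L :=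
  F.eval (QuantumField.qHalf L) fun k => M fun i => B i k

/-- The matrix of initial quasi-commutation exponents of the quantum cluster algebra with principal
coefficients `𝒜_•(B⁰, D, Λ, t₀)`. -/
def principalForm {n : ℕ} (B0 : Matrix (Fin n) (Fin n) ℤ) (d : Fin n → ℤ)
    (Λ : Matrix (Fin n) (Fin n) ℤ) : Matrix (Fin n ⊕ Fin n) (Fin n ⊕ Fin n) ℤ :=
  Matrix.fromBlocks Λ (-(Λ * B0) - Matrix.diagonal d)
    (-(B0.transpose * Λ) + Matrix.diagonal d)
    (B0.transpose * Λ * B0 + B0.transpose * Matrix.diagonal d)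

/-! ### Quantum binomial coefficients -/

section Binomial

variable {C : Type} [Field C]

/-! A toric frame is handled as a map `M` into a skew-field over a central field containing `v =
q^(1/2)`, subject to `M(x) M(y) = v^(Λ(x,y)) M(x+y)`. The theorem rests on one consequence of
compatibility: `Λ(Bx, c) = ∑ x_j d_j c_j` involves only the mutable coordinates of `c`
(`IsSeed.form_mulVec`). Hence the commutation rules of the `Ŷ_k` among themselves and with `M(c)`
depend neither on the frozen rows nor on the form.

Induction along the path from `t₀` to `t` therefore produces one element `z` of the skew-field of
the `Z`-torus with `X_{j;t} = φ(z) M₀(g̃)` in every quantum cluster algebra over `B⁰`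
(`exists_transfer`). Here `φ` substitutes `Ŷ` for `Z`, and `g̃` is the value at `e_j` of a linear
map `gMap`. The powers of `q` met on the way are also determined by mutable coordinates, so they are
absorbed into `z` and the exponent `λ` can be taken to be `0`. Independence of the columns of the
exchange matrix makes `φ` available and gives uniqueness.

That `z` is a polynomial `F` can be checked in a single algebra, the one with principal coefficients
and `Λ = 0` (`exists_isPolynomial`). It takes three ingredients. (a) The quantum Laurent phenomenon,
`IsSeed.frame_along_mem`. Being a Laurent polynomial in a cluster and in all neighbouring clusters
is a property preserved by mutation; this is a rank two statement (`IsSeed.laurent_step`) that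
reduces to the coprimality of two variables. (b) Absence of negative powers of a frozen variable. At
`q = 1`, with this variable equal to `0` and the other initial variables equal to `1`, the remaining
classical variables stay positive (`classicalAlong_pos`). So in an exchange relation `X_k X_k' = P`
the factor `X_k` has a term of degree zero in the frozen variable, and `X_k'` cannot have a pole
there (`hasValue_along`). (c) `φ(z)` commutes with the frozen variables, which forces its exponents
into the lattice spanned by the columns. On this lattice the frozen coordinates are the exponents of
the `Z_k`.

The formula with `M₀(g̃)` on the left comes from the anti-automorphism that inverts `q^(1/2)` and
fixes the initial frame: the mutation formula is symmetric, so it fixes all cluster variables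
(`bar_frame_along`). The classical statements follow by specializing to `q = 1`. Putting `x = 1`
gives the classical F-polynomial, the degree zero of `ŷ_k` gives the g-vector, and
`classicalAlong_separation` identifies `gMap` with the extended g-vector. -/

theorem tBinomial_self_add (t : C) (r p : ℕ) : tBinomial t r (r + 1 + p) = 0 := by
  induction p with
  -- The last factor has numerator `t^0 - t^0`.
  | zero => simp [tBinomial]
  | succ p ih =>
    rw [← add_assoc, tBinomial, ih, zero_mul]

theorem tBinomial_eq_zero (t : C) {r p : ℕ} (h : r < p) : tBinomial t r p = 0 := by
  obtain ⟨q, rfl⟩ := Nat.exists_eq_add_of_lt h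
  have := tBinomial_self_add t r q
  rwa [show r + q + 1 = r + 1 + q by omega]

/-- `t` is not a root of unity (and not zero). -/
def IsGeneric (t : C) : Prop := t ≠ 0 ∧ ∀ m : ℤ, t ^ m = 1 → m = 0

theorem IsGeneric.zpow {t : C} (ht : IsGeneric t) {d : ℤ} (hd : d ≠ 0) : IsGeneric (t ^ d) :=
  ⟨zpow_ne_zero _ ht.1, fun m h => by
    rw [← zpow_mul] at h
    exact (mul_eq_zero.1 (ht.2 _ h)).resolve_left hd⟩

theorem IsGeneric.zpow_injective {t : C} (ht : IsGeneric t) : Function.Injective fun m : ℤ => t ^ m := by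
  intro a b h
  have : t ^ (a - b) = 1 := by
    rw [zpow_sub₀ ht.1, show t ^ a = t ^ b from h, div_self (zpow_ne_zero _ ht.1)]
  have := ht.2 _ this
  omega

theorem IsGeneric.sub_ne_zero {t : C} (ht : IsGeneric t) (p : ℕ) :
    t ^ ((p : ℤ) + 1) - t ^ (-((p : ℤ) + 1)) ≠ 0 := fun h => by
  have := ht.zpow_injective (_root_.sub_eq_zero.1 h)
  omega

/-- The absorption identity: raising both indices multiplies the product of quotients by
`[r+1]/[p+1]`, where `[m] = t^m - t^(-m)`. It is the form from which Pascal's rule follows after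
clearing one denominator. -/
theorem tBinomial_succ_succ_mul {t : C} (ht : IsGeneric t) (r p : ℕ) :
    tBinomial t (r + 1) (p + 1) * (t ^ ((p : ℤ) + 1) - t ^ (-((p : ℤ) + 1))) =
      tBinomial t r p * (t ^ ((r : ℤ) + 1) - t ^ (-((r : ℤ) + 1))) := by
  induction p with
  | zero =>
    have := ht.sub_ne_zero 0
    simp only [tBinomial, Nat.cast_zero, zero_add] at this ⊢
    rw [one_mul, one_mul, div_mul_cancel₀ _ this]
    push_cast
    ring_nf
  | succ p ih =>
    have h1 := ht.sub_ne_zero p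
    have h2 := ht.sub_ne_zero (p + 1)
    have e1 : tBinomial t (r + 1) (p + 1 + 1) = tBinomial t (r + 1) (p + 1) *
        ((t ^ ((r : ℤ) - p) - t ^ (-((r : ℤ) - p))) /
          (t ^ (((p + 1 : ℕ) : ℤ) + 1) - t ^ (-(((p + 1 : ℕ) : ℤ) + 1)))) := by
      rw [tBinomial]; push_cast; ring_nf
    have e2 : tBinomial t r (p + 1) = tBinomial t r p *
        ((t ^ ((r : ℤ) - p) - t ^ (-((r : ℤ) - p))) / (t ^ ((p : ℤ) + 1) - t ^ (-((p : ℤ) + 1)))) :=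
      rfl
    rw [e1, e2, mul_assoc, div_mul_cancel₀ _ h2]
    refine mul_right_cancel₀ h1 ?_
    have e3 := div_mul_cancel₀ (t ^ ((r : ℤ) - p) - t ^ (-((r : ℤ) - p))) h1
    linear_combination (t ^ ((r : ℤ) - p) - t ^ (-((r : ℤ) - p))) * ih -
      tBinomial t r p * (t ^ ((r : ℤ) + 1) - t ^ (-((r : ℤ) + 1))) * e3

/-- Pascal's rule for the coefficients `tBinomial`. -/
theorem tBinomial_succ_succ {t : C} (ht : IsGeneric t) (r p : ℕ) :
    tBinomial t (r + 1) (p + 1) =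
      t ^ (-((p : ℤ) + 1)) * tBinomial t r (p + 1) + t ^ ((r : ℤ) - p) * tBinomial t r p := by
  have h1 := ht.sub_ne_zero p
  refine mul_right_cancel₀ h1 ?_
  rw [tBinomial_succ_succ_mul ht, add_mul, mul_assoc, mul_assoc]
  conv_rhs => rw [tBinomial, mul_assoc, div_mul_cancel₀ _ h1]
  -- With the common factor removed, Pascal's rule is `[r+1] = t^(-(p+1)) [r-p] + t^(r-p) [p+1]` for
  -- `[m] = t^m - t^(-m)`.
  have e1 : t ^ ((r : ℤ) + 1) = t ^ ((r : ℤ) - p) * t ^ ((p : ℤ) + 1) := by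
    rw [← zpow_add₀ ht.1]; ring_nf
  have e2 : t ^ (-((r : ℤ) + 1)) = t ^ (-((p : ℤ) + 1)) * t ^ (-((r : ℤ) - p)) := by
    rw [← zpow_add₀ ht.1]; ring_nf
  rw [e1, e2]
  ring

theorem map_tBinomial {K K' : Type} [DivisionRing K] [DivisionRing K'] (f : K →+* K') (t : K)
    (r p : ℕ) : f (tBinomial t r p) = tBinomial (f t) r p := by
  induction p with
  | zero => simp [tBinomial]
  | succ p ih => simp [tBinomial, ih, map_zpow₀]

end Binomial

/-! ### Toric maps -/

section Toric

variable {C K V : Type} [Field C] [DivisionRing K] [Algebra C K] [AddCommGroup V]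

/-- `M(x) M(y) = v^(Λ(x,y)) M(x+y)`; here `v` stands for `q^(1/2)`. -/
structure IsToric (v : C) (Λ : LinearMap.BilinForm ℤ V) (M : V → K) : Prop where
  generic : IsGeneric v
  alt : ∀ x, Λ x x = 0
  map_zero : M 0 = 1
  mul : ∀ x y, M x * M y = v ^ Λ x y • M (x + y)

namespace IsToric

variable {v : C} {Λ : LinearMap.BilinForm ℤ V} {M : V → K}

theorem skew (h : IsToric v Λ M) (x y : V) : Λ y x = -Λ x y := by
  have := h.alt (x + y)
  simp only [map_add, LinearMap.add_apply, h.alt] at this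
  omega

theorem zpow_smul_smul (h : IsToric v Λ M) (a b : ℤ) (x : K) : v ^ a • v ^ b • x = v ^ (a + b) • x := by
  rw [smul_smul, zpow_add₀ h.generic.1]

theorem mul_neg_cancel (h : IsToric v Λ M) (x : V) : M x * M (-x) = 1 := by
  rw [h.mul, map_neg, h.alt, neg_zero, zpow_zero, one_smul, add_neg_cancel, h.map_zero]

theorem neg_mul_cancel (h : IsToric v Λ M) (x : V) : M (-x) * M x = 1 := by
  simpa using h.mul_neg_cancel (-x)

theorem ne_zero (h : IsToric v Λ M) (x : V) : M x ≠ 0 := fun h0 => by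
  have := h.mul_neg_cancel x
  rw [h0, zero_mul] at this
  exact zero_ne_one this

theorem inv (h : IsToric v Λ M) (x : V) : (M x)⁻¹ = M (-x) :=
  inv_eq_of_mul_eq_one_right (h.mul_neg_cancel x)

theorem map_add (h : IsToric v Λ M) (x y : V) : M (x + y) = v ^ (-Λ x y) • (M x * M y) := by
  rw [h.mul, h.zpow_smul_smul, neg_add_cancel, zpow_zero, one_smul]

theorem mul_comm (h : IsToric v Λ M) (x y : V) : M x * M y = v ^ (2 * Λ x y) • (M y * M x) := by
  rw [h.mul, h.mul, h.zpow_smul_smul, add_comm y x, h.skew x y]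
  ring_nf

theorem zpow (h : IsToric v Λ M) (x : V) (m : ℤ) : M x ^ m = M (m • x) := by
  induction m using Int.induction_on with
  | zero => simp [h.map_zero]
  | succ m ih =>
    rw [zpow_add_one₀ (h.ne_zero x), ih, h.mul, map_smul, LinearMap.smul_apply, h.alt, smul_zero,
      zpow_zero, one_smul, add_smul, one_smul]
  | pred m ih =>
    rw [zpow_sub_one₀ (h.ne_zero x), ih, h.inv, h.mul, map_neg, map_smul, LinearMap.smul_apply,
      h.alt, smul_zero, neg_zero, zpow_zero, one_smul, sub_smul, one_smul, sub_eq_add_neg]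

end IsToric

end Toric

/-! ### Mutation of toric maps and compatible matrices -/

section Mutation

variable {C K : Type} [Field C] [DivisionRing K] [Algebra C K] {n r : ℕ}

/-- The linear map `E`. -/
def mapE (k : Fin n) (B : Matrix (Fin n ⊕ Fin r) (Fin n) ℤ) :
    (Fin n ⊕ Fin r → ℤ) →ₗ[ℤ] (Fin n ⊕ Fin r → ℤ) := (matrixE k B).mulVecLin

/-- The basis vector of the `k`-th mutable direction. -/
abbrev unitVec (r : ℕ) (k : Fin n) : Fin n ⊕ Fin r → ℤ := Pi.single (Sum.inl k) 1

theorem mapE_apply (k : Fin n) (B : Matrix (Fin n ⊕ Fin r) (Fin n) ℤ) (c : Fin n ⊕ Fin r → ℤ)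
    (i : Fin n ⊕ Fin r) : mapE k B c i =
      if i = Sum.inl k then -c (Sum.inl k) else c i + c (Sum.inl k) * max 0 (-B i k) := by
  have h0 : mapE k B c i = ∑ j, matrixE k B i j * c j := rfl
  rw [h0, ← Finset.add_sum_erase _ _ (Finset.mem_univ (Sum.inl k))]
  have h1 : ∀ j ∈ Finset.univ.erase (Sum.inl k : Fin n ⊕ Fin r),
      matrixE k B i j * c j = if i = j then c j else 0 := by
    intro j hj
    have : j ≠ Sum.inl k := Finset.ne_of_mem_erase hj
    simp [matrixE, this]
  rw [Finset.sum_congr rfl h1, Finset.sum_ite_eq]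
  by_cases hi : i = Sum.inl k
  · simp [matrixE, hi]
  · simp [matrixE, hi]; ring

theorem mapE_of_eq_zero (k : Fin n) (B : Matrix (Fin n ⊕ Fin r) (Fin n) ℤ) {c : Fin n ⊕ Fin r → ℤ}
    (hc : c (Sum.inl k) = 0) : mapE k B c = c := by
  ext i
  rw [mapE_apply]
  split_ifs with h
  · rw [h, hc, neg_zero]
  · rw [hc]; ring

theorem mapE_inl (k : Fin n) (B : Matrix (Fin n ⊕ Fin r) (Fin n) ℤ) (c : Fin n ⊕ Fin r → ℤ) :
    mapE k B c (Sum.inl k) = -c (Sum.inl k) := by simp [mapE_apply]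

theorem mapE_mapE (k : Fin n) (B : Matrix (Fin n ⊕ Fin r) (Fin n) ℤ) (c : Fin n ⊕ Fin r → ℤ) :
    mapE k B (mapE k B c) = c := by
  ext i
  rw [mapE_apply, mapE_inl]
  split_ifs with h
  · rw [h, neg_neg]
  · rw [mapE_apply, if_neg h]; ring

/-- The matrix `-B` gives the map `E` for the opposite sign. The two maps differ by the transvection
along the `k`-th column, because `max 0 b - max 0 (-b) = b`. -/
theorem mapE_neg (k : Fin n) (B : Matrix (Fin n ⊕ Fin r) (Fin n) ℤ)
    (hB : B (Sum.inl k) k = 0) (c : Fin n ⊕ Fin r → ℤ) :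
    mapE k (-B) c = mapE k B c + c (Sum.inl k) • B.col k := by
  ext i
  rw [Pi.add_apply, mapE_apply, mapE_apply]
  split_ifs with h
  · simp [h, hB]
  · simp only [Matrix.neg_apply, neg_neg, Pi.smul_apply, Matrix.col_apply, smul_eq_mul]
    rcases le_total 0 (B i k) with h1 | h1
    · rw [max_eq_right h1, max_eq_left (by omega)]; ring
    · rw [max_eq_left h1, max_eq_right (by omega)]; ring

theorem mutateMatrix_neg (k : Fin n) (B : Matrix (Fin n ⊕ Fin r) (Fin n) ℤ) :
    mutateMatrix k (-B) = -mutateMatrix k B := by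
  ext i j
  simp only [mutateMatrix, Matrix.of_apply, Matrix.neg_apply, Int.sign_neg, neg_mul_neg]
  split_ifs <;> ring

theorem mutateMatrix_mutateMatrix (k : Fin n) (B : Matrix (Fin n ⊕ Fin r) (Fin n) ℤ) :
    mutateMatrix k (mutateMatrix k B) = B := by
  ext i j
  simp only [mutateMatrix, Matrix.of_apply]
  by_cases h1 : i = Sum.inl k ∨ j = k
  · simp [h1]
  · simp [h1, Int.sign_neg]

/-- Mutated columns in terms of the map `E`. -/
theorem col_mutateMatrix (k j : Fin n) (hj : j ≠ k) (B : Matrix (Fin n ⊕ Fin r) (Fin n) ℤ)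
    (hB : B (Sum.inl k) k = 0) :
    (mutateMatrix k B).col j = mapE k B (B.col j) + max 0 (B (Sum.inl k) j) • B.col k := by
  ext i
  simp only [Pi.add_apply, mapE_apply, Matrix.col_apply, Pi.smul_apply, mutateMatrix,
    Matrix.of_apply, hj, or_false, smul_eq_mul]
  by_cases h : i = Sum.inl k
  · simp [h, hB]
  · simp only [h, if_false]
    generalize B i k = x
    generalize B (Sum.inl k) j = y
    generalize B i j = z
    rcases lt_trichotomy x 0 with hx | hx | hx
    · rw [Int.sign_eq_neg_one_of_neg hx, max_eq_right (by omega : (0:ℤ) ≤ -x)]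
      rcases le_total 0 y with hy | hy
      · rw [max_eq_right hy, max_eq_right (by nlinarith)]; ring
      · rw [max_eq_left hy, max_eq_left (by nlinarith)]; ring
    · simp [hx]
    · rw [Int.sign_eq_one_of_pos hx, max_eq_left (by omega : -x ≤ 0)]
      rcases le_total 0 y with hy | hy
      · rw [max_eq_right hy, max_eq_left (by nlinarith)]; ring
      · rw [max_eq_left hy, max_eq_right (by nlinarith)]; ring

theorem col_mutateMatrix_self (k : Fin n) (B : Matrix (Fin n ⊕ Fin r) (Fin n) ℤ) :
    (mutateMatrix k B).col k = -B.col k := by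
  ext i; simp [mutateMatrix]

/-- A toric map together with a compatible exchange matrix. -/
structure IsSeed (v : C) (d : Fin n → ℤ) (Λ : LinearMap.BilinForm ℤ (Fin n ⊕ Fin r → ℤ))
    (S : FrameSeed K n r) : Prop extends IsToric v Λ S.frame where
  -- Only a common sign of the constants is required, so that the notion is stable under `(B, d) ↦
  -- (-B, -d)`. This symmetry later reduces `b_{kl} > 0` to `b_{kl} < 0`.
  d_pos : ∀ i j, 0 < d i * d j
  compat : ∀ j c, Λ (S.matrix.col j) c = d j * c (Sum.inl j)

/-- Mutation of a seed; the scalar `q^(1/2)` is the image of `v`. -/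
noncomputable abbrev seedMutate (v : C) (d : Fin n → ℤ) (k : Fin n) (S : FrameSeed K n r) :
    FrameSeed K n r := S.mutate (algebraMap C K v) d k

/-- The mutated form. -/
noncomputable abbrev mutateForm (k : Fin n) (B : Matrix (Fin n ⊕ Fin r) (Fin n) ℤ)
    (Λ : LinearMap.BilinForm ℤ (Fin n ⊕ Fin r → ℤ)) : LinearMap.BilinForm ℤ (Fin n ⊕ Fin r → ℤ) :=
  Λ.compl₁₂ (mapE k B) (mapE k B)

end Mutation

/-- Pascal's rule summed over `p`: the second half of each summand is shifted by one index, and the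
extra top term vanishes since `tBinomial t m (m+1) = 0`. -/
theorem tBinomial_pascal_sum {C K : Type} [Field C] [AddCommGroup K] [Module C K] {t : C}
    (ht : IsGeneric t) (m : ℕ) (G : ℕ → K) :
    ∑ p ∈ Finset.range (m + 1),
        tBinomial t m p • (t ^ (-(p : ℤ)) • G p + t ^ ((m : ℤ) - p) • G (p + 1)) =
      ∑ p ∈ Finset.range (m + 1 + 1), tBinomial t (m + 1) p • G p := by
  have h1 : ∑ p ∈ Finset.range (m + 1), tBinomial t m p • t ^ (-(p : ℤ)) • G p =
      ∑ p ∈ Finset.range (m + 1), tBinomial t m (p + 1) • t ^ (-((p : ℤ) + 1)) • G (p + 1) +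
        G 0 := by
    have h2 := Finset.sum_range_succ (fun p => tBinomial t m p • t ^ (-(p : ℤ)) • G p) (m + 1)
    rw [tBinomial_eq_zero t (Nat.lt_succ_self m), zero_smul, add_zero] at h2
    rw [← h2, Finset.sum_range_succ']
    simp [tBinomial]
  have h0 : tBinomial t (m + 1) 0 = 1 := rfl
  rw [Finset.sum_range_succ' _ (m + 1), h0, one_smul]
  simp only [smul_add, Finset.sum_add_distrib]
  rw [h1]
  simp only [tBinomial_succ_succ ht, add_smul, smul_smul, Finset.sum_add_distrib,
    mul_comm (tBinomial _ _ _)]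
  abel

attribute [ext] FrameSeed

section Mutation

variable {C K : Type} [Field C] [DivisionRing K] [Algebra C K] {n r : ℕ}

theorem eq_sub_add_smul_unitVec (k : Fin n) (c : Fin n ⊕ Fin r → ℤ) :
    c = (c - c (Sum.inl k) • unitVec r k) + c (Sum.inl k) • unitVec r k := by abel

theorem sub_smul_unitVec_inl (k : Fin n) (c : Fin n ⊕ Fin r → ℤ) :
    (c - c (Sum.inl k) • unitVec r k) (Sum.inl k) = 0 := by simp

/-- A toric map is determined by its values at the vectors with `k`-th coordinate zero and at the
`k`-th basis vector. -/
theorem IsToric.ext_of_unitVec {v : C} {Λ : LinearMap.BilinForm ℤ (Fin n ⊕ Fin r → ℤ)}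
    {M M' : (Fin n ⊕ Fin r → ℤ) → K} (h : IsToric v Λ M) (h' : IsToric v Λ M') (k : Fin n)
    (h0 : ∀ c, c (Sum.inl k) = 0 → M c = M' c) (h1 : M (unitVec r k) = M' (unitVec r k)) :
    M = M' := by
  funext c
  rw [eq_sub_add_smul_unitVec k c, h.map_add, h'.map_add, ← h.zpow, ← h'.zpow, h1,
    h0 _ (sub_smul_unitVec_inl k c)]

/-- Extension of a toric map from the vectors with `k`-th coordinate zero by a quasi-commuting
element. -/
theorem IsToric.extend {v : C} {Λ : LinearMap.BilinForm ℤ (Fin n ⊕ Fin r → ℤ)}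
    (hv : IsGeneric v) (halt : ∀ x, Λ x x = 0) (M : (Fin n ⊕ Fin r → ℤ) → K) (k : Fin n)
    (hM0 : M 0 = 1)
    (hM : ∀ x y, x (Sum.inl k) = 0 → y (Sum.inl k) = 0 → M x * M y = v ^ Λ x y • M (x + y))
    (X : K) (hX : X ≠ 0)
    (hXM : ∀ x, x (Sum.inl k) = 0 → M x * X = v ^ (2 * Λ x (unitVec r k)) • (X * M x)) :
    IsToric v Λ fun c => v ^ (-(c (Sum.inl k) * Λ c (unitVec r k))) •
      (M (c - c (Sum.inl k) • unitVec r k) * X ^ c (Sum.inl k)) := by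
  have hcomm : ∀ x, x (Sum.inl k) = 0 → ∀ m : ℤ,
      X ^ m * M x = v ^ (-(2 * m * Λ x (unitVec r k))) • (M x * X ^ m) := by
    intro x hx m
    have h1 : SemiconjBy (M x) X (v ^ (2 * Λ x (unitVec r k)) • X) := by
      rw [SemiconjBy, hXM x hx, smul_mul_assoc]
    have h2 := h1.zpow_right₀ m
    have h3 : (v ^ (2 * Λ x (unitVec r k)) • X) ^ m = v ^ (2 * m * Λ x (unitVec r k)) • X ^ m := by
      rw [Algebra.smul_def, (show Commute _ X from Algebra.commutes _ _).mul_zpow, ← map_zpow₀, ← zpow_mul,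
        ← Algebra.smul_def]
      ring_nf
    rw [h3, SemiconjBy, smul_mul_assoc] at h2
    rw [h2, smul_smul, ← zpow_add₀ hv.1, neg_add_cancel, zpow_zero, one_smul]
  have hskew : ∀ x y, Λ y x = -Λ x y := fun x y => (LinearMap.IsAlt.neg halt x y).symm
  refine ⟨hv, halt, by simp [hM0], fun x y => ?_⟩
  have hx := sub_smul_unitVec_inl k x
  have hy := sub_smul_unitVec_inl k y
  simp only [Pi.add_apply]
  rw [smul_mul_smul_comm, mul_assoc, ← mul_assoc (X ^ _), hcomm _ hy, smul_mul_assoc,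
    mul_smul_comm, mul_assoc (M _), ← zpow_add₀ hX, ← mul_assoc, hM _ _ hx hy, smul_mul_assoc,
    smul_smul, smul_smul, smul_smul, ← zpow_add₀ hv.1, ← zpow_add₀ hv.1, ← zpow_add₀ hv.1,
    ← zpow_add₀ hv.1]
  have e : x - x (Sum.inl k) • unitVec r k + (y - y (Sum.inl k) • unitVec r k) =
      x + y - (x (Sum.inl k) + y (Sum.inl k)) • unitVec r k := by
    rw [add_smul]; abel
  rw [e]
  congr 2
  simp only [_root_.map_sub, _root_.map_add, map_smul, LinearMap.sub_apply, LinearMap.add_apply,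
    LinearMap.smul_apply, smul_eq_mul, halt, hskew y (unitVec r k)]
  ring

namespace IsSeed

variable {v : C} {d : Fin n → ℤ} {Λ : LinearMap.BilinForm ℤ (Fin n ⊕ Fin r → ℤ)}
  {S : FrameSeed K n r}

theorem compat_right (h : IsSeed v d Λ S) (j : Fin n) (c : Fin n ⊕ Fin r → ℤ) :
    Λ c (S.matrix.col j) = -(d j * c (Sum.inl j)) := by
  rw [h.skew (S.matrix.col j) c, h.compat]

theorem d_ne (h : IsSeed v d Λ S) (i : Fin n) : d i ≠ 0 := fun h0 => by
  have := h.d_pos i i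
  rw [h0] at this
  omega

theorem diag (h : IsSeed v d Λ S) (k : Fin n) : S.matrix (Sum.inl k) k = 0 := by
  have h1 := h.compat k (S.matrix.col k)
  rw [h.alt] at h1
  exact (mul_eq_zero.1 h1.symm).resolve_left (h.d_ne k)

theorem skew_matrix (h : IsSeed v d Λ S) (i j : Fin n) :
    d i * S.matrix (Sum.inl i) j = -(d j * S.matrix (Sum.inl j) i) := by
  have h1 := h.compat i (S.matrix.col j)
  rw [h.compat_right] at h1
  exact h1.symm

theorem matrix_nonpos (h : IsSeed v d Λ S) {i j : Fin n} (hij : 0 ≤ S.matrix (Sum.inl i) j) :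
    S.matrix (Sum.inl j) i ≤ 0 := by
  have h1 := h.skew_matrix i j
  have h2 := mul_nonneg (h.d_pos i j).le hij
  have h3 : d j * d j * S.matrix (Sum.inl j) i ≤ 0 := by linear_combination h2 + d j * h1
  exact nonpos_of_mul_nonpos_right h3 (h.d_pos j j)

theorem matrix_nonneg (h : IsSeed v d Λ S) {i j : Fin n} (hij : S.matrix (Sum.inl i) j ≤ 0) :
    0 ≤ S.matrix (Sum.inl j) i := by
  have h1 := h.skew_matrix i j
  have h2 := mul_nonpos_of_nonneg_of_nonpos (h.d_pos i j).le hij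
  have h3 : 0 ≤ d j * d j * S.matrix (Sum.inl j) i := by linear_combination h2 - d j * h1
  exact nonneg_of_mul_nonneg_right h3 (h.d_pos j j)

theorem matrix_eq_zero (h : IsSeed v d Λ S) {i j : Fin n} (hij : S.matrix (Sum.inl i) j = 0) :
    S.matrix (Sum.inl j) i = 0 := by
  have := h.skew_matrix i j
  rw [hij, mul_zero, eq_comm, neg_eq_zero] at this
  exact (mul_eq_zero.1 this).resolve_left (h.d_ne j)

theorem mapE_col (h : IsSeed v d Λ S) (k : Fin n) :
    mapE k S.matrix (S.matrix.col k) = S.matrix.col k := mapE_of_eq_zero _ _ (h.diag k)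

theorem compat_mapE (h : IsSeed v d Λ S) (k : Fin n) (c : Fin n ⊕ Fin r → ℤ) :
    Λ (S.matrix.col k) (mapE k S.matrix c) = -(d k * c (Sum.inl k)) := by
  rw [h.compat, mapE_inl]; ring

/-- Since `E` is an involution fixing `b^k`, applying it to the mutated column `j` gives `b^j +
max(0, b_{kj}) b^k`. Pairing this with `E c`, the contributions of `c_k` cancel because `d_j b_{jk}
= -d_k b_{kj}`. -/
theorem compat_mutate (h : IsSeed v d Λ S) (k j : Fin n) (c : Fin n ⊕ Fin r → ℤ) :
    mutateForm k S.matrix Λ ((mutateMatrix k S.matrix).col j) c = d j * c (Sum.inl j) := by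
  rw [LinearMap.compl₁₂_apply]
  by_cases hj : j = k
  · subst hj
    rw [col_mutateMatrix_self, map_neg, h.mapE_col, map_neg, LinearMap.neg_apply, h.compat_mapE,
      neg_neg]
  · rw [col_mutateMatrix k j hj _ (h.diag k), map_add, mapE_mapE, map_smul, h.mapE_col, map_add,
      map_smul, LinearMap.add_apply, LinearMap.smul_apply, h.compat_mapE, h.compat, mapE_apply,
      if_neg (by simpa using hj)]
    have h1 := h.skew_matrix j k
    rw [smul_eq_mul]
    rcases le_total 0 (S.matrix (Sum.inl k) j) with h2 | h2
    · rw [max_eq_right h2, max_eq_right (by have := h.matrix_nonpos h2; omega)]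
      linear_combination -c (Sum.inl k) * h1
    · rw [max_eq_left h2, max_eq_left (by have := h.matrix_nonneg h2; omega)]
      ring

/-- The summand of index `p` in the mutation formula has non-negative top coordinate at `0`. -/
theorem frame_aux_of_eq_zero (k : Fin n) {c : Fin n ⊕ Fin r → ℤ} (hc : c (Sum.inl k) = 0) :
    S.mutateFrameAux (algebraMap C K v) d k c = S.frame c := by
  have : (matrixE k S.matrix).mulVec c = c := mapE_of_eq_zero k S.matrix hc
  simp [FrameSeed.mutateFrameAux, hc, tBinomial, this]

theorem tBinomial_mul (t : C) (m p : ℕ) (x : K) :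
    tBinomial (algebraMap C K t) m p * x = tBinomial t m p • x := by
  rw [← map_tBinomial, Algebra.smul_def]

theorem frame_aux_eq (k : Fin n) (c : Fin n ⊕ Fin r → ℤ) :
    S.mutateFrameAux (algebraMap C K v) d k c =
      ∑ p ∈ Finset.range ((c (Sum.inl k)).toNat + 1), tBinomial (v ^ d k) (c (Sum.inl k)).toNat p •
        S.frame (mapE k S.matrix c + (p : ℤ) • S.matrix.col k) := by
  refine Finset.sum_congr rfl fun p _ => ?_
  rw [← map_zpow₀, tBinomial_mul]
  rfl

/-- The new cluster variable. -/
noncomputable def newVar (k : Fin n) (S : FrameSeed K n r) : K :=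
  S.frame (mapE k S.matrix (unitVec r k)) + S.frame (mapE k S.matrix (unitVec r k) + S.matrix.col k)

/-- Each monomial `M(Ec + p b^k)` times the binomial `newVar` yields the two consecutive monomials
of index `p` and `p+1`, with weights `t^(-p)` and `t^(m-p)` for `t = v^(d_k)`. These are the weights
in `tBinomial_pascal_sum`. -/
theorem frame_aux_mul_newVar (h : IsSeed v d Λ S) (k : Fin n) {c : Fin n ⊕ Fin r → ℤ}
    (hc : 0 ≤ c (Sum.inl k)) :
    S.mutateFrameAux (algebraMap C K v) d k c * newVar k S =
      v ^ mutateForm k S.matrix Λ c (unitVec r k) •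
        S.mutateFrameAux (algebraMap C K v) d k (c + unitVec r k) := by
  obtain ⟨m, hm⟩ := Int.eq_ofNat_of_zero_le hc
  have hm' : (c + unitVec r k) (Sum.inl k) = ((m + 1 : ℕ) : ℤ) := by simp [hm]
  have ht : IsGeneric (v ^ d k) := h.generic.zpow (h.d_ne k)
  rw [frame_aux_eq, frame_aux_eq, hm, hm', Int.toNat_natCast, Int.toNat_natCast]
  set u := mapE k S.matrix (unitVec r k)
  set b := S.matrix.col k
  set e := mapE k S.matrix c
  have hΛ : mutateForm k S.matrix Λ c (unitVec r k) = Λ e u := rfl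
  have heu : mapE k S.matrix (c + unitVec r k) = e + u := map_add _ _ _
  have hbu : Λ b u = -d k := by
    rw [h.compat_mapE]; simp
  have heb : Λ e b = d k * m := by
    have : e (Sum.inl k) = -m := by rw [← hm]; exact mapE_inl _ _ _
    rw [h.compat_right, this]; ring
  have hnew : newVar k S = S.frame u + S.frame (u + b) := rfl
  have hterm : ∀ p : ℕ, S.frame (e + (p : ℤ) • b) * newVar k S = v ^ Λ e u •
      ((v ^ d k) ^ (-(p : ℤ)) • S.frame (e + u + (p : ℤ) • b) +
        (v ^ d k) ^ ((m : ℤ) - p) • S.frame (e + u + ((p + 1 : ℕ) : ℤ) • b)) := by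
    intro p
    rw [hnew, mul_add, h.mul, h.mul, smul_add, ← zpow_mul, ← zpow_mul, h.zpow_smul_smul,
      h.zpow_smul_smul]
    congr 2
    · simp only [map_add, map_smul, LinearMap.add_apply, LinearMap.smul_apply, hbu, smul_eq_mul]
      ring_nf
    · congr 1; abel
    · simp only [map_add, map_smul, LinearMap.add_apply, LinearMap.smul_apply, hbu, heb, h.alt,
        smul_eq_mul]
      ring_nf
    · congr 1; push_cast; rw [add_smul, one_smul]; abel
  rw [Finset.sum_mul, heu, hΛ, ← tBinomial_pascal_sum ht m fun p => S.frame (e + u + (p : ℤ) • b),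
    Finset.smul_sum]
  refine Finset.sum_congr rfl fun p _ => ?_
  rw [smul_mul_assoc, hterm, smul_comm]

/-- The two monomials of the new variable differ by `b^k`, and `Λ(x, b^k) = 0` when `x_k = 0`; so
both commute with `M(x)` up to the same power of `v`. -/
theorem frame_mul_comm_newVar (h : IsSeed v d Λ S) (k : Fin n) {x : Fin n ⊕ Fin r → ℤ}
    (hx : x (Sum.inl k) = 0) : S.frame x * newVar k S =
      v ^ (2 * mutateForm k S.matrix Λ x (unitVec r k)) • (newVar k S * S.frame x) := by
  have h1 : Λ x (S.matrix.col k) = 0 := by rw [h.compat_right, hx]; ring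
  have h2 : mutateForm k S.matrix Λ x (unitVec r k) = Λ x (mapE k S.matrix (unitVec r k)) := by
    rw [LinearMap.compl₁₂_apply, mapE_of_eq_zero _ _ hx]
  rw [newVar, mul_add, add_mul, h.mul_comm, h.mul_comm x (_ + _), h2, smul_add]
  simp [h1]

/-- Otherwise `M(b^k)` would be a scalar and commute with `M(e_k)`, whereas the two commute only up
to the factor `v^(2 d_k) ≠ 1`. -/
theorem one_add_smul_frame_ne_zero (h : IsSeed v d Λ S) (k : Fin n) (a : ℤ) :
    1 + v ^ a • S.frame (S.matrix.col k) ≠ 0 := by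
  intro h0
  have h1 : v ^ a • S.frame (S.matrix.col k) = -1 := eq_neg_of_add_eq_zero_right h0
  have h2 := h.mul_comm (S.matrix.col k) (unitVec r k)
  rw [h.compat, show unitVec r k (Sum.inl k) = 1 from Pi.single_eq_same _ _, mul_one] at h2
  have h3 := congrArg (v ^ a • ·) h2
  rw [← smul_mul_assoc, smul_comm, ← mul_smul_comm, h1, neg_one_mul, mul_neg_one] at h3
  have h4 : (1 - v ^ (2 * d k)) • S.frame (unitVec r k) = 0 := by
    rw [sub_smul, one_smul, sub_eq_zero, ← neg_inj, h3, smul_neg]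
  rcases smul_eq_zero.1 h4 with h5 | h5
  · have := h.generic.2 _ (sub_eq_zero.1 h5).symm
    exact h.d_ne k (by omega)
  · exact h.ne_zero _ h5

theorem add_frame_col (h : IsSeed v d Λ S) (k : Fin n) (c : Fin n ⊕ Fin r → ℤ) :
    S.frame c + S.frame (c + S.matrix.col k) =
      (1 + v ^ (-(d k * c (Sum.inl k))) • S.frame (S.matrix.col k)) * S.frame c := by
  rw [add_mul, one_mul, smul_mul_assoc, h.mul, h.compat, h.zpow_smul_smul, neg_add_cancel, zpow_zero,
    one_smul, add_comm (S.matrix.col k)]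

theorem newVar_ne_zero (h : IsSeed v d Λ S) (k : Fin n) : newVar k S ≠ 0 := by
  rw [newVar, h.add_frame_col]
  exact mul_ne_zero (h.one_add_smul_frame_ne_zero k _) (h.ne_zero _)

/-- The mutated form in terms of the original one. -/
theorem mutateForm_alt (h : IsSeed v d Λ S) (k : Fin n) (x : Fin n ⊕ Fin r → ℤ) :
    mutateForm k S.matrix Λ x x = 0 := h.alt _

theorem isToric_extend (h : IsSeed v d Λ S) (k : Fin n) :
    IsToric v (mutateForm k S.matrix Λ) fun c =>
      v ^ (-(c (Sum.inl k) * mutateForm k S.matrix Λ c (unitVec r k))) •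
        (S.frame (c - c (Sum.inl k) • unitVec r k) * newVar k S ^ c (Sum.inl k)) := by
  refine IsToric.extend h.generic (h.mutateForm_alt k) S.frame k h.map_zero ?_ _
    (h.newVar_ne_zero k) fun x hx => h.frame_mul_comm_newVar k hx
  intro x y hx hy
  rw [h.mul, LinearMap.compl₁₂_apply, mapE_of_eq_zero _ _ hx, mapE_of_eq_zero _ _ hy]

/-- Induction on `c_k` by `frame_aux_mul_newVar`. It identifies the binomial sum with a normalized
monomial in the new cluster, so that the mutated frame is toric by `IsToric.extend`. -/
theorem frame_aux_eq_extend (h : IsSeed v d Λ S) (k : Fin n) {c : Fin n ⊕ Fin r → ℤ}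
    (hc : 0 ≤ c (Sum.inl k)) : S.mutateFrameAux (algebraMap C K v) d k c =
      v ^ (-(c (Sum.inl k) * mutateForm k S.matrix Λ c (unitVec r k))) •
        (S.frame (c - c (Sum.inl k) • unitVec r k) * newVar k S ^ c (Sum.inl k)) := by
  obtain ⟨m, hm⟩ := Int.eq_ofNat_of_zero_le hc
  induction m generalizing c with
  | zero =>
    have hm' : c (Sum.inl k) = 0 := by simpa using hm
    rw [frame_aux_of_eq_zero k hm', hm']
    simp
  | succ m ih =>
    have hm' : (c - unitVec r k) (Sum.inl k) = m := by simp [hm]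
    have ih' := ih (by rw [hm']; positivity) hm'
    have h1 := h.frame_aux_mul_newVar k (c := c - unitVec r k) (by rw [hm']; positivity)
    rw [sub_add_cancel, ih', hm'] at h1
    rw [hm]
    have h2 : c - unitVec r k - (m : ℤ) • unitVec r k = c - ((m + 1 : ℕ) : ℤ) • unitVec r k := by
      push_cast; rw [add_smul, one_smul]; abel
    rw [h2, smul_mul_assoc, mul_assoc, ← zpow_add_one₀ (h.newVar_ne_zero k)] at h1
    have h3 := congrArg (v ^ (-mutateForm k S.matrix Λ (c - unitVec r k) (unitVec r k)) • ·) h1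
    simp only [h.zpow_smul_smul, neg_add_cancel, zpow_zero, one_smul] at h3
    rw [← h3, map_sub, LinearMap.sub_apply, h.mutateForm_alt]
    push_cast
    ring_nf

theorem frame_seedMutate (h : IsSeed v d Λ S) (k : Fin n) (c : Fin n ⊕ Fin r → ℤ) :
    (seedMutate v d k S).frame c =
      v ^ (-(c (Sum.inl k) * mutateForm k S.matrix Λ c (unitVec r k))) •
        (S.frame (c - c (Sum.inl k) • unitVec r k) * newVar k S ^ c (Sum.inl k)) := by
  simp only [FrameSeed.mutate]
  split_ifs with hc
  · exact h.frame_aux_eq_extend k hc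
  · rw [h.frame_aux_eq_extend k (c := -c) (by simp; omega)]
    -- For a toric map, inverting the value at `-c` gives the value at `c`, so the two branches of
    -- the definition obey one formula.
    exact ((h.isToric_extend k).inv (-c)).trans (by rw [neg_neg])

theorem seedMutate_isSeed (h : IsSeed v d Λ S) (k : Fin n) :
    IsSeed v d (mutateForm k S.matrix Λ) (seedMutate v d k S) where
  toIsToric := by
    rw [funext (h.frame_seedMutate k)]
    exact h.isToric_extend k
  d_pos := h.d_pos
  compat := h.compat_mutate k

theorem frame_seedMutate_of_eq_zero (k : Fin n) {c : Fin n ⊕ Fin r → ℤ}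
    (hc : c (Sum.inl k) = 0) : (seedMutate v d k S).frame c = S.frame c := by
  simp only [FrameSeed.mutate]
  rw [if_pos hc.ge, frame_aux_of_eq_zero k hc]

theorem frame_seedMutate_of_nonneg (k : Fin n) {c : Fin n ⊕ Fin r → ℤ}
    (hc : 0 ≤ c (Sum.inl k)) : (seedMutate v d k S).frame c =
      ∑ p ∈ Finset.range ((c (Sum.inl k)).toNat + 1), tBinomial (v ^ d k) (c (Sum.inl k)).toNat p •
        S.frame (mapE k S.matrix c + (p : ℤ) • S.matrix.col k) := by
  simp only [FrameSeed.mutate]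
  rw [if_pos hc, frame_aux_eq]

theorem tBinomial_one_one {t : C} (ht : IsGeneric t) : tBinomial t 1 1 = 1 := by
  rw [tBinomial_succ_succ ht, tBinomial_eq_zero t (by omega : 0 < 0 + 1)]
  simp [tBinomial]

theorem frame_seedMutate_of_eq_one (h : IsSeed v d Λ S) (k : Fin n) {c : Fin n ⊕ Fin r → ℤ}
    (hc : c (Sum.inl k) = 1) : (seedMutate v d k S).frame c =
      S.frame (mapE k S.matrix c) + S.frame (mapE k S.matrix c + S.matrix.col k) := by
  rw [frame_seedMutate_of_nonneg k (by rw [hc]; exact zero_le_one), hc]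
  have h0 : tBinomial (v ^ d k) 1 0 = 1 := rfl
  simp [Finset.sum_range_succ, tBinomial_one_one (h.generic.zpow (h.d_ne k)), h0]

/-- Mutation negates the `k`-th column, the only column on which `E` depends; so this is `mapE_neg`
again. -/
theorem mapE_mapE_mutate (k : Fin n) (B : Matrix (Fin n ⊕ Fin r) (Fin n) ℤ)
    (hB : B (Sum.inl k) k = 0) (c : Fin n ⊕ Fin r → ℤ) :
    mapE k (mutateMatrix k B) c = mapE k B c + c (Sum.inl k) • B.col k := by
  rw [← mapE_neg k B hB]
  ext i
  simp [mapE_apply, mutateMatrix]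

/-- Mutation of seeds is involutive. -/
theorem seedMutate_seedMutate (h : IsSeed v d Λ S) (k : Fin n) :
    seedMutate v d k (seedMutate v d k S) = S := by
  have h1 := h.seedMutate_isSeed k
  have h2 := h1.seedMutate_isSeed k
  have hE : ∀ c, mapE k S.matrix (mapE k (mutateMatrix k S.matrix) c) =
      c + c (Sum.inl k) • S.matrix.col k := fun c => by
    rw [mapE_mapE_mutate k _ (h.diag k), map_add, mapE_mapE, map_smul, h.mapE_col]
  -- The composite of the two maps `E` is the transvection `c ↦ c + c_k b^k`, which is an isometry
  -- of `Λ` by compatibility.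
  have hform : mutateForm k (seedMutate v d k S).matrix (mutateForm k S.matrix Λ) = Λ := by
    refine LinearMap.ext fun x => LinearMap.ext fun y => ?_
    have e : mutateForm k (seedMutate v d k S).matrix (mutateForm k S.matrix Λ) x y =
      Λ (mapE k S.matrix (mapE k (mutateMatrix k S.matrix) x))
        (mapE k S.matrix (mapE k (mutateMatrix k S.matrix) y)) := rfl
    rw [e, hE, hE]
    simp only [map_add, map_smul, LinearMap.add_apply, LinearMap.smul_apply, h.compat,
      h.compat_right, smul_eq_mul, Matrix.col_apply, h.diag]
    ring
  have h2' := h2.toIsToric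
  rw [hform] at h2'
  have hM : (seedMutate v d k (seedMutate v d k S)).frame = S.frame := by
    refine h2'.ext_of_unitVec h.toIsToric k (fun c hc => ?_) ?_
    · rw [frame_seedMutate_of_eq_zero k hc, frame_seedMutate_of_eq_zero k hc]
    · have e1 : unitVec r k (Sum.inl k) = 1 := Pi.single_eq_same _ _
      have e2 : mapE k (seedMutate v d k S).matrix (unitVec r k) =
          mapE k S.matrix (unitVec r k) + S.matrix.col k := by
        refine (mapE_mapE_mutate k _ (h.diag k) _).trans ?_
        rw [e1, one_smul]
      have e3 : (seedMutate v d k S).matrix.col k = -S.matrix.col k := col_mutateMatrix_self k _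
      have e4 := mapE_inl k S.matrix (unitVec r k)
      -- After multiplication by the new variable, both sides are the right-hand side of the same
      -- exchange relation; only the order of the two monomials is swapped.
      refine mul_left_cancel₀ (h1.ne_zero (unitVec r k)) ?_
      rw [h1.frame_seedMutate_of_eq_one k e1, e2, e3, add_neg_cancel_right, mul_add, h1.mul, h1.mul,
        frame_seedMutate_of_eq_zero k (by simp [e4, h.diag]),
        frame_seedMutate_of_eq_zero k (by simp [e4]), h.frame_seedMutate_of_eq_one k e1, add_mul,
        h.mul, h.mul, add_comm]
      congr 3
      · rw [LinearMap.compl₁₂_apply, mapE_mapE]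
      · exact add_comm _ _
      · rw [LinearMap.compl₁₂_apply, map_add, mapE_mapE, h.mapE_col, map_add, map_add,
          LinearMap.add_apply, h.compat, h.compat_right, e4, e1]
        ring
      · exact add_comm _ _
  have hB : (seedMutate v d k (seedMutate v d k S)).matrix = S.matrix :=
    mutateMatrix_mutateMatrix k S.matrix
  exact FrameSeed.ext hM hB

/-- Mutation does not depend on the choice of sign. -/
theorem neg (h : IsSeed v d Λ S) : IsSeed v (-d) Λ ⟨S.frame, -S.matrix⟩ where
  toIsToric := h.toIsToric
  d_pos i j := by simpa using h.d_pos i j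
  compat j c := by
    have := h.compat j c
    have e : (-S.matrix).col j = -S.matrix.col j := rfl
    simp [e, this]

/-- Passing to `-B` replaces `E` by its version for the other sign, which exchanges the two
monomials of the new variable and leaves the mutated form unchanged. -/
theorem frame_seedMutate_neg (h : IsSeed v d Λ S) (k : Fin n) :
    (seedMutate v (-d) k ⟨S.frame, -S.matrix⟩).frame = (seedMutate v d k S).frame := by
  have h1 := h.neg.seedMutate_isSeed k
  have hform : mutateForm k (-S.matrix) Λ = mutateForm k S.matrix Λ := by
    refine LinearMap.ext fun x => LinearMap.ext fun y => ?_
    rw [LinearMap.compl₁₂_apply, LinearMap.compl₁₂_apply, mapE_neg _ _ (h.diag k),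
      mapE_neg _ _ (h.diag k)]
    simp only [map_add, map_smul, LinearMap.add_apply, LinearMap.smul_apply, h.compat,
      h.compat_right, smul_eq_mul, Matrix.col_apply, h.diag, mapE_inl]
    ring
  rw [hform] at h1
  have e1 : unitVec r k (Sum.inl k) = 1 := Pi.single_eq_same _ _
  refine h1.toIsToric.ext_of_unitVec (h.seedMutate_isSeed k).toIsToric k (fun c hc => ?_) ?_
  · rw [frame_seedMutate_of_eq_zero k hc, frame_seedMutate_of_eq_zero k hc]
  · have e2 : (-S.matrix).col k = -S.matrix.col k := rfl
    rw [h.neg.frame_seedMutate_of_eq_one k e1, h.frame_seedMutate_of_eq_one k e1,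
      mapE_neg _ _ (h.diag k), e1, one_smul, e2, add_neg_cancel_right, add_comm]

end IsSeed

end Mutation

/-! ### Laurent polynomials in a toric frame -/

section Span

variable {C K V : Type} [Field C] [DivisionRing K] [Algebra C K]

/-- The `ℤ[v^(±1)]`-span of the elements `M(x)` with `Q x`. -/
def laurentSpan (v : C) (M : V → K) (Q : V → Prop) : AddSubgroup K :=
  AddSubgroup.closure {z | ∃ (a : ℤ) (x : V), Q x ∧ z = v ^ a • M x}

/-- The sums of eigenvectors of the conjugation by `w` with eigenvalues `v^m`, `P m`. -/
def eigenSpan (v : C) (w : K) (P : ℤ → Prop) : AddSubgroup K :=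
  AddSubgroup.closure {z | ∃ m : ℤ, P m ∧ w * z = v ^ m • (z * w)}

/-- Conjugation `z ↦ w z w⁻¹` is linear over the central field, so eigenvectors for distinct
eigenvalues are independent, and `v^m` determines `m` as `v` is generic. With `w = M(e)` this
provides gradings inside the skew-field, replacing an appeal to linear independence of the
monomials. -/
theorem eigenSpan_disjoint {v : C} (hv : IsGeneric v) {w : K} (hw : w ≠ 0) {P P' : ℤ → Prop}
    (hP : ∀ m, P m → ¬P' m) {z : K} (hz : z ∈ eigenSpan v w P) (hz' : z ∈ eigenSpan v w P') :
    z = 0 := by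
  let T : Module.End C K :=
    (LinearMap.mulRight C w⁻¹).comp (LinearMap.mulLeft C w)
  have hind : iSupIndep fun m : ℤ => T.eigenspace (v ^ m) :=
    T.eigenspaces_iSupIndep.comp hv.zpow_injective
  have key : ∀ R : ℤ → Prop, ∀ y ∈ eigenSpan v w R, y ∈ ⨆ m ∈ {m | R m}, T.eigenspace (v ^ m) := by
    intro R y hy
    induction hy using AddSubgroup.closure_induction with
    | mem x hx =>
      obtain ⟨m, hm, h⟩ := hx
      refine Submodule.mem_iSup_of_mem m (Submodule.mem_iSup_of_mem hm ?_)
      rw [Module.End.mem_eigenspace_iff]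
      simp [T, h, mul_assoc, mul_inv_cancel₀ hw]
    | zero => exact zero_mem _
    | add x y _ _ hx hy => exact add_mem hx hy
    | neg x _ hx => exact neg_mem hx
  have hd : Disjoint {m | P m} {m | P' m} := Set.disjoint_left.2 hP
  exact (Submodule.disjoint_def.1 (hind.disjoint_biSup_biSup hd)) z (key _ _ hz) (key _ _ hz')

section

variable {v : C} {M : V → K} {Q Q' : V → Prop}

theorem smul_mem_laurentSpan (a : ℤ) {x : V} (hx : Q x) : v ^ a • M x ∈ laurentSpan v M Q :=
  AddSubgroup.subset_closure ⟨a, x, hx, rfl⟩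

theorem mem_laurentSpan {x : V} (hx : Q x) : M x ∈ laurentSpan v M Q := by
  simpa using smul_mem_laurentSpan (v := v) (M := M) 0 hx

theorem laurentSpan_mono (h : ∀ x, Q x → Q' x) : laurentSpan v M Q ≤ laurentSpan v M Q' :=
  AddSubgroup.closure_mono fun _ ⟨a, x, hx, e⟩ => ⟨a, x, h x hx, e⟩

/-- Induction principle: an additive subgroup containing the generators contains the span. -/
theorem laurentSpan_le {G : AddSubgroup K} (h : ∀ (a : ℤ) x, Q x → v ^ a • M x ∈ G) :
    laurentSpan v M Q ≤ G := by
  rw [laurentSpan, AddSubgroup.closure_le]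
  rintro _ ⟨a, x, hx, rfl⟩
  exact h a x hx

theorem zpow_smul_mem_laurentSpan (hv : IsGeneric v) (a : ℤ) {z : K}
    (hz : z ∈ laurentSpan v M Q) : v ^ a • z ∈ laurentSpan v M Q := by
  have : laurentSpan v M Q ≤
      (laurentSpan v M Q).comap (DistribSMul.toAddMonoidHom K (v ^ a)) :=
    laurentSpan_le fun b x hx => by
      simp only [AddSubgroup.mem_comap, DistribSMul.toAddMonoidHom_apply, smul_smul,
        ← zpow_add₀ hv.1]
      exact smul_mem_laurentSpan _ hx
  exact this hz

theorem laurentSpan_split (P : V → Prop) {z : K} (hz : z ∈ laurentSpan v M Q) :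
    ∃ z₁ ∈ laurentSpan v M (fun x => Q x ∧ P x), ∃ z₂ ∈ laurentSpan v M (fun x => Q x ∧ ¬P x),
      z = z₁ + z₂ := by
  have : laurentSpan v M Q ≤ laurentSpan v M (fun x => Q x ∧ P x) ⊔
      laurentSpan v M (fun x => Q x ∧ ¬P x) := laurentSpan_le fun a x hx => by
    by_cases h : P x
    · exact AddSubgroup.mem_sup_left (smul_mem_laurentSpan a ⟨hx, h⟩)
    · exact AddSubgroup.mem_sup_right (smul_mem_laurentSpan a ⟨hx, h⟩)
  obtain ⟨a, ha, b, hb, h⟩ := AddSubgroup.mem_sup.1 (this hz)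
  exact ⟨a, ha, b, hb, h.symm⟩

/-- All Laurent polynomials in the toric frame. -/
abbrev laurentRing (v : C) (M : V → K) : AddSubgroup K := laurentSpan v M fun _ => True

theorem mem_laurentRing (v : C) (M : V → K) (x : V) : M x ∈ laurentRing v M :=
  mem_laurentSpan trivial

namespace IsToric

variable [AddCommGroup V] {Λ : LinearMap.BilinForm ℤ V}

theorem mul_mem_laurentSpan (h : IsToric v Λ M) {Q₁ Q₂ : V → Prop}
    (hQ : ∀ x y, Q₁ x → Q₂ y → Q (x + y)) {z w : K} (hz : z ∈ laurentSpan v M Q₁)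
    (hw : w ∈ laurentSpan v M Q₂) : z * w ∈ laurentSpan v M Q := by
  have h1 : laurentSpan v M Q₁ ≤ (laurentSpan v M Q).comap (AddMonoidHom.mulRight w) :=
    laurentSpan_le fun a x hx => by
      have h2 : laurentSpan v M Q₂ ≤
          (laurentSpan v M Q).comap (AddMonoidHom.mulLeft (v ^ a • M x)) :=
        laurentSpan_le fun b y hy => by
          change (v ^ a • M x) * (v ^ b • M y) ∈ laurentSpan v M Q
          rw [smul_mul_smul_comm, h.mul, smul_smul, ← zpow_add₀ h.generic.1,
            ← zpow_add₀ h.generic.1]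
          exact smul_mem_laurentSpan _ (hQ x y hx hy)
      exact h2 hw
  exact h1 hz

theorem laurentSpan_le_eigenSpan (h : IsToric v Λ M) (e : V) {P : ℤ → Prop}
    (hP : ∀ x, Q x → P (2 * Λ e x)) : laurentSpan v M Q ≤ eigenSpan v (M e) P :=
  laurentSpan_le fun a x hx => AddSubgroup.subset_closure ⟨2 * Λ e x, hP x hx, by
    rw [mul_smul_comm, h.mul_comm, smul_mul_assoc, smul_comm]⟩

/-- Inside the span, an eigenvector for the conjugation by `M(e)` is a combination of the
monomials that are eigenvectors for the same eigenvalue. -/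
theorem mem_laurentSpan_of_eigen (h : IsToric v Λ M) (e : V) {m : ℤ} {z : K}
    (hz : z ∈ laurentSpan v M Q) (hm : M e * z = v ^ (2 * m) • (z * M e)) :
    z ∈ laurentSpan v M fun x => Q x ∧ Λ e x = m := by
  obtain ⟨z₁, h₁, z₂, h₂, rfl⟩ := laurentSpan_split (fun x => Λ e x = m) hz
  have e1 : z₂ ∈ eigenSpan v (M e) (· = 2 * m) := by
    have h3 : z₁ + z₂ ∈ eigenSpan v (M e) (· = 2 * m) :=
      AddSubgroup.subset_closure ⟨_, rfl, hm⟩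
    have h4 := h.laurentSpan_le_eigenSpan e (P := (· = 2 * m)) (fun x hx => by rw [hx.2]) h₁
    simpa using sub_mem h3 h4
  have e2 := h.laurentSpan_le_eigenSpan e (P := (· ≠ 2 * m)) (fun x hx => by
    have := hx.2; omega) h₂
  have : z₂ = 0 := eigenSpan_disjoint h.generic (h.ne_zero e) (fun m hm => by simpa using hm) e1 e2
  rwa [this, add_zero]

theorem mul_mem_laurentRing (h : IsToric v Λ M) {z w : K} (hz : z ∈ laurentRing v M)
    (hw : w ∈ laurentRing v M) : z * w ∈ laurentRing v M :=
  h.mul_mem_laurentSpan (fun _ _ _ _ => trivial) hz hw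

theorem mem_laurentRing_of_mul (h : IsToric v Λ M) (x : V) {z : K}
    (hz : M x * z ∈ laurentRing v M) : z ∈ laurentRing v M := by
  have := h.mul_mem_laurentRing (mem_laurentRing v M (-x)) hz
  rwa [← mul_assoc, h.neg_mul_cancel, one_mul] at this

theorem mem_laurentRing_of_smul (h : IsToric v Λ M) (a : ℤ) {z : K}
    (hz : v ^ a • z ∈ laurentRing v M) : z ∈ laurentRing v M := by
  have := zpow_smul_mem_laurentSpan h.generic (-a) hz
  rwa [h.zpow_smul_smul, neg_add_cancel, zpow_zero, one_smul] at this

/-- Elements of the span are combinations of monomials of bounded degree. -/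
theorem exists_bound (Λ : LinearMap.BilinForm ℤ V) (e : V) {z : K}
    (hz : z ∈ laurentSpan v M Q) :
    ∃ N : ℕ, z ∈ laurentSpan v M fun x => Q x ∧ |Λ e x| ≤ N := by
  induction hz using AddSubgroup.closure_induction with
  | mem z hz =>
    obtain ⟨a, x, hx, rfl⟩ := hz
    exact ⟨(Λ e x).natAbs, smul_mem_laurentSpan a ⟨hx, (Int.abs_eq_natAbs _).le⟩⟩
  | zero => exact ⟨0, zero_mem _⟩
  | add x y _ _ hx hy =>
    obtain ⟨N, hN⟩ := hx
    obtain ⟨N', hN'⟩ := hy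
    refine ⟨N + N', add_mem (laurentSpan_mono (fun x hx => ⟨hx.1, ?_⟩) hN)
      (laurentSpan_mono (fun x hx => ⟨hx.1, ?_⟩) hN')⟩
    · have := hx.2; push_cast; omega
    · have := hx.2; push_cast; omega
  | neg x _ hx =>
    obtain ⟨N, hN⟩ := hx
    exact ⟨N, neg_mem hN⟩

end IsToric

end

end Span

/-! ### Laurent rings of seeds and coprime exchange binomials -/

section Laurent

variable {C K : Type} [Field C] [DivisionRing K] [Algebra C K] {n r : ℕ}

/-- Although defined by quotients, the binomials are Laurent polynomials in `t` with integer
coefficients: induct by Pascal's rule. -/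
theorem tBinomial_smul_mem {t : C} (ht : IsGeneric t) {A : AddSubgroup K}
    (hA : ∀ (m : ℤ), ∀ z ∈ A, t ^ m • z ∈ A) (r p : ℕ) {z : K} (hz : z ∈ A) :
    tBinomial t r p • z ∈ A := by
  induction r generalizing p z with
  | zero =>
    cases p with
    | zero => simpa [tBinomial] using hz
    | succ p => rw [tBinomial_eq_zero t (Nat.succ_pos p), zero_smul]; exact zero_mem _
  | succ r ih =>
    cases p with
    | zero => simpa [tBinomial] using hz
    | succ p =>
      rw [tBinomial_succ_succ ht, add_smul, mul_smul, mul_smul]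
      exact add_mem (hA _ _ (ih _ hz)) (hA _ _ (ih _ hz))

namespace IsSeed

variable {v : C} {d : Fin n → ℤ} {Λ : LinearMap.BilinForm ℤ (Fin n ⊕ Fin r → ℤ)}
  {S : FrameSeed K n r}

theorem tBinomial_smul_mem_laurentRing (h : IsSeed v d Λ S) (k : Fin n) (m p : ℕ) {z : K}
    (hz : z ∈ laurentRing v S.frame) : tBinomial (v ^ d k) m p • z ∈ laurentRing v S.frame :=
  tBinomial_smul_mem (h.generic.zpow (h.d_ne k)) (fun m z hz => by
    rw [← zpow_mul]; exact zpow_smul_mem_laurentSpan h.generic _ hz) m p hz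

/-- Monomials of the mutated frame with non-negative exponent of the new variable. -/
theorem frame_seedMutate_mem (h : IsSeed v d Λ S) (k : Fin n) {c : Fin n ⊕ Fin r → ℤ}
    (hc : 0 ≤ c (Sum.inl k)) : (seedMutate v d k S).frame c ∈ laurentRing v S.frame := by
  rw [frame_seedMutate_of_nonneg k hc]
  exact sum_mem fun p _ => h.tBinomial_smul_mem_laurentRing k _ _ (mem_laurentRing _ _ _)

theorem frame_mem_seedMutate (h : IsSeed v d Λ S) (k : Fin n) {c : Fin n ⊕ Fin r → ℤ}
    (hc : 0 ≤ c (Sum.inl k)) : S.frame c ∈ laurentRing v (seedMutate v d k S).frame := by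
  have := (h.seedMutate_isSeed k).frame_seedMutate_mem k hc
  rwa [h.seedMutate_seedMutate] at this

/-- Write `y₁`, `y₂` for the multiples of `M(b^k)`, `M(b^l)`; they commute because `b_{kl} = 0`. In
the grading by `Λ(e, ·)` the element `y₁` has degree `0` and `y₂` positive degree. Thus `1 + y₁`
divides the lowest component of `z`, and division proceeds degree by degree, by induction on the
width `N` of the range of degrees. -/
theorem coprime_aux (h : IsSeed v d Λ S) {k l : Fin n} (hkl : k ≠ l)
    (hb : S.matrix (Sum.inl k) l = 0) (a b : ℤ) (N : ℕ) (m : ℤ) {z : K}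
    (hz : z ∈ laurentSpan v S.frame fun x =>
      m ≤ Λ (-d l • unitVec r l) x ∧ Λ (-d l • unitVec r l) x < m + N)
    (hex : ∃ z' ∈ laurentRing v S.frame, (1 + v ^ b • S.frame (S.matrix.col l)) * z =
      (1 + v ^ a • S.frame (S.matrix.col k)) * z') :
    ∃ z' ∈ laurentRing v S.frame, z = (1 + v ^ a • S.frame (S.matrix.col k)) * z' := by
  -- The factor `-d l` makes the degree of `b^l` equal to `d_l²`, positive whatever the sign of `d
  -- l`.
  set e := -d l • unitVec r l with he
  have hek : Λ e (S.matrix.col k) = 0 := by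
    simp [h.compat_right, he, hkl]
  have hel : 0 < Λ e (S.matrix.col l) := by
    simpa [h.compat_right, he] using h.d_pos l l
  have hy1 : v ^ a • S.frame (S.matrix.col k) ∈ laurentSpan v S.frame fun x => Λ e x = 0 :=
    smul_mem_laurentSpan a hek
  have hy2 : v ^ b • S.frame (S.matrix.col l) ∈ laurentSpan v S.frame fun x => 0 < Λ e x :=
    smul_mem_laurentSpan b hel
  have hcomm : Commute (v ^ a • S.frame (S.matrix.col k)) (v ^ b • S.frame (S.matrix.col l)) := by
    have h1 := h.mul_comm (S.matrix.col k) (S.matrix.col l)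
    rw [h.compat, Matrix.col_apply, hb, mul_zero, mul_zero, zpow_zero, one_smul] at h1
    rw [Commute, SemiconjBy, smul_mul_smul_comm, smul_mul_smul_comm, h1, mul_comm (v ^ a)]
  generalize v ^ a • S.frame (S.matrix.col k) = y₁ at *
  generalize v ^ b • S.frame (S.matrix.col l) = y₂ at *
  induction N generalizing m z with
  | zero =>
    have : z ∈ (⊥ : AddSubgroup K) := by
      refine laurentSpan_le (fun a x hx => ?_) hz
      exact absurd hx (by push_cast; omega)
    exact ⟨0, zero_mem _, by rw [AddSubgroup.mem_bot.1 this, mul_zero]⟩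
  | succ N ih =>
    obtain ⟨z₁, hz₁, z₂, hz₂, rfl⟩ := laurentSpan_split (fun x => Λ e x = m) hz
    obtain ⟨z', hz', heq⟩ := hex
    obtain ⟨w₁, hw₁, w₂, hw₂, rfl⟩ := laurentSpan_split (fun x => Λ e x = m) hz'
    -- The left side is homogeneous of degree `m` and the right side has no component of degree `m`,
    -- so both vanish.
    have key : z₁ - (1 + y₁) * w₁ = (1 + y₁) * w₂ - (z₂ + y₂ * (z₁ + z₂)) := by
      have : (1 + y₁) * w₁ + (1 + y₁) * w₂ = z₁ + (z₂ + y₂ * (z₁ + z₂)) := by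
        rw [← mul_add, ← heq, add_mul, one_mul, add_assoc]
      rw [sub_eq_sub_iff_add_eq_add, ← this]
      abel
    have e1 : z₁ - (1 + y₁) * w₁ ∈ laurentSpan v S.frame fun x => Λ e x = m := by
      refine sub_mem (laurentSpan_mono (fun x hx => hx.2) hz₁) ?_
      rw [add_mul, one_mul]
      refine add_mem (laurentSpan_mono (fun x hx => hx.2) hw₁) ?_
      exact h.mul_mem_laurentSpan (fun x y hx hy => by rw [map_add, hx, hy.2, zero_add]) hy1 hw₁
    have e2 : (1 + y₁) * w₂ - (z₂ + y₂ * (z₁ + z₂)) ∈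
        laurentSpan v S.frame fun x => Λ e x ≠ m := by
      refine sub_mem ?_ (add_mem (laurentSpan_mono (fun x hx => hx.2) hz₂) ?_)
      · rw [add_mul, one_mul]
        refine add_mem (laurentSpan_mono (fun x hx => hx.2) hw₂) ?_
        exact h.mul_mem_laurentSpan (fun x y hx hy => by rw [map_add, hx, zero_add]; exact hy.2)
          hy1 hw₂
      · exact h.mul_mem_laurentSpan (fun x y hx hy => by
          rw [map_add]; have := hy.1; omega) hy2 hz
    rw [← key] at e2
    have hzero : z₁ - (1 + y₁) * w₁ = 0 := eigenSpan_disjoint h.generic (h.ne_zero e)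
      (P := (· = 2 * m)) (P' := (· ≠ 2 * m)) (fun m hm => by simpa using hm)
      (h.laurentSpan_le_eigenSpan e (fun x hx => by rw [hx]) e1)
      (h.laurentSpan_le_eigenSpan e (fun x hx => by omega) e2)
    rw [sub_eq_zero] at hzero
    have hz₂' : z₂ ∈ laurentSpan v S.frame fun x => m + 1 ≤ Λ e x ∧ Λ e x < m + 1 + N :=
      laurentSpan_mono (fun x hx => by
        have h1 := hx.1; have h2 := hx.2; push_cast at h1; omega) hz₂
    have hy₁ : y₁ ∈ laurentRing v S.frame := laurentSpan_mono (fun _ _ => trivial) hy1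
    have hy₂ : y₂ ∈ laurentRing v S.frame := laurentSpan_mono (fun _ _ => trivial) hy2
    have hw₁' : w₁ ∈ laurentRing v S.frame := laurentSpan_mono (fun _ _ => trivial) hw₁
    have hw₂' : w₂ ∈ laurentRing v S.frame := laurentSpan_mono (fun _ _ => trivial) hw₂
    -- Subtracting `(1 + y₂) z₁ = (1 + y₂)(1 + y₁) w₁` from the hypothesis leaves `(1 + y₂) z₂ = (1
    -- + y₁)(w₂ - y₂ w₁)`.
    obtain ⟨z', hz', heq'⟩ := ih (m + 1) hz₂' ⟨w₂ - y₂ * w₁,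
      sub_mem hw₂' (h.mul_mem_laurentRing hy₂ hw₁'), by
        have h3 : (1 + y₂) * ((1 + y₁) * w₁) = (1 + y₁) * (w₁ + y₂ * w₁) := by
          have : (1 + y₂) * (1 + y₁) = (1 + y₁) * (1 + y₂) :=
            ((Commute.one_left _).add_left ((Commute.one_right _).add_right hcomm.symm)).eq
          rw [← mul_assoc, this, mul_assoc, add_mul 1 y₂, one_mul]
        have h4 : (1 + y₂) * z₂ = (1 + y₁) * (w₁ + w₂) - (1 + y₂) * ((1 + y₁) * w₁) := by
          rw [← heq, hzero]; noncomm_ring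
        rw [h4, h3, ← mul_sub]
        congr 1; abel⟩
    exact ⟨w₁ + z', add_mem hw₁' hz', by rw [mul_add, ← heq', ← hzero]⟩

/-- Apply `coprime_aux` to the first product: multiplied by the second binomial it is divisible by
the first one, with quotient the second product. Hence it is itself the first binomial times a
Laurent polynomial, and the binomial is cancelled. -/
theorem coprime (h : IsSeed v d Λ S) {k l : Fin n} (hkl : k ≠ l)
    (hb : S.matrix (Sum.inl k) l = 0) (a b : ℤ) {Y : K}
    (h1 : (1 + v ^ a • S.frame (S.matrix.col k)) * Y ∈ laurentRing v S.frame)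
    (h2 : (1 + v ^ b • S.frame (S.matrix.col l)) * Y ∈ laurentRing v S.frame) :
    Y ∈ laurentRing v S.frame := by
  obtain ⟨N, hN⟩ := IsToric.exists_bound Λ (-d l • unitVec r l) h1
  have hcomm : (1 + v ^ b • S.frame (S.matrix.col l)) * (1 + v ^ a • S.frame (S.matrix.col k)) =
      (1 + v ^ a • S.frame (S.matrix.col k)) * (1 + v ^ b • S.frame (S.matrix.col l)) := by
    have h1 := h.mul_comm (S.matrix.col k) (S.matrix.col l)
    rw [h.compat, Matrix.col_apply, hb, mul_zero, mul_zero, zpow_zero, one_smul] at h1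
    have h3 : Commute (v ^ b • S.frame (S.matrix.col l)) (v ^ a • S.frame (S.matrix.col k)) := by
      rw [Commute, SemiconjBy, smul_mul_smul_comm, smul_mul_smul_comm, h1, mul_comm (v ^ a)]
    exact ((Commute.one_left _).add_left ((Commute.one_right _).add_right h3)).eq
  -- A window of width `2N + 1` starting at `-N` contains all degrees of absolute value at most `N`.
  obtain ⟨z', hz', heq⟩ := h.coprime_aux hkl hb a b (2 * N + 1) (-N)
    (laurentSpan_mono (fun x hx => by
      have := abs_le.1 hx.2; push_cast; omega) hN)
    ⟨_, h2, by rw [← mul_assoc, hcomm, mul_assoc]⟩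
  rwa [mul_left_cancel₀ (h.one_add_smul_frame_ne_zero k a) heq]

end IsSeed

end Laurent

section Laurent

variable {C K : Type} [Field C] [DivisionRing K] [Algebra C K] {n r : ℕ}

theorem mapE_eq_sub_add (k : Fin n) (B : Matrix (Fin n ⊕ Fin r) (Fin n) ℤ)
    (c : Fin n ⊕ Fin r → ℤ) : mapE k B c =
      c - c (Sum.inl k) • unitVec r k + c (Sum.inl k) • mapE k B (unitVec r k) := by
  conv_lhs => rw [eq_sub_add_smul_unitVec k c]
  rw [map_add, map_smul, mapE_of_eq_zero k B (sub_smul_unitVec_inl k c)]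

namespace IsSeed

variable {v : C} {d : Fin n → ℤ} {Λ : LinearMap.BilinForm ℤ (Fin n ⊕ Fin r → ℤ)}
  {S : FrameSeed K n r}

/-- A set of Laurent polynomials that contains the monomials without the variables `k`, `l`, and
also the variables `k`, `l` themselves. -/
theorem _root_.IsToric.frame_mem_of_nonneg {M M' : (Fin n ⊕ Fin r → ℤ) → K}
    {Λ' : LinearMap.BilinForm ℤ (Fin n ⊕ Fin r → ℤ)} (h : IsToric v Λ M) (h' : IsToric v Λ' M')
    (k l : Fin n) (h0 : ∀ c, c (Sum.inl k) = 0 → c (Sum.inl l) = 0 → M c ∈ laurentRing v M')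
    (hk : M (unitVec r k) ∈ laurentRing v M') (hl : M (unitVec r l) ∈ laurentRing v M')
    (hkl : k ≠ l) {c : Fin n ⊕ Fin r → ℤ} (hck : 0 ≤ c (Sum.inl k)) (hcl : 0 ≤ c (Sum.inl l)) :
    M c ∈ laurentRing v M' := by
  have hpow : ∀ i : Fin n, M (unitVec r i) ∈ laurentRing v M' → ∀ a : ℤ, 0 ≤ a →
      M (a • unitVec r i) ∈ laurentRing v M' := by
    intro i hi a ha
    obtain ⟨m, rfl⟩ := Int.eq_ofNat_of_zero_le ha
    induction m with
    | zero => simpa using h0 0 rfl rfl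
    | succ m ih =>
      rw [Nat.cast_succ, add_smul, one_smul, h.map_add]
      exact zpow_smul_mem_laurentSpan h.generic _
        (h'.mul_mem_laurentRing (ih (by positivity)) hi)
  have e : c = (c - c (Sum.inl k) • unitVec r k - c (Sum.inl l) • unitVec r l) +
      c (Sum.inl k) • unitVec r k + c (Sum.inl l) • unitVec r l := by abel
  rw [e, h.map_add]
  refine zpow_smul_mem_laurentSpan h.generic _ (h'.mul_mem_laurentRing ?_ (hpow l hl _ hcl))
  rw [h.map_add]
  refine zpow_smul_mem_laurentSpan h.generic _ (h'.mul_mem_laurentRing ?_ (hpow k hk _ hck))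
  apply h0
  · simp [hkl]
  · simp [hkl.symm]

/-! ### Two successive mutations in different directions -/

section Rank2

variable (v d) (S) (k l : Fin n)

/-- The frame obtained by mutations in the directions `k`, then `l`. -/
noncomputable abbrev frame₂ : (Fin n ⊕ Fin r → ℤ) → K :=
  (seedMutate v d l (seedMutate v d k S)).frame

variable {v d S k l}

theorem toric₂ (h : IsSeed v d Λ S) : IsToric v (mutateForm l (mutateMatrix k S.matrix)
    (mutateForm k S.matrix Λ)) (frame₂ v d S k l) :=
  ((h.seedMutate_isSeed k).seedMutate_isSeed l).toIsToric

theorem frame₂_of_zero {c : Fin n ⊕ Fin r → ℤ} (hck : c (Sum.inl k) = 0)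
    (hcl : c (Sum.inl l) = 0) : frame₂ v d S k l c = S.frame c := by
  rw [frame₂, frame_seedMutate_of_eq_zero l hcl, frame_seedMutate_of_eq_zero k hck]

theorem frame_mem₂_of_zero {c : Fin n ⊕ Fin r → ℤ} (hck : c (Sum.inl k) = 0)
    (hcl : c (Sum.inl l) = 0) : S.frame c ∈ laurentRing v (frame₂ v d S k l) := by
  rw [← frame₂_of_zero (v := v) (d := d) hck hcl]
  exact mem_laurentRing _ _ _

/-- Monomials after the first mutation, with non-negative exponent of the variable `l`. -/
theorem frame_seedMutate_mem₂ (h : IsSeed v d Λ S) {c : Fin n ⊕ Fin r → ℤ}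
    (hcl : 0 ≤ c (Sum.inl l)) :
    (seedMutate v d k S).frame c ∈ laurentRing v (frame₂ v d S k l) :=
  (h.seedMutate_isSeed k).frame_mem_seedMutate l hcl

theorem frame_eq_seedMutate_add (h : IsSeed v d Λ S) (k : Fin n) {c : Fin n ⊕ Fin r → ℤ}
    (hc : c (Sum.inl k) = 1) : S.frame c =
      (seedMutate v d k S).frame (mapE k (mutateMatrix k S.matrix) c) +
        (seedMutate v d k S).frame
          (mapE k (mutateMatrix k S.matrix) c + (mutateMatrix k S.matrix).col k) := by
  have := (h.seedMutate_isSeed k).frame_seedMutate_of_eq_one k hc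
  rwa [h.seedMutate_seedMutate] at this

theorem unitVec_l_mem₂ (h : IsSeed v d Λ S) (hkl : k ≠ l) :
    S.frame (unitVec r l) ∈ laurentRing v (frame₂ v d S k l) := by
  rw [← frame_seedMutate_of_eq_zero (v := v) (d := d) (S := S) k (c := unitVec r l) (by simp [hkl])]
  exact h.frame_seedMutate_mem₂ (by simp)

/-- The exchange relation read backwards writes the old variable `k` as two monomials in the cluster
after `μ_k`. Their exponents at `l` are `max(0, b_{lk})` and `max(0, b_{lk}) - b_{lk}`, both
non-negative, so they remain Laurent after `μ_l`. -/
theorem unitVec_k_mem₂ (h : IsSeed v d Λ S) (hkl : k ≠ l) :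
    S.frame (unitVec r k) ∈ laurentRing v (frame₂ v d S k l) := by
  have h1 : mapE k (mutateMatrix k S.matrix) (unitVec r k) (Sum.inl l) =
      max 0 (S.matrix (Sum.inl l) k) := by
    rw [mapE_apply]; simp [hkl.symm, mutateMatrix]
  rw [h.frame_eq_seedMutate_add k (by simp)]
  refine add_mem (h.frame_seedMutate_mem₂ ?_) (h.frame_seedMutate_mem₂ ?_)
  · rw [h1]; exact le_max_left _ _
  · rw [Pi.add_apply, h1, col_mutateMatrix_self, Pi.neg_apply, Matrix.col_apply]
    omega

/-- The new variable in direction `l` when `b_{kl} < 0`. -/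
theorem newVar_mem₂_of_neg (h : IsSeed v d Λ S) (hkl : k ≠ l)
    (hb : S.matrix (Sum.inl k) l < 0) :
    (seedMutate v d l S).frame (unitVec r l) ∈ laurentRing v (frame₂ v d S k l) := by
  have hS' := h.seedMutate_isSeed k
  have hS'' := h.toric₂ (k := k) (l := l)
  obtain ⟨b, hb'⟩ : ∃ b : ℕ, S.matrix (Sum.inl k) l = -b := ⟨(S.matrix (Sum.inl k) l).natAbs, by omega⟩
  have hblk : 0 ≤ S.matrix (Sum.inl l) k := h.matrix_nonneg hb.le
  have hblk' : S.matrix (Sum.inl l) k ≠ 0 := fun h0 => by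
    have := h.matrix_eq_zero h0; omega
  set ek := unitVec r k with hek
  set el := unitVec r l with hel
  have ekk : ek (Sum.inl k) = 1 := by simp [hek]
  have ekl : ek (Sum.inl l) = 0 := by simp [hek, hkl.symm]
  have elk : el (Sum.inl k) = 0 := by simp [hel, hkl]
  have ell : el (Sum.inl l) = 1 := by simp [hel]
  set u := mapE l S.matrix el with hu
  have huk : u (Sum.inl k) = b := by
    rw [hu, mapE_apply, if_neg (by simpa using hkl), elk, ell, hb']; simp
  have hul : u (Sum.inl l) = -1 := by rw [hu, mapE_inl, ell]
  set w := mapE k S.matrix ek with hw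
  have hwk : w (Sum.inl k) = -1 := by rw [hw, mapE_inl, ekk]
  have hwl : w (Sum.inl l) = 0 := by
    rw [hw, mapE_apply, if_neg (by simpa using hkl.symm), ekk, ekl]
    simp [hblk]
  have hx3 : ((b : ℤ) • ek) (Sum.inl l) = 0 := by simp [ekl]
  -- the monomial by which the new variable is multiplied is a unit
  refine hS''.mem_laurentRing_of_mul ((b : ℤ) • ek) ?_
  have hM3 : frame₂ v d S k l ((b : ℤ) • ek) = (seedMutate v d k S).frame ((b : ℤ) • ek) :=
    frame_seedMutate_of_eq_zero l hx3
  rw [hM3, h.frame_seedMutate_of_eq_one l ell, mul_add]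
  -- first product
  have h1 : (seedMutate v d k S).frame ((b : ℤ) • ek) * S.frame (u + S.matrix.col l) =
      v ^ (b * Λ w u) • (seedMutate v d k S).frame ((b : ℤ) • w + u + (mutateMatrix k S.matrix).col l) := by
    have e0 : (u + S.matrix.col l) (Sum.inl k) = 0 := by
      rw [Pi.add_apply, huk, Matrix.col_apply, hb']; ring
    rw [← frame_seedMutate_of_eq_zero (v := v) (d := d) (S := S) k e0, hS'.mul]
    congr 2
    · rw [LinearMap.compl₁₂_apply, mapE_of_eq_zero k _ e0, map_smul, map_smul,
        LinearMap.smul_apply, map_add, h.compat_right, ← hw, hwl, smul_eq_mul]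
      ring
    · rw [col_mutateMatrix k l hkl.symm _ (h.diag k), max_eq_left hb.le, zero_smul, add_zero,
        mapE_eq_sub_add, Matrix.col_apply, hb', ← hw]
      module
  -- Expand the `b`-th power of the new variable `k` by binomials. The product of its term of index
  -- `p` with `M(u)` has exponent `p b_{lk} - 1` at `l`, non-negative for `p ≥ 1`; only the term `p
  -- = 0` has to be set aside.
  have h2 : (seedMutate v d k S).frame ((b : ℤ) • ek) * S.frame u -
      v ^ (b * Λ w u) • (seedMutate v d k S).frame ((b : ℤ) • w + u) ∈
        laurentRing v (frame₂ v d S k l) := by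
    have e0 : ((b : ℤ) • ek) (Sum.inl k) = b := by simp [ekk]
    have e1 : mapE k S.matrix ((b : ℤ) • ek) = (b : ℤ) • w := map_smul _ _ _
    have e2 : ∀ p : ℕ, ((b : ℤ) • w + (p : ℤ) • S.matrix.col k + u) (Sum.inl k) = 0 := fun p => by
      simp [hwk, huk, h.diag]
    have e3 : ((b : ℤ) • w + u) (Sum.inl k) = 0 := by simpa using e2 0
    have e4 : ((b : ℤ) • w + ((0 : ℕ) : ℤ) • S.matrix.col k) = (b : ℤ) • w := by simp
    rw [frame_seedMutate_of_nonneg k (by rw [e0]; positivity), e0, Int.toNat_natCast,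
      Finset.sum_range_succ', add_mul, e1, e4, show tBinomial (v ^ d k) b 0 = 1 from rfl, one_smul,
      h.mul, map_smul, LinearMap.smul_apply, smul_eq_mul, frame_seedMutate_of_eq_zero k e3,
      add_sub_cancel_right, Finset.sum_mul]
    refine sum_mem fun p _ => ?_
    rw [smul_mul_assoc, h.mul]
    refine ((h.seedMutate_isSeed k).seedMutate_isSeed l).tBinomial_smul_mem_laurentRing k _ _
      (zpow_smul_mem_laurentSpan h.generic _ ?_)
    rw [← frame_seedMutate_of_eq_zero (v := v) (d := d) (S := S) k (e2 _)]
    refine h.frame_seedMutate_mem₂ ?_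
    simp only [Pi.add_apply, Pi.smul_apply, smul_eq_mul, hwl, hul, Matrix.col_apply]
    push_cast
    have : 1 ≤ S.matrix (Sum.inl l) k := by omega
    nlinarith
  -- The term set aside and the first product are the two halves of one exchange binomial in
  -- direction `l`, hence together a multiple of a monomial of the final cluster.
  have h3 : frame₂ v d S k l (mapE l (mutateMatrix k S.matrix) ((b : ℤ) • w + u)) = 
      (seedMutate v d k S).frame ((b : ℤ) • w + u) +
        (seedMutate v d k S).frame ((b : ℤ) • w + u + (mutateMatrix k S.matrix).col l) := by
    have e0 : mapE l (mutateMatrix k S.matrix) ((b : ℤ) • w + u) (Sum.inl l) = 1 := by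
      rw [mapE_inl]; simp [hwl, hul]
    rw [frame₂, hS'.frame_seedMutate_of_eq_one l e0]
    have e1 := mapE_mapE l (mutateMatrix k S.matrix) ((b : ℤ) • w + u)
    congr 2
    exact congrArg (· + _) e1
  rw [h1, ← sub_add_cancel (_ * S.frame u), add_assoc, ← smul_add, ← h3]
  exact add_mem h2 (smul_mem_laurentSpan _ trivial)

/-- If `b_{kl} = 0`, the mutation `μ_k` does not affect the exchange relation at `l`, so the element
is already a variable of the final cluster. The case `b_{kl} > 0` is the negative one for `(-B,
-d)`. -/
theorem newVar_mem₂ (h : IsSeed v d Λ S) (hkl : k ≠ l) :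
    (seedMutate v d l S).frame (unitVec r l) ∈ laurentRing v (frame₂ v d S k l) := by
  rcases lt_trichotomy (S.matrix (Sum.inl k) l) 0 with hb | hb | hb
  · exact h.newVar_mem₂_of_neg hkl hb
  · have hS' := h.seedMutate_isSeed k
    have e1 : unitVec r l (Sum.inl l) = 1 := Pi.single_eq_same _ _
    have hcol : (mutateMatrix k S.matrix).col l = S.matrix.col l := by
      rw [col_mutateMatrix k l hkl.symm _ (h.diag k), hb, max_self, zero_smul, add_zero,
        mapE_of_eq_zero k _ hb]
    have hE : mapE l (seedMutate v d k S).matrix (unitVec r l) =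
        mapE l S.matrix (unitVec r l) := by
      ext i
      have := congrFun hcol i
      simp only [Matrix.col_apply] at this
      rw [mapE_apply, mapE_apply, show (seedMutate v d k S).matrix i l = S.matrix i l from this]
    have e2 : mapE l S.matrix (unitVec r l) (Sum.inl k) = 0 := by
      rw [mapE_apply]; simp [hkl, hb]
    have e3 : (mapE l S.matrix (unitVec r l) + S.matrix.col l) (Sum.inl k) = 0 := by
      rw [Pi.add_apply, e2, Matrix.col_apply, hb, add_zero]
    rw [h.frame_seedMutate_of_eq_one l e1, ← frame_seedMutate_of_eq_zero (v := v) (d := d) k e2,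
      ← frame_seedMutate_of_eq_zero (v := v) (d := d) k e3]
    have := hS'.frame_seedMutate_of_eq_one l e1
    rw [hE, show (seedMutate v d k S).matrix.col l = S.matrix.col l from hcol] at this
    rw [← this]
    exact mem_laurentRing _ _ _
  · have h1 := h.neg.newVar_mem₂_of_neg (k := k) (l := l) hkl (by simpa using hb)
    rw [h.frame_seedMutate_neg] at h1
    have h2 := (h.seedMutate_isSeed k).frame_seedMutate_neg l
    have h3 : seedMutate v (-d) k (⟨S.frame, -S.matrix⟩ : FrameSeed K n r) =
        ⟨(seedMutate v d k S).frame, -(seedMutate v d k S).matrix⟩ :=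
      FrameSeed.ext (h.frame_seedMutate_neg k) (mutateMatrix_neg k S.matrix)
    rwa [frame₂, h3, h2] at h1

/-- A Laurent polynomial in the first mutated cluster becomes a Laurent polynomial after the
second mutation when multiplied by a power of the variable `l`. -/
theorem exists_frame_l_mul_mem (h : IsSeed v d Λ S) (hkl : k ≠ l) {Y : K}
    (hY : Y ∈ laurentRing v (seedMutate v d k S).frame) :
    ∃ N : ℕ, ∀ m : ℕ, N ≤ m → S.frame ((m : ℤ) • unitVec r l) * Y ∈
      laurentRing v (frame₂ v d S k l) := by
  have hS' := h.seedMutate_isSeed k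
  induction hY using AddSubgroup.closure_induction with
  | mem z hz =>
    obtain ⟨a, c, -, rfl⟩ := hz
    refine ⟨(c (Sum.inl l)).natAbs, fun m hm => ?_⟩
    rw [← frame_seedMutate_of_eq_zero (v := v) (d := d) (S := S) k (by simp [hkl]), mul_smul_comm,
      hS'.mul]
    refine zpow_smul_mem_laurentSpan h.generic _ (zpow_smul_mem_laurentSpan h.generic _
      (h.frame_seedMutate_mem₂ ?_))
    simp
    omega
  | zero => exact ⟨0, fun m _ => by rw [mul_zero]; exact zero_mem _⟩
  | add x y _ _ hx hy =>
    obtain ⟨N, hN⟩ := hx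
    obtain ⟨N', hN'⟩ := hy
    exact ⟨max N N', fun m hm => by
      rw [mul_add]
      exact add_mem (hN m (le_of_max_le_left hm)) (hN' m (le_of_max_le_right hm))⟩
  | neg x _ hx =>
    obtain ⟨N, hN⟩ := hx
    exact ⟨N, fun m hm => by rw [mul_neg]; exact neg_mem (hN m hm)⟩

/-- Only finitely many exponents at `k` occur, and a large power of that variable makes all of them
non-negative. The frame is kept general since both `S` and its mutation at `l` are used below. -/
theorem exists_frame_k_mul_mem_aux (hkl : k ≠ l) {M : (Fin n ⊕ Fin r → ℤ) → K}
    {Λ' : LinearMap.BilinForm ℤ (Fin n ⊕ Fin r → ℤ)} (hM : IsToric v Λ' M) {A : AddSubgroup K}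
    (hA : ∀ (a : ℤ), ∀ z ∈ A, v ^ a • z ∈ A)
    (hMA : ∀ c, 0 ≤ c (Sum.inl k) → 0 ≤ c (Sum.inl l) → M c ∈ A) {Y : K}
    (hY : Y ∈ laurentSpan v M fun c => 0 ≤ c (Sum.inl l)) :
    ∃ N : ℕ, ∀ m : ℕ, N ≤ m → M ((m : ℤ) • unitVec r k) * Y ∈ A := by
  induction hY using AddSubgroup.closure_induction with
  | mem z hz =>
    obtain ⟨a, c, hc, rfl⟩ := hz
    refine ⟨(c (Sum.inl k)).natAbs, fun m hm => ?_⟩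
    rw [mul_smul_comm, hM.mul]
    refine hA _ _ (hA _ _ (hMA _ ?_ ?_))
    · simp; omega
    · simp [hkl.symm, hc]
  | zero => exact ⟨0, fun m _ => by rw [mul_zero]; exact zero_mem _⟩
  | add x y _ _ hx hy =>
    obtain ⟨N, hN⟩ := hx
    obtain ⟨N', hN'⟩ := hy
    exact ⟨max N N', fun m hm => by
      rw [mul_add]
      exact add_mem (hN m (le_of_max_le_left hm)) (hN' m (le_of_max_le_right hm))⟩
  | neg x _ hx =>
    obtain ⟨N, hN⟩ := hx
    exact ⟨N, fun m hm => by rw [mul_neg]; exact neg_mem (hN m hm)⟩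

/-- Conjugation by `M(b^l)` gives the monomial `c` degree `2 d_l c_l` in the cluster of `S` and `-2
d_l c_l` in that of `μ_l S`. The part of `Y` of positive degree thus uses only positive powers of
the old variable `l`, and the remaining part only non-negative powers of the new one. Both variables
are Laurent in the final cluster, so only denominators in the variable `k` are left to clear. -/
theorem exists_frame_k_mul_mem (h : IsSeed v d Λ S) (hd : 0 < d l) (hkl : k ≠ l) {Y : K}
    (hY : Y ∈ laurentRing v S.frame) (hY' : Y ∈ laurentRing v (seedMutate v d l S).frame) :
    ∃ N : ℕ, ∀ m : ℕ, N ≤ m → S.frame ((m : ℤ) • unitVec r k) * Y ∈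
      laurentRing v (frame₂ v d S k l) := by
  have hS' := h.seedMutate_isSeed l
  have h₂ := h.toric₂ (k := k) (l := l)
  obtain ⟨y₁, hy₁, y₂, hy₂, e⟩ := laurentSpan_split (fun c => 0 < d l * c (Sum.inl l)) hY
  obtain ⟨z₁, hz₁, z₂, hz₂, e'⟩ := laurentSpan_split (fun c => d l * c (Sum.inl l) < 0) hY'
  have hcol : (seedMutate v d l S).frame (-(seedMutate v d l S).matrix.col l) =
      S.frame (S.matrix.col l) := by
    rw [show (seedMutate v d l S).matrix.col l = -S.matrix.col l from col_mutateMatrix_self l _,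
      neg_neg, frame_seedMutate_of_eq_zero l (h.diag l)]
  have hdisj : y₁ - z₁ = 0 := by
    refine eigenSpan_disjoint h.generic (h.ne_zero (S.matrix.col l)) (P := fun m => 0 < m)
      (P' := fun m => m ≤ 0) (fun m hm => not_le.2 hm) (sub_mem ?_ ?_) ?_
    · refine h.laurentSpan_le_eigenSpan _ (fun x hx => ?_) hy₁
      rw [h.compat]; have := hx.2; omega
    · rw [← hcol]
      refine hS'.laurentSpan_le_eigenSpan _ (fun x hx => ?_) hz₁
      rw [map_neg, LinearMap.neg_apply, hS'.compat]; have := hx.2; omega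
    · have : y₁ - z₁ = z₂ - y₂ := by
        rw [sub_eq_sub_iff_add_eq_add, ← e, e', add_comm]
      rw [this]
      refine sub_mem ?_ ?_
      · rw [← hcol]
        refine hS'.laurentSpan_le_eigenSpan _ (fun x hx => ?_) hz₂
        rw [map_neg, LinearMap.neg_apply, hS'.compat]; have := hx.2; omega
      · refine h.laurentSpan_le_eigenSpan _ (fun x hx => ?_) hy₂
        rw [h.compat]; have := hx.2; omega
  have hA : ∀ (a : ℤ), ∀ z ∈ laurentRing v (frame₂ v d S k l),
      v ^ a • z ∈ laurentRing v (frame₂ v d S k l) :=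
    fun a z hz => zpow_smul_mem_laurentSpan h.generic a hz
  obtain ⟨N, hN⟩ := exists_frame_k_mul_mem_aux hkl h.toIsToric hA
    (fun c hck hcl => h.toIsToric.frame_mem_of_nonneg h₂ k l
      (fun c h1 h2 => frame_mem₂_of_zero h1 h2) (h.unitVec_k_mem₂ hkl) (h.unitVec_l_mem₂ hkl) hkl
      hck hcl) (laurentSpan_mono (fun c hc => (pos_of_mul_pos_right hc.2 hd.le).le) hy₁)
  have hk0 : ∀ a : ℤ, (seedMutate v d l S).frame (a • unitVec r k) = S.frame (a • unitVec r k) :=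
    fun a => frame_seedMutate_of_eq_zero l (by simp [hkl.symm])
  obtain ⟨N', hN'⟩ := exists_frame_k_mul_mem_aux hkl hS'.toIsToric hA
    (fun c hck hcl => hS'.toIsToric.frame_mem_of_nonneg h₂ k l
      (fun c h1 h2 => by
        rw [frame_seedMutate_of_eq_zero l h2]; exact frame_mem₂_of_zero h1 h2)
      (by have := hk0 1; rw [one_smul] at this; rw [this]; exact h.unitVec_k_mem₂ hkl)
      (h.newVar_mem₂ hkl) hkl hck hcl)
    (laurentSpan_mono (fun c hc => nonneg_of_mul_nonneg_right (not_lt.1 hc.2) hd) hz₂)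
  refine ⟨max N N', fun m hm => ?_⟩
  have e3 : Y = y₁ + z₂ := by rw [e', sub_eq_zero.1 hdisj]
  rw [e3, mul_add]
  refine add_mem (hN m (le_of_max_le_left hm)) ?_
  rw [← hk0]
  exact hN' m (le_of_max_le_right hm)

/-- The variables `k` and `l` are coprime in the ring of Laurent polynomials after the two
mutations. -/
theorem mem₂_of_mul_mem (h : IsSeed v d Λ S) (hkl : k ≠ l) {Y : K}
    (hk : S.frame (unitVec r k) * Y ∈ laurentRing v (frame₂ v d S k l))
    (hl : S.frame (unitVec r l) * Y ∈ laurentRing v (frame₂ v d S k l)) :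
    Y ∈ laurentRing v (frame₂ v d S k l) := by
  have hS' := h.seedMutate_isSeed k
  have h₂ := h.toric₂ (k := k) (l := l)
  have ekk : unitVec r k (Sum.inl k) = 1 := Pi.single_eq_same _ _
  have ell : unitVec r l (Sum.inl l) = 1 := Pi.single_eq_same _ _
  have ekl : unitVec r k (Sum.inl l) = 0 := by simp [hkl.symm]
  have elk : unitVec r l (Sum.inl k) = 0 := by simp [hkl]
  by_cases hb : S.matrix (Sum.inl l) k = 0
  -- When `b_{kl} = 0`, the two variables are, up to units of the final Laurent ring, binomials `1 +
  -- v^a Ŷ_k` and `1 + v^b Ŷ_l` in the final cluster, and `coprime` applies.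
  · have hbkl := h.matrix_eq_zero hb
    set S₂ := seedMutate v d l (seedMutate v d k S) with hS₂
    have hS₂' := (h.seedMutate_isSeed k).seedMutate_isSeed l
    have hbS₂ : S₂.matrix (Sum.inl k) l = 0 := by
      simp [hS₂, FrameSeed.mutate, mutateMatrix, hbkl]
    have hcolk : S₂.matrix.col k = (mutateMatrix k S.matrix).col k := by
      have e0 : (mutateMatrix k S.matrix) (Sum.inl l) k = 0 := by simp [mutateMatrix, hb]
      refine (col_mutateMatrix l k hkl _ (hS'.diag l)).trans ?_
      rw [show (seedMutate v d k S).matrix = mutateMatrix k S.matrix from rfl, e0, max_self,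
        zero_smul, add_zero]
      exact mapE_of_eq_zero l _ e0
    set f := mapE k (mutateMatrix k S.matrix) (unitVec r k) with hf
    have hfl : f (Sum.inl l) = 0 := by
      rw [hf, mapE_apply]; simp [hkl.symm, mutateMatrix, hb]
    set e := mapE l S₂.matrix (unitVec r l) with he
    have hek : e (Sum.inl k) = 0 := by
      rw [he, mapE_apply]; simp [hkl, hbS₂]
    have hxk : S.frame (unitVec r k) = (1 + v ^ (-(d k * f (Sum.inl k))) •
        S₂.frame (S₂.matrix.col k)) * S₂.frame f := by
      rw [← hS₂'.add_frame_col, hcolk, h.frame_eq_seedMutate_add k ekk,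
        frame_seedMutate_of_eq_zero l hfl, frame_seedMutate_of_eq_zero l]
      simp [hfl, mutateMatrix, hb]
    have hxl : S.frame (unitVec r l) = (1 + v ^ (-(d l * e (Sum.inl l))) •
        S₂.frame (S₂.matrix.col l)) * S₂.frame e := by
      rw [← hS₂'.add_frame_col, ← frame_seedMutate_of_eq_zero (v := v) (d := d) k elk]
      exact hS'.frame_eq_seedMutate_add l ell
    have hce : S₂.frame e * (1 + v ^ (-(d k * f (Sum.inl k))) • S₂.frame (S₂.matrix.col k)) =
        (1 + v ^ (-(d k * f (Sum.inl k))) • S₂.frame (S₂.matrix.col k)) * S₂.frame e := by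
      have := hS₂'.mul_comm (S₂.matrix.col k) e
      rw [hS₂'.compat, hek, mul_zero, mul_zero, zpow_zero, one_smul] at this
      rw [mul_add, add_mul, mul_one, one_mul, mul_smul_comm, smul_mul_assoc, this]
    have hcf : S₂.frame f * (1 + v ^ (-(d l * e (Sum.inl l))) • S₂.frame (S₂.matrix.col l)) =
        (1 + v ^ (-(d l * e (Sum.inl l))) • S₂.frame (S₂.matrix.col l)) * S₂.frame f := by
      have := hS₂'.mul_comm (S₂.matrix.col l) f
      rw [hS₂'.compat, hfl, mul_zero, mul_zero, zpow_zero, one_smul] at this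
      rw [mul_add, add_mul, mul_one, one_mul, mul_smul_comm, smul_mul_assoc, this]
    have h1 := hS₂'.mul_mem_laurentRing (mem_laurentRing v _ e) hk
    rw [hxk, mul_assoc, ← mul_assoc, hce, mul_assoc] at h1
    have h2 := hS₂'.mul_mem_laurentRing (mem_laurentRing v _ f) hl
    rw [hxl, mul_assoc, ← mul_assoc, hcf, mul_assoc, ← mul_assoc (S₂.frame f),
      hS₂'.mul_comm f e, smul_mul_assoc, mul_smul_comm] at h2
    replace h2 := hS₂'.mem_laurentRing_of_smul _ h2
    rw [mul_assoc] at h2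
    exact hS₂'.mem_laurentRing_of_mul f (hS₂'.mem_laurentRing_of_mul e
      (hS₂'.coprime hkl hbS₂ _ _ h1 h2))
  -- Otherwise the product of the old and new variables `k` is a sum of two monomials, only one of
  -- which involves the variable `l`. That one times `Y` is Laurent by `hl`; by subtraction so is
  -- the other times `Y`, and the other is a unit in the final cluster.
  · have key : ∀ (f₀ f₁ : Fin n ⊕ Fin r → ℤ) (a₀ a₁ : ℤ), f₀ (Sum.inl k) = 0 →
        f₁ (Sum.inl k) = 0 → f₀ (Sum.inl l) = 0 → 1 ≤ f₁ (Sum.inl l) →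
        (v ^ a₀ • S.frame f₀ + v ^ a₁ • S.frame f₁) * Y ∈ laurentRing v (frame₂ v d S k l) →
        Y ∈ laurentRing v (frame₂ v d S k l) := by
      intro f₀ f₁ a₀ a₁ h0k h1k h0l h1l hmem
      have e1 : S.frame f₁ = v ^ (-Λ (f₁ - unitVec r l) (unitVec r l)) •
          (S.frame (f₁ - unitVec r l) * S.frame (unitVec r l)) := by
        rw [← h.map_add, sub_add_cancel]
      have e2 : S.frame (f₁ - unitVec r l) ∈ laurentRing v (frame₂ v d S k l) := by
        rw [← frame_seedMutate_of_eq_zero (v := v) (d := d) (S := S) k (by simp [h1k, hkl])]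
        exact h.frame_seedMutate_mem₂ (by simp [h1l])
      have e3 : v ^ a₁ • S.frame f₁ * Y ∈ laurentRing v (frame₂ v d S k l) := by
        rw [e1, smul_mul_assoc, smul_mul_assoc, mul_assoc]
        exact zpow_smul_mem_laurentSpan h.generic _ (zpow_smul_mem_laurentSpan h.generic _
          (h₂.mul_mem_laurentRing e2 hl))
      rw [add_mul] at hmem
      have e4 := sub_mem hmem e3
      rw [add_sub_cancel_right, smul_mul_assoc] at e4
      replace e4 := h₂.mem_laurentRing_of_smul _ e4
      rw [← frame₂_of_zero (v := v) (d := d) h0k h0l] at e4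
      exact h₂.mem_laurentRing_of_mul _ e4
    have hx3 : (seedMutate v d k S).frame (unitVec r k) ∈ laurentRing v (frame₂ v d S k l) :=
      h.frame_seedMutate_mem₂ ekl.ge
    have h1 := h₂.mul_mem_laurentRing hx3 hk
    have huk := mapE_inl k S.matrix (unitVec r k)
    have hul : mapE k S.matrix (unitVec r k) (Sum.inl l) = max 0 (-S.matrix (Sum.inl l) k) := by
      rw [mapE_apply]; simp [hkl.symm]
    rw [h.frame_seedMutate_of_eq_one k ekk, ← mul_assoc, add_mul, h.mul, h.mul] at h1
    rcases lt_or_gt_of_ne hb with hb | hb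
    · rw [add_comm] at h1
      refine key _ _ _ _ ?_ ?_ ?_ ?_ h1
      · simp [huk, h.diag]
      · simp [huk]
      · simp only [Pi.add_apply, hul, ekl, Matrix.col_apply]; omega
      · simp only [Pi.add_apply, hul, ekl]; omega
    · refine key _ _ _ _ ?_ ?_ ?_ ?_ h1
      · simp [huk]
      · simp [huk, h.diag]
      · simp only [Pi.add_apply, hul, ekl]; omega
      · simp only [Pi.add_apply, hul, ekl, Matrix.col_apply]; omega

end Rank2

/-! ### Upper bounds and the quantum Laurent phenomenon -/

/-- The main step of the Laurent phenomenon. -/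
theorem laurent_step (h : IsSeed v d Λ S) {k l : Fin n} (hd : 0 < d l) (hkl : k ≠ l) {Y : K}
    (hY : Y ∈ laurentRing v S.frame) (hYk : Y ∈ laurentRing v (seedMutate v d k S).frame)
    (hYl : Y ∈ laurentRing v (seedMutate v d l S).frame) :
    Y ∈ laurentRing v (frame₂ v d S k l) := by
  obtain ⟨N, hN⟩ := h.exists_frame_k_mul_mem hd hkl hY hYl
  obtain ⟨N', hN'⟩ := h.exists_frame_l_mul_mem hkl hYk
  have h₂ := h.toric₂ (k := k) (l := l)
  have hpow : ∀ (i : Fin n) (a : ℕ), S.frame ((a : ℤ) • unitVec r i) ∈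
      laurentRing v (frame₂ v d S k l) := fun i a =>
    h.toIsToric.frame_mem_of_nonneg h₂ k l (fun c h1 h2 => frame_mem₂_of_zero h1 h2)
      (h.unitVec_k_mem₂ hkl) (h.unitVec_l_mem₂ hkl) hkl
      (by by_cases hi : i = k <;> simp [hi])
      (by by_cases hi : i = l <;> simp [hi])
  have hsucc : ∀ (i : Fin n) (a : ℕ), S.frame (((a + 1 : ℕ) : ℤ) • unitVec r i) =
      S.frame (unitVec r i) * S.frame ((a : ℤ) • unitVec r i) := fun i a => by
    rw [← h.zpow, ← h.zpow, Nat.cast_succ, add_comm, zpow_add₀ (h.ne_zero _), zpow_one]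
  have hswap : ∀ (x y : Fin n ⊕ Fin r → ℤ) (Z : K),
      S.frame x ∈ laurentRing v (frame₂ v d S k l) →
      S.frame y * Z ∈ laurentRing v (frame₂ v d S k l) →
      S.frame y * (S.frame x * Z) ∈ laurentRing v (frame₂ v d S k l) := by
    intro x y Z hx hZ
    rw [← mul_assoc, h.mul_comm, smul_mul_assoc, mul_assoc]
    exact zpow_smul_mem_laurentSpan h.generic _ (h₂.mul_mem_laurentRing hx hZ)
  -- `mem₂_of_mul_mem` treats exponents `1` and `1`; a double descent removes one factor of each
  -- power at a time, commuting the two powers past each other by `hswap`.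
  have key₁ : ∀ (b : ℕ) (Z : K), S.frame (unitVec r k) * Z ∈ laurentRing v (frame₂ v d S k l) →
      S.frame ((b : ℤ) • unitVec r l) * Z ∈ laurentRing v (frame₂ v d S k l) →
      Z ∈ laurentRing v (frame₂ v d S k l) := by
    intro b
    induction b with
    | zero => intro Z _ h2; simpa [h.map_zero] using h2
    | succ b ih =>
      intro Z h1 h2
      rw [hsucc, mul_assoc] at h2
      exact ih Z h1 (h.mem₂_of_mul_mem hkl (hswap _ _ _ (hpow l b) h1) h2)
  have key : ∀ (a b : ℕ) (Z : K), S.frame ((a : ℤ) • unitVec r k) * Z ∈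
      laurentRing v (frame₂ v d S k l) → S.frame ((b : ℤ) • unitVec r l) * Z ∈
      laurentRing v (frame₂ v d S k l) → Z ∈ laurentRing v (frame₂ v d S k l) := by
    intro a
    induction a with
    | zero => intro b Z h1 _; simpa [h.map_zero] using h1
    | succ a ih =>
      intro b Z h1 h2
      rw [hsucc, mul_assoc] at h1
      exact ih b Z (key₁ b _ h1 (hswap _ _ _ (hpow k a) h2)) h2
  exact key N N' Y (hN N le_rfl) (hN' N' le_rfl)

/-- `Y` is a Laurent polynomial in the cluster of `S` and in all the neighbouring clusters. -/
def MemUpperBound (v : C) (d : Fin n → ℤ) (S : FrameSeed K n r) (Y : K) : Prop :=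
  Y ∈ laurentRing v S.frame ∧ ∀ l, Y ∈ laurentRing v (seedMutate v d l S).frame

/-- The neighbours of `μ_k S` are `S`, by involutivity, and the seeds `μ_l μ_k S`, covered by
`laurent_step`. -/
theorem memUpperBound_seedMutate (h : IsSeed v d Λ S) (hd : ∀ i, 0 < d i) (k : Fin n) {Y : K}
    (hY : MemUpperBound v d S Y) : MemUpperBound v d (seedMutate v d k S) Y := by
  refine ⟨hY.2 k, fun l => ?_⟩
  by_cases hkl : k = l
  · subst hkl
    rw [h.seedMutate_seedMutate]
    exact hY.1
  · exact h.laurent_step (hd l) hkl hY.1 (hY.2 k) (hY.2 l)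

theorem along_isSeed (h : IsSeed v d Λ S) (w : List (Fin n)) :
    ∃ Λ', IsSeed v d Λ' (S.along (algebraMap C K v) d w) := by
  induction w with
  | nil => exact ⟨Λ, h⟩
  | cons k w ih =>
    obtain ⟨Λ', h'⟩ := ih
    exact ⟨_, h'.seedMutate_isSeed k⟩

/-- The upper bound does not depend on the seed. -/
theorem memUpperBound_of_along (h : IsSeed v d Λ S) (hd : ∀ i, 0 < d i) (w : List (Fin n)) {Y : K}
    (hY : MemUpperBound v d (S.along (algebraMap C K v) d w) Y) : MemUpperBound v d S Y := by
  induction w with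
  | nil => exact hY
  | cons k w ih =>
    obtain ⟨Λ', h'⟩ := h.along_isSeed w
    have h1 := (h'.seedMutate_isSeed k).memUpperBound_seedMutate hd k hY
    rw [h'.seedMutate_seedMutate] at h1
    exact ih h1

/-- The quantum Laurent phenomenon. -/
theorem frame_along_mem (h : IsSeed v d Λ S) (hd : ∀ i, 0 < d i) (w : List (Fin n)) (j : Fin n) :
    (S.along (algebraMap C K v) d w).frame (unitVec r j) ∈ laurentRing v S.frame := by
  obtain ⟨Λ', h'⟩ := h.along_isSeed w
  -- A cluster variable lies in the upper bound of its own seed: its exponents are non-negative, so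
  -- it stays Laurent in every neighbour.
  refine (h.memUpperBound_of_along hd w ⟨mem_laurentRing _ _ _, fun l => ?_⟩).1
  refine h'.frame_mem_seedMutate l ?_
  by_cases hi : j = l <;> simp [hi]

end IsSeed

end Laurent

/-! ### Homomorphisms from the quantum torus and its skew-field -/

section TorusHom

variable {C K : Type} [Field C] [DivisionRing K] [Algebra C K] {ι : Type} [Fintype ι]
  [DecidableEq ι]

/-- The bilinear form of a matrix. -/
noncomputable abbrev matForm (Λ : Matrix ι ι ℤ) : LinearMap.BilinForm ℤ (ι → ℤ) :=
  Matrix.toBilin' Λ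

theorem matForm_apply (Λ : Matrix ι ι ℤ) (x y : ι → ℤ) : matForm Λ x y = x ⬝ᵥ Λ.mulVec y :=
  Matrix.toBilin'_apply' Λ x y

variable {v : C} {Λ : Matrix ι ι ℤ} {M : (ι → ℤ) → K}

/-- The homomorphism from the quantum torus given by a toric map. -/
noncomputable def torusHom (h : IsToric v (matForm Λ) M) : QuantumTorus Λ →+* K :=
  (MonoidAlgebra.lift ℤ K (HeisenbergGroup Λ)
    { toFun := fun x => v ^ x.half • M x.vec
      map_one' := by simp [h.map_zero]
      map_mul' := fun x y => by
        rw [smul_mul_smul_comm, h.mul, smul_smul, HeisenbergGroup.mul_half, HeisenbergGroup.mul_vec,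
          zpow_add₀ h.generic.1, zpow_add₀ h.generic.1, matForm_apply] }).toRingHom

theorem torusHom_single (h : IsToric v (matForm Λ) M) (x : HeisenbergGroup Λ) (z : ℤ) :
    torusHom h (MonoidAlgebra.single x z) = z • v ^ x.half • M x.vec :=
  MonoidAlgebra.lift_single _ _ _

theorem torusHom_apply (h : IsToric v (matForm Λ) M) (F : QuantumTorus Λ) :
    torusHom h F = F.coeff.sum fun x z => z • v ^ x.half • M x.vec :=
  MonoidAlgebra.lift_apply _ _

/-- Pulling back a toric map along a linear map. -/
theorem IsToric.comp {V V' : Type} [AddCommGroup V] [AddCommGroup V'] {v : C}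
    {Λ : LinearMap.BilinForm ℤ V} {M : V → K} (h : IsToric v Λ M) {Λ' : LinearMap.BilinForm ℤ V'}
    (f : V' →ₗ[ℤ] V) (hf : ∀ x y, Λ' x y = Λ (f x) (f y)) : IsToric v Λ' (M ∘ f) where
  generic := h.generic
  alt x := by rw [hf, h.alt]
  map_zero := by simp [h.map_zero]
  mul x y := by rw [Function.comp, Function.comp, h.mul, hf, Function.comp, _root_.map_add]

theorem torusHom_comp {κ : Type} [Fintype κ] [DecidableEq κ] {Λ' : Matrix κ κ ℤ}
    (h : IsToric v (matForm Λ) M) (f : (κ → ℤ) →ₗ[ℤ] (ι → ℤ))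
    (h' : IsToric v (matForm Λ') (M ∘ f)) (F : QuantumTorus Λ') :
    torusHom h' F = torusHom h
      (MonoidAlgebra.mapDomain (fun x => (⟨x.half, f x.vec⟩ : HeisenbergGroup Λ)) F) := by
  induction F using MonoidAlgebra.induction_linear with
  | zero => simp
  | add x y hx hy => rw [map_add, hx, hy, MonoidAlgebra.mapDomain_add, map_add]
  | single x z => rw [torusHom_single, MonoidAlgebra.mapDomain_single, torusHom_single]; rfl

theorem torusHom_comp_injective {κ : Type} [Fintype κ] [DecidableEq κ] {Λ' : Matrix κ κ ℤ}
    (h : IsToric v (matForm Λ) M) (hinj : Function.Injective (torusHom h))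
    (f : (κ → ℤ) →ₗ[ℤ] (ι → ℤ)) (hf : Function.Injective f)
    (h' : IsToric v (matForm Λ') (M ∘ f)) : Function.Injective (torusHom h') := by
  have h1 : Function.Injective
      (fun x : HeisenbergGroup Λ' => (⟨x.half, f x.vec⟩ : HeisenbergGroup Λ)) := by
    intro x y hxy
    simp only [HeisenbergGroup.mk.injEq] at hxy
    exact HeisenbergGroup.ext hxy.1 (hf hxy.2)
  intro x y hxy
  rw [torusHom_comp h, torusHom_comp h] at hxy
  exact MonoidAlgebra.mapDomain_injective h1 (hinj hxy)

/-- The bar-involution of the based quantum torus. -/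
noncomputable def torusBar (F : QuantumTorus Λ) : QuantumTorus Λ :=
  MonoidAlgebra.mapDomain (fun x => ⟨-x.half, x.vec⟩) F

omit [DecidableEq ι] in
theorem torusBar_injective : Function.Injective (torusBar (Λ := Λ)) :=
  MonoidAlgebra.mapDomain_injective fun x y hxy => by
    simp only [HeisenbergGroup.mk.injEq, neg_inj] at hxy
    exact HeisenbergGroup.ext hxy.1 hxy.2

/-- Reversing products replaces `Λ` by `-Λ`, which is compensated by `v ↦ v⁻¹`. The bar
anti-automorphism thereby becomes an ordinary homomorphism into the opposite ring. -/
theorem IsToric.op {V : Type} [AddCommGroup V] {Λ : LinearMap.BilinForm ℤ V} {M : V → K}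
    (h : IsToric v Λ M) : IsToric v⁻¹ Λ fun x => MulOpposite.op (M x) where
  generic := ⟨inv_ne_zero h.generic.1, fun m hm => by
    rw [inv_zpow', ] at hm
    have := h.generic.2 _ hm
    omega⟩
  alt := h.alt
  map_zero := by rw [h.map_zero]; rfl
  mul x y := by
    rw [← MulOpposite.op_mul, h.mul, h.skew x y, add_comm y, inv_zpow']
    rfl

theorem torusHom_op (h : IsToric v (matForm Λ) M) (F : QuantumTorus Λ) :
    torusHom h.op F = MulOpposite.op (torusHom h (torusBar F)) := by
  induction F using MonoidAlgebra.induction_linear with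
  | zero => simp [torusBar]
  | add x y hx hy =>
    rw [map_add, hx, hy, torusBar, torusBar, torusBar, MonoidAlgebra.mapDomain_add, map_add]
    rfl
  | single x z =>
    rw [torusHom_single, torusBar, MonoidAlgebra.mapDomain_single, torusHom_single, inv_zpow']
    rfl

end TorusHom

/-- The centre of a skew-field. -/
def Centre (K : Type) [DivisionRing K] : Type := Subring.center K

noncomputable instance (K : Type) [DivisionRing K] : Field (Centre K) :=
  inferInstanceAs (Field (Subring.center K))

noncomputable instance (K : Type) [DivisionRing K] : Algebra (Centre K) K :=
  inferInstanceAs (Algebra (Subring.center K) K)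

section QuantumField

variable {ι : Type} [Fintype ι] {L : Matrix ι ι ℤ}

namespace QuantumField

/-- The embedding of the quantum torus into its skew-field. -/
noncomputable def numer (L : Matrix ι ι ℤ) : QuantumTorus L →+* QuantumField L :=
  OreLocalization.numeratorRingHom

theorem numer_injective : Function.Injective (numer L) :=
  OreLocalization.numeratorHom_inj fun _ hx => hx.1

/-- The extension of an injective homomorphism to the skew-field. -/
noncomputable def lift {T : Type} [DivisionRing T] (f : QuantumTorus L →+* T)
    (hf : Function.Injective f) : QuantumField L →+* T :=
  OreLocalization.universalHom f
    { toFun := fun s => Units.mk0 (f s) fun h => nonZeroDivisors.coe_ne_zero s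
        (hf (h.trans (map_zero f).symm))
      map_one' := by ext; simp
      map_mul' := fun x y => by ext; simp }
    fun s => rfl

theorem lift_numer {T : Type} [DivisionRing T] (f : QuantumTorus L →+* T)
    (hf : Function.Injective f) (a : QuantumTorus L) : lift f hf (numer L a) = f a :=
  OreLocalization.universalHom_commutes _ _ _

/-- By uniqueness in the universal property the identity is the extension of `numer`; its value on a
fraction is the desired expression. -/
theorem exists_eq_inv_mul (x : QuantumField L) :
    ∃ s r : QuantumTorus L, s ≠ 0 ∧ x = (numer L s)⁻¹ * numer L r := by
  have hid : RingHom.id (QuantumField L) = lift (numer L) numer_injective :=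
    OreLocalization.universalHom_unique _ _ _ _ fun r => rfl
  induction x using OreLocalization.ind with
  | _ r s =>
    refine ⟨s, r, nonZeroDivisors.coe_ne_zero s, ?_⟩
    have h1 := congrArg (fun f : QuantumField L →+* QuantumField L => f (r /ₒ s)) hid
    refine (show r /ₒ s = lift (numer L) numer_injective (r /ₒ s) from h1).trans ?_
    refine (OreLocalization.universalHom_apply _ _ _).trans ?_
    congr 1

theorem numer_ne_zero {s : QuantumTorus L} (hs : s ≠ 0) : numer L s ≠ 0 := fun h =>
  hs (numer_injective (h.trans (map_zero _).symm))

theorem qHalf_comm (x : QuantumField L) : qHalf L * x = x * qHalf L := by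
  have h1 : ∀ a : QuantumTorus L, Commute (qHalf L) (numer L a) := by
    intro a
    have : Commute (MonoidAlgebra.single (⟨1, 0⟩ : HeisenbergGroup L) (1 : ℤ)) a := by
      induction a using MonoidAlgebra.induction_linear with
      | zero => exact Commute.zero_right _
      | add x y hx hy => exact hx.add_right hy
      | single x z =>
        rw [Commute, SemiconjBy, MonoidAlgebra.single_mul_single, MonoidAlgebra.single_mul_single,
          one_mul, mul_one]
        congr 1
        ext1
        · simp; ring
        · simp
    exact this.map (numer L)
  obtain ⟨s, r, -, rfl⟩ := exists_eq_inv_mul x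
  exact ((h1 s).inv_right₀.mul_right (h1 r)).eq

/-- `q^(1/2)` as an element of the centre. -/
noncomputable def q (L : Matrix ι ι ℤ) : Centre (QuantumField L) :=
  ⟨qHalf L, Subring.mem_center_iff.2 fun x => (qHalf_comm x).symm⟩

theorem algebraMap_q : algebraMap (Centre (QuantumField L)) (QuantumField L) (q L) = qHalf L :=
  rfl

theorem q_smul (a : ℤ) (x : QuantumField L) : q L ^ a • x = qHalf L ^ a * x := by
  rw [Algebra.smul_def, map_zpow₀ (algebraMap (Centre (QuantumField L)) (QuantumField L)),
    algebraMap_q]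

theorem qHalf_ne_zero : qHalf L ≠ 0 := numer_ne_zero (by simp)

theorem qHalf_zpow (a : ℤ) :
    qHalf L ^ a = numer L (MonoidAlgebra.single (⟨a, 0⟩ : HeisenbergGroup L) (1 : ℤ)) := by
  have hmul : ∀ a b : ℤ, numer L (MonoidAlgebra.single (⟨a, 0⟩ : HeisenbergGroup L) (1 : ℤ)) *
      numer L (MonoidAlgebra.single (⟨b, 0⟩ : HeisenbergGroup L) (1 : ℤ)) =
      numer L (MonoidAlgebra.single (⟨a + b, 0⟩ : HeisenbergGroup L) (1 : ℤ)) := by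
    intro a b
    rw [← map_mul, MonoidAlgebra.single_mul_single, mul_one]
    congr 2
    ext1 <;> simp
  have h1 : qHalf L = numer L (MonoidAlgebra.single (⟨1, 0⟩ : HeisenbergGroup L) (1 : ℤ)) := rfl
  have h0 : numer L (MonoidAlgebra.single (⟨0, 0⟩ : HeisenbergGroup L) (1 : ℤ)) = 1 := map_one _
  induction a using Int.induction_on with
  | zero => rw [zpow_zero, h0]
  | succ a ih => rw [zpow_add_one₀ qHalf_ne_zero, ih, h1, hmul]
  | pred a ih =>
    rw [zpow_sub_one₀ qHalf_ne_zero, ih, mul_inv_eq_iff_eq_mul₀ qHalf_ne_zero, h1, hmul]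
    congr 3
    ring

theorem q_generic : IsGeneric (q L) := by
  refine ⟨fun h => qHalf_ne_zero (congrArg Subtype.val h), fun m hm => ?_⟩
  have h1 : qHalf L ^ m = 1 := by
    have := congrArg (algebraMap (Centre (QuantumField L)) (QuantumField L)) hm
    rwa [map_zpow₀ (algebraMap (Centre (QuantumField L)) (QuantumField L)), map_one,
      algebraMap_q] at this
  rw [qHalf_zpow, ← map_one (numer L)] at h1
  have h2 := MonoidAlgebra.single_left_injective (one_ne_zero) (numer_injective h1)
  exact congrArg HeisenbergGroup.half h2

theorem numer_single [DecidableEq ι] (x : HeisenbergGroup L) :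
    numer L (MonoidAlgebra.single x (1 : ℤ)) = q L ^ x.half • X L x.vec := by
  rw [q_smul, qHalf_zpow, X]
  change _ = numer L _ * numer L _
  rw [← map_mul, MonoidAlgebra.single_mul_single, mul_one]
  congr 2
  ext1 <;> simp

theorem X_isToric [DecidableEq ι] (hL : L.transpose = -L) :
    IsToric (q L) (matForm L) (X L) where
  generic := q_generic
  alt x := by
    have h1 : matForm L x x = -matForm L x x := by
      conv_lhs => rw [matForm_apply, Matrix.dotProduct_mulVec, ← Matrix.mulVec_transpose, hL,
        Matrix.neg_mulVec, neg_dotProduct, dotProduct_comm]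
      rw [matForm_apply]
    omega
  map_zero := map_one (numer L)
  mul x y := by
    have := numer_single (L := L) ⟨matForm L x y, x + y⟩
    rw [← this, X, X]
    change numer L _ * numer L _ = _
    rw [← map_mul, MonoidAlgebra.single_mul_single, mul_one]
    congr 2
    ext1 <;> simp [matForm_apply]

theorem torusHom_X [DecidableEq ι] (hL : L.transpose = -L) : torusHom (X_isToric hL) = numer L := by
  refine MonoidAlgebra.ringHom_ext (fun z => ?_) fun x => ?_
  · rw [torusHom_single, HeisenbergGroup.one_half, HeisenbergGroup.one_vec, (X_isToric hL).map_zero]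
    rw [zpow_zero, one_smul, zsmul_one, ← map_intCast (numer L)]
    rfl
  · rw [torusHom_single, numer_single, one_smul]

/-- The bar anti-automorphism of the skew-field. -/
theorem exists_bar [DecidableEq ι] (hL : L.transpose = -L) :
    ∃ σ : QuantumField L →+* (QuantumField L)ᵐᵒᵖ,
      σ (qHalf L) = MulOpposite.op (qHalf L)⁻¹ ∧ ∀ c, σ (X L c) = MulOpposite.op (X L c) := by
  have hinj : Function.Injective (torusHom (X_isToric hL).op) := by
    intro a b hab
    rw [torusHom_op (X_isToric hL), torusHom_op (X_isToric hL), torusHom_X hL] at hab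
    exact torusBar_injective (numer_injective (MulOpposite.op_injective hab))
  refine ⟨lift _ hinj, ?_, fun c => ?_⟩
  · refine (lift_numer _ hinj _).trans ?_
    rw [torusHom_op (X_isToric hL), torusBar, MonoidAlgebra.mapDomain_single, torusHom_X hL,
      show (⟨-1, 0⟩ : HeisenbergGroup L) = ⟨(-1 : ℤ), 0⟩ from rfl, ← qHalf_zpow, zpow_neg_one]
  · refine (lift_numer _ hinj _).trans ?_
    rw [torusHom_op (X_isToric hL), torusBar, MonoidAlgebra.mapDomain_single, torusHom_X hL, neg_zero]
    rfl

end QuantumField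

end QuantumField

/-! ### Bar-invariance of cluster variables, and evaluation -/

section Bar

variable {C K : Type} [Field C] [DivisionRing K] [Algebra C K] {v : C}

theorem tBinomial_inv (t : C) (r p : ℕ) : tBinomial t⁻¹ r p = tBinomial t r p := by
  induction p with
  | zero => rfl
  | succ p ih =>
    rw [tBinomial, tBinomial, ih, inv_zpow', inv_zpow', inv_zpow', inv_zpow', neg_neg, neg_neg,
      ← neg_sub (t ^ ((r : ℤ) - p)), ← neg_sub (t ^ ((p : ℤ) + 1)), neg_div_neg_eq]

/-- An anti-automorphism inverting `v` fixes the `t`-binomials in powers of `v`. -/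
theorem bar_tBinomial {σ : K →+* Kᵐᵒᵖ}
    (hv : σ (algebraMap C K v) = MulOpposite.op (algebraMap C K v)⁻¹) (a : ℤ) (r p : ℕ) :
    σ (tBinomial (algebraMap C K v ^ a) r p) =
      MulOpposite.op (tBinomial (algebraMap C K v ^ a) r p) := by
  have h1 : σ (algebraMap C K v ^ a) = algebraMap C Kᵐᵒᵖ (v ^ a)⁻¹ := by
    rw [map_zpow₀, hv, ← map_inv₀, MulOpposite.algebraMap_apply, ← inv_zpow, map_zpow₀]
    rfl
  rw [map_tBinomial, h1, ← map_tBinomial, tBinomial_inv, MulOpposite.algebraMap_apply,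
    ← map_zpow₀, ← map_tBinomial]

/-- The mutation formula combines values of the old frame, fixed by induction, with binomials that
are invariant under `t ↦ t⁻¹`; these are central, so the reversal of products is harmless. -/
theorem bar_frame_along {n r : ℕ} {d : Fin n → ℤ} {S : FrameSeed K n r} {σ : K →+* Kᵐᵒᵖ}
    (hv : σ (algebraMap C K v) = MulOpposite.op (algebraMap C K v)⁻¹)
    (hS : ∀ c, σ (S.frame c) = MulOpposite.op (S.frame c)) (w : List (Fin n)) :
    ∀ c, σ ((S.along (algebraMap C K v) d w).frame c) =
      MulOpposite.op ((S.along (algebraMap C K v) d w).frame c) := by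
  induction w with
  | nil => exact hS
  | cons k w ih =>
    have haux : ∀ c, σ ((S.along (algebraMap C K v) d w).mutateFrameAux (algebraMap C K v) d k c) =
        MulOpposite.op
          ((S.along (algebraMap C K v) d w).mutateFrameAux (algebraMap C K v) d k c) := by
      intro c
      rw [FrameSeed.mutateFrameAux, map_sum, ← MulOpposite.opAddEquiv_apply, map_sum]
      refine Finset.sum_congr rfl fun p _ => ?_
      rw [map_mul, bar_tBinomial hv, ih, ← MulOpposite.op_mul, ← map_zpow₀, ← map_tBinomial,
        ← Algebra.commutes]
      rfl
    intro c
    change σ (if _ then _ else _) = MulOpposite.op (if _ then _ else _)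
    split_ifs
    · exact haux c
    · rw [map_inv₀, haux, MulOpposite.op_inv]

theorem bar_torusHom {ι : Type} [Fintype ι] [DecidableEq ι] {Λ : Matrix ι ι ℤ} {M : (ι → ℤ) → K}
    (h : IsToric v (matForm Λ) M) {σ : K →+* Kᵐᵒᵖ}
    (hv : σ (algebraMap C K v) = MulOpposite.op (algebraMap C K v)⁻¹)
    (hM : ∀ c, σ (M c) = MulOpposite.op (M c)) (F : QuantumTorus Λ) :
    σ (torusHom h F) = MulOpposite.op (torusHom h (torusBar F)) := by
  induction F using MonoidAlgebra.induction_linear with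
  | zero => simp [torusBar]
  | add x y hx hy =>
    rw [map_add, map_add, hx, hy, torusBar, torusBar, torusBar, MonoidAlgebra.mapDomain_add,
      map_add]
    rfl
  | single x z =>
    rw [torusHom_single, torusBar, MonoidAlgebra.mapDomain_single, torusHom_single, map_zsmul,
      Algebra.smul_def (v ^ x.half), map_mul, hM, map_zpow₀, map_zpow₀, hv,
      ← map_inv₀, ← MulOpposite.algebraMap_apply, ← map_zpow₀, ← Algebra.smul_def, inv_zpow']
    rfl

theorem IsToric.prod_ofFn {V : Type} [AddCommGroup V] {Λ : LinearMap.BilinForm ℤ V} {M : V → K}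
    (h : IsToric v Λ M) : ∀ {n : ℕ} (u : Fin n → V), (List.ofFn fun i => M (u i)).prod =
      v ^ (∑ i, ∑ j, if i < j then Λ (u i) (u j) else 0) • M (∑ i, u i)
  | 0, u => by simp [h.map_zero]
  | n + 1, u => by
    rw [List.ofFn_succ, List.prod_cons, h.prod_ofFn, mul_smul_comm, h.mul, smul_smul,
      ← zpow_add₀ h.generic.1, Fin.sum_univ_succ u, Fin.sum_univ_succ]
    congr 2
    simp only [Fin.sum_univ_succ, Fin.succ_pos, if_true, Fin.not_lt_zero, if_false, lt_irrefl,
      zero_add, Fin.succ_lt_succ_iff, _root_.map_sum]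
    ring

/-- The exponent `∑_{i<j} Λ_{ji} c_i c_j` in `eval` cancels the power of `v` created by the ordered
product, so `eval` is the substitution homomorphism. -/
theorem eval_eq_torusHom {n : ℕ} {V : Type} [AddCommGroup V] {Λ' : LinearMap.BilinForm ℤ V}
    {M : V → K} (h : IsToric v Λ' M) {Λ : Matrix (Fin n) (Fin n) ℤ}
    (f : (Fin n → ℤ) →ₗ[ℤ] V) (hf : IsToric v (matForm Λ) (M ∘ f)) (F : QuantumTorus Λ) :
    F.eval (algebraMap C K v) (fun i => M (f (Pi.single i 1))) = torusHom hf F := by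
  rw [torusHom_apply, QuantumTorus.eval]
  refine Finset.sum_congr rfl fun x _ => ?_
  have hprod := hf.prod_ofFn fun i => x.vec i • Pi.single i (1 : ℤ)
  have hsum : ∑ i, x.vec i • Pi.single i (1 : ℤ) = x.vec := by
    ext j
    simp [Finset.sum_apply, Pi.single_apply]
  have hΛ : ∀ i j, Λ j i = -Λ i j := by
    intro i j
    have := hf.skew (Pi.single i 1) (Pi.single j 1)
    rw [matForm, Matrix.toBilin'_single, Matrix.toBilin'_single] at this
    omega
  rw [hsum] at hprod
  have hz : ∀ i, M (f (Pi.single i 1)) ^ x.vec i = (M ∘ f) (x.vec i • Pi.single i (1 : ℤ)) := by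
    intro i
    exact hf.zpow _ _
  simp only [hz]
  rw [hprod, ← map_zpow₀, mul_assoc, ← Algebra.smul_def, smul_smul, ← zpow_add₀ h.generic.1,
    zsmul_eq_mul]
  congr 3
  rw [add_assoc, add_eq_left, ← Finset.sum_add_distrib]
  refine Finset.sum_eq_zero fun i _ => ?_
  rw [← Finset.sum_add_distrib]
  refine Finset.sum_eq_zero fun j _ => ?_
  split_ifs
  · simp only [map_smul, LinearMap.smul_apply, matForm, Matrix.toBilin'_single, smul_eq_mul, hΛ i j]
    ring
  · rfl

end Bar

/-! ### Quantum seeds as toric seeds -/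

section QuantumSeed

variable {n r : ℕ} {d : Fin n → ℤ} {L Λ : Matrix (Fin n ⊕ Fin r) (Fin n ⊕ Fin r) ℤ}
  {M : (Fin n ⊕ Fin r → ℤ) → QuantumField L} {B : Matrix (Fin n ⊕ Fin r) (Fin n) ℤ}

open QuantumField

/-- All three properties hold for the standard frame `X` and are transported: the relations and
injectivity along `φ` and `η`, the anti-automorphism by conjugation with `φ`. -/
theorem IsToricFrame.exists_isToric {ι : Type} [Fintype ι] [DecidableEq ι] {L Λ : Matrix ι ι ℤ}
    {M : (ι → ℤ) → QuantumField L} (hL : L.transpose = -L) (h : IsToricFrame L M Λ) :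
    ∃ h' : IsToric (q L) (matForm Λ) M, Function.Injective (torusHom h') ∧
      ∃ σ : QuantumField L →+* (QuantumField L)ᵐᵒᵖ,
        σ (algebraMap (Centre (QuantumField L)) (QuantumField L) (q L)) =
          MulOpposite.op (algebraMap (Centre (QuantumField L)) (QuantumField L) (q L))⁻¹ ∧
        ∀ c, σ (M c) = MulOpposite.op (M c) := by
  obtain ⟨φ, η, hφ, hM, hΛ⟩ := h
  have hη : ∀ x y, matForm Λ x y = matForm L (η x) (η y) := by
    have h1 : matForm Λ = (matForm L).compl₁₂ η.toAddMonoidHom.toIntLinearMap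
        η.toAddMonoidHom.toIntLinearMap := by
      rw [← Matrix.toBilin'_toMatrix' (LinearMap.compl₁₂ _ _ _)]
      congr 1
      ext i j
      rw [LinearMap.BilinForm.toMatrix'_apply, hΛ]
      exact (matForm_apply _ _ _).symm
    intro x y
    rw [h1]
    rfl
  have hX : IsToric (q L) (matForm Λ) (X L ∘ η.toAddMonoidHom.toIntLinearMap) :=
    (X_isToric hL).comp η.toAddMonoidHom.toIntLinearMap hη
  have hsmul : ∀ (a : ℤ) x, φ (q L ^ a • x) = q L ^ a • φ x := by
    intro a x
    rw [q_smul, q_smul, map_mul, map_zpow₀, hφ]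
  have hM' : ∀ c, M c = φ ((X L ∘ η.toAddMonoidHom.toIntLinearMap) c) := hM
  have h' : IsToric (q L) (matForm Λ) M :=
    { generic := q_generic
      alt := hX.alt
      map_zero := by rw [hM', hX.map_zero, map_one]
      mul := fun x y => by rw [hM', hM', hM', ← map_mul, hX.mul, hsmul] }
  have hF : ∀ F, torusHom h' F = φ (torusHom hX F) := by
    intro F
    induction F using MonoidAlgebra.induction_linear with
    | zero => simp
    | add x y hx hy => rw [map_add, map_add, hx, hy, map_add]
    | single x z => rw [torusHom_single, torusHom_single, map_zsmul, hsmul, hM']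
  obtain ⟨σ, hσ1, hσ2⟩ := exists_bar hL
  refine ⟨h', fun x y hxy => ?_, (RingHom.op φ.toRingHom).comp (σ.comp φ.symm.toRingHom), ?_, ?_⟩
  · rw [hF, hF] at hxy
    refine torusHom_comp_injective (X_isToric hL) ?_ _ η.injective hX (φ.injective hxy)
    rw [torusHom_X hL]
    exact numer_injective
  · have h1 : φ.symm (qHalf L) = qHalf L := by rw [RingEquiv.symm_apply_eq, hφ]
    change (RingHom.op φ.toRingHom) (σ (φ.symm (qHalf L))) = MulOpposite.op (qHalf L)⁻¹
    rw [h1, hσ1]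
    change MulOpposite.op (φ (qHalf L)⁻¹) = _
    rw [map_inv₀, hφ]
  · intro c
    change (RingHom.op φ.toRingHom) (σ (φ.symm (M c))) = _
    rw [hM, RingEquiv.symm_apply_apply, hσ2]
    rfl

theorem matForm_col (h : IsCompatible d Λ B) (j : Fin n) (c : Fin n ⊕ Fin r → ℤ) :
    matForm Λ (B.col j) c = d j * c (Sum.inl j) := by
  have h1 := congrFun (congrArg (fun A => A.mulVec c) h) j
  simp only [← Matrix.mulVec_mulVec] at h1
  rw [matForm_apply]
  refine Eq.trans h1 ?_
  simp [Matrix.mulVec, dotProduct, Matrix.diagonal_apply]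

theorem IsQuantumSeed.isSeed (hd : ∀ i, 0 < d i) (h : IsQuantumSeed d L M B Λ) :
    IsSeed (q L) d (matForm Λ) ⟨M, B⟩ :=
  { (h.2.1.exists_isToric h.1).choose with
    d_pos := fun i j => mul_pos (hd i) (hd j)
    compat := matForm_col h.2.2 }

end QuantumSeed

/-! ### Extended g-vectors of all cluster monomials -/

section GMap

variable {n r r' : ℕ}

/-- Iterated matrix mutation. -/
def mutateAlong (B : Matrix (Fin n ⊕ Fin r) (Fin n) ℤ) :
    List (Fin n) → Matrix (Fin n ⊕ Fin r) (Fin n) ℤ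
  | [] => B
  | k :: w => mutateMatrix k (mutateAlong B w)

theorem along_matrix {K : Type} [DivisionRing K] (v : K) (d : Fin n → ℤ) (S : FrameSeed K n r)
    (w : List (Fin n)) : (S.along v d w).matrix = mutateAlong S.matrix w := by
  induction w with
  | nil => rfl
  | cons k w ih => rw [mutateAlong, ← ih]; rfl

theorem classicalAlong_matrix {K : Type} [Field K] (S : ClassicalSeed K n r)
    (w : List (Fin n)) : (S.along w).matrix = mutateAlong S.matrix w := by
  induction w with
  | nil => rfl
  | cons k w ih => rw [mutateAlong, ← ih]; rfl

/-- The `k`-th c-vector. -/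
def cCol (B0 : Matrix (Fin n) (Fin n) ℤ) (w : List (Fin n)) (k : Fin n) : Fin n → ℤ :=
  fun i => mutateAlong (principalMatrix B0) w (Sum.inr i) k

/-- The negative part of the `k`-th c-vector. -/
def cNeg (B0 : Matrix (Fin n) (Fin n) ℤ) (w : List (Fin n)) (k : Fin n) : Fin n → ℤ :=
  fun i => max 0 (-cCol B0 w k i)

/-- The linear map sending the exponent of a cluster monomial to its extended g-vector. -/
def gMap (B : Matrix (Fin n ⊕ Fin r) (Fin n) ℤ) :
    List (Fin n) → ((Fin n ⊕ Fin r → ℤ) →ₗ[ℤ] (Fin n ⊕ Fin r → ℤ))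
  | [] => LinearMap.id
  | k :: w => (gMap B w).comp (mapE k (mutateAlong B w)) -
      (LinearMap.proj (Sum.inl k)).smulRight (B.mulVec (cNeg (principalPart B) w k))

theorem gMap_cons (B : Matrix (Fin n ⊕ Fin r) (Fin n) ℤ) (k : Fin n) (w : List (Fin n))
    (c : Fin n ⊕ Fin r → ℤ) : gMap B (k :: w) c = gMap B w (mapE k (mutateAlong B w) c) -
      c (Sum.inl k) • B.mulVec (cNeg (principalPart B) w k) := rfl

theorem principalPart_principalMatrix (B0 : Matrix (Fin n) (Fin n) ℤ) :
    principalPart (principalMatrix B0) = B0 := rfl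

theorem mutateAlong_inl {B : Matrix (Fin n ⊕ Fin r) (Fin n) ℤ}
    {B' : Matrix (Fin n ⊕ Fin r') (Fin n) ℤ} (h : principalPart B = principalPart B')
    (w : List (Fin n)) (i j : Fin n) :
    mutateAlong B w (Sum.inl i) j = mutateAlong B' w (Sum.inl i) j := by
  induction w generalizing i j with
  | nil => exact congrFun (congrFun h i) j
  | cons k w ih => simp only [mutateAlong, mutateMatrix, Matrix.of_apply, ih, Sum.inl.injEq]

/-- The top coordinates do not see the frozen rows: the correction term in `gMap` uses c-vectors,
which come from the principal matrix and not from the frozen part of `B`. -/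
theorem gMap_inl {B : Matrix (Fin n ⊕ Fin r) (Fin n) ℤ}
    {B' : Matrix (Fin n ⊕ Fin r') (Fin n) ℤ} (h : principalPart B = principalPart B')
    (w : List (Fin n)) {c : Fin n ⊕ Fin r → ℤ} {c' : Fin n ⊕ Fin r' → ℤ}
    (hc : c ∘ Sum.inl = c' ∘ Sum.inl) : gMap B w c ∘ Sum.inl = gMap B' w c' ∘ Sum.inl := by
  induction w generalizing c c' with
  | nil => exact hc
  | cons k w ih =>
    have hk := congrFun hc k
    simp only [Function.comp] at hk
    have h1 : mapE k (mutateAlong B w) c ∘ Sum.inl = mapE k (mutateAlong B' w) c' ∘ Sum.inl := by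
      ext i
      have hi := congrFun hc i
      simp only [Function.comp] at hi
      simp only [Function.comp, mapE_apply, Sum.inl.injEq, hk, hi, mutateAlong_inl h]
    ext i
    have h2 := congrFun (ih h1) i
    simp only [Function.comp] at h2
    have h3 : ∀ e, B.mulVec e (Sum.inl i) = B'.mulVec e (Sum.inl i) := fun e =>
      congrFun (congrArg (fun A => Matrix.mulVec A e) h) i
    simp only [Function.comp, gMap_cons, Pi.sub_apply, Pi.smul_apply, hk, h2, h, h3]

theorem cCol_cons (B0 : Matrix (Fin n) (Fin n) ℤ) (w : List (Fin n)) {j k : Fin n} (hj : j ≠ k)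
    (hdiag : mutateAlong (principalMatrix B0) w (Sum.inl k) k = 0) :
    cCol B0 (k :: w) j = cCol B0 w j +
      mutateAlong (principalMatrix B0) w (Sum.inl k) j • cNeg B0 w k +
      max 0 (mutateAlong (principalMatrix B0) w (Sum.inl k) j) • cCol B0 w k := by
  ext i
  have h1 := congrFun (col_mutateMatrix k j hj _ hdiag) (Sum.inr i)
  rw [Pi.add_apply, mapE_apply, if_neg Sum.inr_ne_inl] at h1
  exact h1

theorem cCol_cons_self (B0 : Matrix (Fin n) (Fin n) ℤ) (w : List (Fin n)) (k : Fin n) :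
    cCol B0 (k :: w) k = -cCol B0 w k := by
  ext i
  exact congrFun (col_mutateMatrix_self k (mutateAlong (principalMatrix B0) w)) (Sum.inr i)

/-- The monomial part of a mutated `ŷ_j` is the monomial in the initial `ŷ` whose exponent is the
c-vector. By induction it suffices to see that the columns and the c-vectors obey the same
recursion. -/
theorem gMap_col {B : Matrix (Fin n ⊕ Fin r) (Fin n) ℤ}
    (hdiag : ∀ w k, mutateAlong B w (Sum.inl k) k = 0) (w : List (Fin n)) (j : Fin n) :
    gMap B w ((mutateAlong B w).col j) = B.mulVec (cCol (principalPart B) w j) := by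
  induction w generalizing j with
  | nil =>
    have : cCol (principalPart B) [] j = Pi.single j 1 := by
      ext i
      simp [cCol, mutateAlong, principalMatrix, Matrix.one_apply, Pi.single_apply]
    rw [this, Matrix.mulVec_single_one]
    rfl
  | cons k w ih =>
    have hd' : mutateAlong (principalMatrix (principalPart B)) w (Sum.inl k) k = 0 := by
      rw [mutateAlong_inl (principalPart_principalMatrix _) w k k, hdiag]
    rw [gMap_cons]
    by_cases hj : j = k
    · subst hj
      have h1 : (mutateAlong B (j :: w)).col j (Sum.inl j) = 0 := hdiag _ _
      rw [h1, zero_smul, sub_zero, mutateAlong, col_mutateMatrix_self, map_neg,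
        mapE_of_eq_zero _ _ (hdiag w j), map_neg, ih, cCol_cons_self, Matrix.mulVec_neg]
    · have h1 : (mutateAlong B (k :: w)).col j (Sum.inl k) = -mutateAlong B w (Sum.inl k) j := by
        simp [mutateAlong, mutateMatrix]
      rw [h1, mutateAlong, col_mutateMatrix k j hj _ (hdiag w k), map_add, mapE_mapE, map_smul,
        mapE_of_eq_zero _ _ (hdiag w k), map_add, map_smul, ih, ih, cCol_cons _ _ hj hd',
        Matrix.mulVec_add, Matrix.mulVec_add, Matrix.mulVec_smul, Matrix.mulVec_smul,
        mutateAlong_inl (principalPart_principalMatrix _) w k j]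
      module

/-- In the frozen rows `E` adds exactly `c_k` times the negative part of the c-vector, which the
correction term removes again. -/
theorem gMap_principal_inr (B0 : Matrix (Fin n) (Fin n) ℤ) (w : List (Fin n))
    (c : Fin n ⊕ Fin n → ℤ) (i : Fin n) :
    gMap (principalMatrix B0) w c (Sum.inr i) = c (Sum.inr i) := by
  induction w generalizing c with
  | nil => rfl
  | cons k w ih =>
    have h1 : ∀ e, (principalMatrix B0).mulVec e (Sum.inr i) = e i := fun e => by
      simp [principalMatrix, Matrix.fromRows_mulVec]
    rw [gMap_cons, Pi.sub_apply, ih, mapE_apply, if_neg Sum.inr_ne_inl, Pi.smul_apply, h1]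
    simp [cNeg, cCol, principalPart_principalMatrix]

end GMap

/-! ### The transfer between quantum cluster algebras -/

section Transfer

open QuantumField

variable {n r : ℕ} {d : Fin n → ℤ} {B0 : Matrix (Fin n) (Fin n) ℤ}

/-- The form of the quantum torus in which the quantum F-polynomials live. -/
abbrev zForm (B0 : Matrix (Fin n) (Fin n) ℤ) (d : Fin n → ℤ) : Matrix (Fin n) (Fin n) ℤ :=
  Matrix.diagonal d * B0

section Seed

variable {C K : Type} [Field C] [DivisionRing K] [Algebra C K] {v : C}
  {Λ : LinearMap.BilinForm ℤ (Fin n ⊕ Fin r → ℤ)} {S : FrameSeed K n r}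

/-- Compatibility makes the pairing with column combinations blind to the frozen coordinates of `c`
and to the form itself. All independence of the coefficients comes from here. -/
theorem IsSeed.form_mulVec (h : IsSeed v d Λ S) (x : Fin n → ℤ) (c : Fin n ⊕ Fin r → ℤ) :
    Λ (S.matrix.mulVec x) c = ∑ j, x j * (d j * c (Sum.inl j)) := by
  have : S.matrix.mulVec x = ∑ j, x j • S.matrix.col j := by
    ext i
    simp [Matrix.mulVec, dotProduct, mul_comm]
  rw [this, map_sum, LinearMap.sum_apply]
  simp only [map_smul, LinearMap.smul_apply, h.compat, smul_eq_mul]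

theorem IsSeed.zForm_apply (h : IsSeed v d Λ S) (hB : principalPart S.matrix = B0)
    (x y : Fin n → ℤ) :
    matForm (zForm B0 d) x y = Λ (S.matrix.mulVec x) (S.matrix.mulVec y) := by
  rw [h.form_mulVec, matForm_apply, ← Matrix.mulVec_mulVec]
  refine Finset.sum_congr rfl fun j _ => ?_
  rw [Matrix.mulVec_diagonal, ← hB]
  rfl

theorem IsSeed.isToric_yHat (h : IsSeed v d Λ S) (hB : principalPart S.matrix = B0) :
    IsToric v (matForm (zForm B0 d)) (S.frame ∘ S.matrix.mulVecLin) :=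
  h.toIsToric.comp _ (h.zForm_apply hB)

/-- Pairing a combination of columns with `e_j` returns `d_j` times the `j`-th coefficient, and `d_j
≠ 0`. -/
theorem IsSeed.mulVec_injective (h : IsSeed v d Λ S) :
    Function.Injective S.matrix.mulVecLin := by
  rw [← LinearMap.ker_eq_bot, LinearMap.ker_eq_bot']
  intro x hx
  ext j
  have h1 := h.form_mulVec x (unitVec r j)
  rw [show S.matrix.mulVec x = 0 from hx, map_zero, LinearMap.zero_apply,
    Finset.sum_eq_single j (fun i _ hi => by simp [hi]) (by simp)] at h1
  simpa [h.d_ne j] using h1.symm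

/-- `φ` substitutes `v` for `q^(1/2)` and `Ŷ` for `Z`. -/
structure IsSubst (v : C) (S : FrameSeed K n r) (φ : QuantumField (zForm B0 d) →+* K) : Prop where
  map_qHalf : φ (qHalf _) = algebraMap C K v
  map_X : ∀ c, φ (X _ c) = S.frame (S.matrix.mulVec c)

theorem numer_single_int (L : Matrix (Fin n) (Fin n) ℤ) (x : HeisenbergGroup L) (z : ℤ) :
    numer L (MonoidAlgebra.single x z) = z • (qHalf L ^ x.half * X L x.vec) := by
  rw [← q_smul, ← numer_single, ← map_zsmul, MonoidAlgebra.smul_single, smul_eq_mul, mul_one]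

theorem IsSubst.numer {φ : QuantumField (zForm B0 d) →+* K} (hφ : IsSubst v S φ)
    (h : IsSeed v d Λ S) (hB : principalPart S.matrix = B0) (F : QuantumTorus (zForm B0 d)) :
    φ (numer _ F) = torusHom (h.isToric_yHat hB) F := by
  induction F using MonoidAlgebra.induction_linear with
  | zero => simp
  | add x y hx hy => simp only [map_add, hx, hy]
  | single x z =>
    rw [numer_single_int, torusHom_single, map_zsmul, map_mul, map_zpow₀, hφ.map_qHalf, hφ.map_X,
      Algebra.smul_def (v ^ x.half), map_zpow₀]
    rfl

theorem IsSeed.exists_isSubst (h : IsSeed v d Λ S) (hB : principalPart S.matrix = B0)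
    (hinj : Function.Injective (torusHom (h.isToric_yHat hB))) :
    ∃ φ : QuantumField (zForm B0 d) →+* K, IsSubst v S φ := by
  refine ⟨lift _ hinj, ⟨?_, fun c => ?_⟩⟩
  · refine (lift_numer _ hinj _).trans ?_
    rw [torusHom_single, one_smul, zpow_one, (h.isToric_yHat hB).map_zero, Algebra.smul_def, mul_one]
  · refine (lift_numer _ hinj _).trans ?_
    rw [torusHom_single, one_smul, zpow_zero, one_smul]
    rfl

end Seed

/-- Conjugating `Ŷ^c` by a monomial `M(γ)` with mutable part `g` multiplies it by this power of `q`.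
The rescaling respects the relations because its exponent is additive in `c`, so it exists already
on the `Z`-skew-field. -/
theorem exists_twist (hZ : (zForm B0 d).transpose = -zForm B0 d) (g : Fin n → ℤ) :
    ∃ τ : QuantumField (zForm B0 d) →+* QuantumField (zForm B0 d),
      τ (qHalf _) = qHalf _ ∧
      ∀ c, τ (X _ c) = qHalf _ ^ (-(2 * ∑ j, c j * (d j * g j))) * X _ c := by
  set s : (Fin n → ℤ) → ℤ := fun c => -(2 * ∑ j, c j * (d j * g j)) with hs
  have hadd : ∀ c c', s (c + c') = s c + s c' := fun c c' => by
    simp only [hs, Pi.add_apply, add_mul, Finset.sum_add_distrib]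
    ring
  have h0 : s 0 = 0 := by simp [hs]
  have hX := X_isToric hZ
  have h : IsToric (q (zForm B0 d)) (matForm (zForm B0 d)) fun c =>
      q (zForm B0 d) ^ s c • X (zForm B0 d) c :=
    { generic := hX.generic
      alt := hX.alt
      map_zero := by rw [h0, zpow_zero, one_smul, hX.map_zero]
      mul := fun x y => by
        rw [smul_mul_smul_comm, hX.mul, smul_smul, smul_smul, hadd, zpow_add₀ hX.generic.1]
        congr 1
        ring }
  have hF : ∀ F, torusHom h F =
      numer _ (MonoidAlgebra.mapDomain (fun x => ⟨x.half + s x.vec, x.vec⟩) F) := by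
    intro F
    induction F using MonoidAlgebra.induction_linear with
    | zero => simp
    | add x y hx hy => rw [map_add, hx, hy, MonoidAlgebra.mapDomain_add, map_add]
    | single x z =>
      rw [torusHom_single, MonoidAlgebra.mapDomain_single, numer_single_int, ← q_smul,
        hX.zpow_smul_smul]
  have hinj : Function.Injective (torusHom h) := by
    intro a b hab
    rw [hF, hF] at hab
    refine MonoidAlgebra.mapDomain_injective (fun x y hxy => ?_) (numer_injective hab)
    simp only [HeisenbergGroup.mk.injEq] at hxy
    refine HeisenbergGroup.ext ?_ hxy.2
    rw [hxy.2] at hxy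
    exact add_right_cancel hxy.1
  refine ⟨lift _ hinj, ?_, fun c => ?_⟩
  · refine (lift_numer _ hinj _).trans ?_
    rw [torusHom_single, one_smul, h.map_zero, q_smul, zpow_one, mul_one]
  · refine (lift_numer _ hinj _).trans ?_
    rw [torusHom_single, one_smul, zpow_zero, one_smul, q_smul]

theorem IsSubst.frame_mul {C K : Type} [Field C] [DivisionRing K] [Algebra C K] {v : C}
    {Λ : LinearMap.BilinForm ℤ (Fin n ⊕ Fin r → ℤ)} {S : FrameSeed K n r}
    {φ : QuantumField (zForm B0 d) →+* K} (hφ : IsSubst v S φ)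
    (h : IsSeed v d Λ S) (γ : Fin n ⊕ Fin r → ℤ)
    {τ : QuantumField (zForm B0 d) →+* QuantumField (zForm B0 d)} (hτ1 : τ (qHalf _) = qHalf _)
    (hτ : ∀ c, τ (QuantumField.X _ c) =
      QuantumField.qHalf _ ^ (-(2 * ∑ j, c j * (d j * γ (Sum.inl j)))) * QuantumField.X _ c)
    (z : QuantumField (zForm B0 d)) : S.frame γ * φ z = φ (τ z) * S.frame γ := by
  have hq : ∀ (a : ℤ) (x : QuantumField (zForm B0 d)),
      φ (QuantumField.qHalf _ ^ a * x) = v ^ a • φ x := fun a x => by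
    rw [map_mul, map_zpow₀, hφ.map_qHalf, Algebra.smul_def, map_zpow₀]
  have hX : ∀ c, SemiconjBy (S.frame γ) (φ (QuantumField.X _ c))
      (φ (τ (QuantumField.X _ c))) := by
    intro c
    rw [SemiconjBy, hτ, hq, hφ.map_X, h.mul_comm, h.skew, h.form_mulVec, smul_mul_assoc]
    congr 2
    ring
  have hn : ∀ F, SemiconjBy (S.frame γ) (φ (QuantumField.numer _ F))
      (φ (τ (QuantumField.numer _ F))) := by
    intro F
    induction F using MonoidAlgebra.induction_linear with
    | zero => simp
    | add x y hx hy => simp only [map_add]; exact hx.add_right hy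
    | single x z =>
      rw [numer_single_int, map_zsmul, map_zsmul, map_zsmul, map_mul τ, map_zpow₀ τ, hτ1, hq, hq,
        SemiconjBy, mul_smul_comm, smul_mul_assoc, mul_smul_comm, smul_mul_assoc, (hX _).eq]
  obtain ⟨s, t, -, rfl⟩ := exists_eq_inv_mul z
  rw [map_mul, map_inv₀, map_mul, map_inv₀, map_mul, map_inv₀]
  exact ((hn s).inv_right₀.mul_right (hn t)).eq

/-- The value of a mutated toric frame is `φ(N(c)) M₀(G(c))` with `N` independent of the
coefficients. -/
theorem exists_transfer (hZ : (zForm B0 d).transpose = -zForm B0 d) (w : List (Fin n)) :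
    ∃ N : (Fin n → ℤ) → QuantumField (zForm B0 d),
      ∀ (r : ℕ) (C K : Type) [Field C] [DivisionRing K] [Algebra C K] (v : C)
        (Λ : LinearMap.BilinForm ℤ (Fin n ⊕ Fin r → ℤ)) (S : FrameSeed K n r)
        (φ : QuantumField (zForm B0 d) →+* K), IsSeed v d Λ S → principalPart S.matrix = B0 →
        IsSubst v S φ → ∀ c : Fin n ⊕ Fin r → ℤ,
        (S.along (algebraMap C K v) d w).frame c =
          φ (N (c ∘ Sum.inl)) * S.frame (gMap S.matrix w c) := by
  induction w with
  | nil => exact ⟨fun _ => 1, fun r C K _ _ _ v Λ S φ h hB hφ c => by simp [FrameSeed.along, gMap]⟩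
  | cons k w ih =>
    obtain ⟨N, hN⟩ := ih
    choose τ hτ1 hτ using exists_twist hZ
    let ext : (Fin n → ℤ) → (Fin n ⊕ Fin n → ℤ) := fun e => Sum.elim e 0
    let g : (Fin n → ℤ) → (Fin n → ℤ) := fun e =>
      gMap (principalMatrix B0) (k :: w) (ext e) ∘ Sum.inl
    let E : (Fin n → ℤ) → (Fin n → ℤ) := fun e =>
      mapE k (mutateAlong (principalMatrix B0) w) (ext e) ∘ Sum.inl
    let b : Fin n → ℤ := fun i => mutateAlong (principalMatrix B0) w (Sum.inl i) k
    -- The `p`-th exponent of the mutation formula, mapped by `gMap` for `w`, exceeds the new `gMap`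
    -- value by `B u`. The power of `q` in `A` normalizes the product of these two monomials.
    let u : (Fin n → ℤ) → ℕ → (Fin n → ℤ) := fun e p => e k • cNeg B0 w k + (p : ℤ) • cCol B0 w k
    let A : (Fin n → ℤ) → QuantumField (zForm B0 d) := fun e =>
      ∑ p ∈ Finset.range ((e k).toNat + 1), tBinomial (qHalf _ ^ d k) (e k).toNat p *
        (N (E e + (p : ℤ) • b) *
          (qHalf _ ^ (-∑ j, u e p j * (d j * g e j)) * X _ (u e p)))
    -- For a negative exponent the product `φ(A(-e)) M₀(-γ)` is inverted, which puts the monomial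
    -- `M₀(γ)` on the left; the twist moves it back to the right.
    refine ⟨fun e => if 0 ≤ e k then A e else τ (g e) (A (-e))⁻¹,
      fun r C K _ _ _ v Λ S φ h hB hφ c => ?_⟩
    have hN' := hN r C K v Λ S φ h hB hφ
    have hdiag : ∀ w k, mutateAlong S.matrix w (Sum.inl k) k = 0 := by
      intro w k
      obtain ⟨Λ', h'⟩ := h.along_isSeed w
      rw [← along_matrix (algebraMap C K v) d]
      exact h'.diag k
    have hpp : principalPart S.matrix = principalPart (principalMatrix B0) := by
      rw [hB, principalPart_principalMatrix]
    have hg : ∀ c : Fin n ⊕ Fin r → ℤ, gMap S.matrix (k :: w) c ∘ Sum.inl = g (c ∘ Sum.inl) :=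
      fun c => gMap_inl hpp _ rfl
    have haux : ∀ c : Fin n ⊕ Fin r → ℤ, 0 ≤ c (Sum.inl k) →
        (S.along (algebraMap C K v) d w).mutateFrameAux (algebraMap C K v) d k c =
          φ (A (c ∘ Sum.inl)) * S.frame (gMap S.matrix (k :: w) c) := by
      intro c hc
      rw [FrameSeed.mutateFrameAux, map_sum, Finset.sum_mul]
      refine Finset.sum_congr rfl fun p _ => ?_
      rw [map_mul, map_tBinomial, map_zpow₀, hφ.map_qHalf, mul_assoc, hN']
      congr 1
      have hE : ((matrixE k (S.along (algebraMap C K v) d w).matrix).mulVec c +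
          (p : ℤ) • fun i => (S.along (algebraMap C K v) d w).matrix i k) =
          mapE k (mutateAlong S.matrix w) c + (p : ℤ) • (mutateAlong S.matrix w).col k := by
        rw [along_matrix]
        rfl
      rw [hE]
      have h1 : (mapE k (mutateAlong S.matrix w) c + (p : ℤ) • (mutateAlong S.matrix w).col k) ∘
          Sum.inl = E (c ∘ Sum.inl) + (p : ℤ) • b := by
        ext i
        simp only [Function.comp, Pi.add_apply, Pi.smul_apply, Matrix.col_apply, E, b, mapE_apply,
          mutateAlong_inl hpp, Sum.inl.injEq, ext, Sum.elim_inl]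
      rw [h1, map_mul, mul_assoc]
      congr 1
      have h2 : gMap S.matrix w
          (mapE k (mutateAlong S.matrix w) c + (p : ℤ) • (mutateAlong S.matrix w).col k) =
          S.matrix.mulVec (u (c ∘ Sum.inl) p) + gMap S.matrix (k :: w) c := by
        rw [map_add, map_smul, gMap_col hdiag, gMap_cons, hB, Matrix.mulVec_add,
          Matrix.mulVec_smul, Matrix.mulVec_smul]
        simp only [Function.comp]
        abel
      have h3 := h.mul (S.matrix.mulVec (u (c ∘ Sum.inl) p)) (gMap S.matrix (k :: w) c)
      have h4 : ∑ j, u (c ∘ Sum.inl) p j * (d j * g (c ∘ Sum.inl) j) =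
          Λ (S.matrix.mulVec (u (c ∘ Sum.inl) p)) (gMap S.matrix (k :: w) c) := by
        rw [h.form_mulVec, ← hg]
        rfl
      rw [h2, map_mul, map_zpow₀, hφ.map_qHalf, hφ.map_X, ← map_zpow₀, ← Algebra.smul_def, smul_mul_assoc,
        h3, h4, h.zpow_smul_smul, neg_add_cancel, zpow_zero, one_smul]
    change (if _ then _ else _) = φ (if _ then _ else _) * _
    split_ifs with h0 h0' h0'
    · exact haux c h0
    · exact absurd h0 h0'
    · exact absurd h0' h0
    · have h5 := haux (-c) (by simp only [Pi.neg_apply]; omega)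
      have h6 : (-c) ∘ Sum.inl = -(c ∘ Sum.inl) := rfl
      rw [h5, map_neg, h6, mul_inv_rev, h.inv, neg_neg, ← map_inv₀]
      refine hφ.frame_mul h _ (hτ1 _) (fun e => ?_) _
      rw [hτ, ← hg]
      rfl

end Transfer

/-! ### Elements of the quantum torus with restricted support -/

section TorusSpan

open QuantumField

variable {ι : Type} [Fintype ι] {L : Matrix ι ι ℤ}

/-- The elements of the quantum torus all of whose exponents satisfy `Q`. -/
def torusSpan (L : Matrix ι ι ℤ) (Q : (ι → ℤ) → Prop) : AddSubgroup (QuantumTorus L) where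
  carrier := {a | ∀ h ∈ a.coeff.support, Q h.vec}
  zero_mem' := by simp
  add_mem' := by
    classical
    intro a b ha hb h hh
    rw [MonoidAlgebra.coeff_add] at hh
    rcases Finset.mem_union.1 (Finsupp.support_add hh) with h1 | h1
    · exact ha h h1
    · exact hb h h1
  neg_mem' := by
    intro a ha h hh
    refine ha h ?_
    rwa [MonoidAlgebra.coeff_neg, Finsupp.support_neg] at hh

variable {Q Q₁ Q₂ : (ι → ℤ) → Prop}

theorem mem_torusSpan {a : QuantumTorus L} :
    a ∈ torusSpan L Q ↔ ∀ h ∈ a.coeff.support, Q h.vec := Iff.rfl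

theorem single_mem_torusSpan {x : HeisenbergGroup L} (hx : Q x.vec) (z : ℤ) :
    MonoidAlgebra.single x z ∈ torusSpan L Q := by
  intro h hh
  rw [MonoidAlgebra.coeff_single] at hh
  rw [Finset.mem_singleton.1 (Finsupp.support_single_subset hh)]
  exact hx

theorem mul_mem_torusSpan (hQ : ∀ x y, Q₁ x → Q₂ y → Q (x + y)) {a b : QuantumTorus L}
    (ha : a ∈ torusSpan L Q₁) (hb : b ∈ torusSpan L Q₂) : a * b ∈ torusSpan L Q := by
  classical
  intro h hh
  obtain ⟨x, hx, y, hy, rfl⟩ := Finset.mem_mul.1 (MonoidAlgebra.support_coeff_mul_subset a b hh)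
  exact hQ _ _ (ha x hx) (hb y hy)

@[elab_as_elim]
theorem torusSpan_induction {p : ∀ a : QuantumTorus L, a ∈ torusSpan L Q → Prop}
    (h0 : p 0 (zero_mem _))
    (hadd : ∀ a b ha hb, p a ha → p b hb → p (a + b) (add_mem ha hb))
    (hsingle : ∀ x z (hx : Q x.vec), p (MonoidAlgebra.single x z) (single_mem_torusSpan hx z))
    {a : QuantumTorus L} (ha : a ∈ torusSpan L Q) : p a ha := by
  classical
  have key : ∀ (f : HeisenbergGroup L →₀ ℤ) (hf : MonoidAlgebra.ofCoeff f ∈ torusSpan L Q),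
      p (MonoidAlgebra.ofCoeff f) hf := by
    intro f
    induction f using Finsupp.induction with
    | zero => intro _; exact h0
    | single_add x z f hx hz ih =>
      intro hf
      have hf' : ∀ h ∈ (Finsupp.single x z + f).support, Q h.vec := hf
      rw [Finsupp.support_single_add hx hz] at hf'
      exact hadd _ _ _ _ (hsingle x z (hf' x (by simp)))
        (ih fun h hh => hf' h (Finset.mem_cons_of_mem hh))
  exact key a.coeff ha

theorem torusSpan_split (P : (ι → ℤ) → Prop) {a : QuantumTorus L} (ha : a ∈ torusSpan L Q) :
    ∃ a₁ ∈ torusSpan L (fun x => Q x ∧ P x), ∃ a₂ ∈ torusSpan L (fun x => Q x ∧ ¬P x),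
      a = a₁ + a₂ := by
  induction ha using torusSpan_induction with
  | h0 => exact ⟨0, zero_mem _, 0, zero_mem _, (add_zero _).symm⟩
  | hadd a b _ _ ha hb =>
    obtain ⟨a₁, h₁, a₂, h₂, rfl⟩ := ha
    obtain ⟨b₁, h₁', b₂, h₂', rfl⟩ := hb
    exact ⟨_, add_mem h₁ h₁', _, add_mem h₂ h₂', add_add_add_comm _ _ _ _⟩
  | hsingle x z hx =>
    by_cases h : P x.vec
    · exact ⟨_, single_mem_torusSpan ⟨hx, h⟩ z, 0, zero_mem _, (add_zero _).symm⟩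
    · exact ⟨0, zero_mem _, _, single_mem_torusSpan ⟨hx, h⟩ z, (zero_add _).symm⟩

theorem torusSpan_mono (h : ∀ x, Q₁ x → Q₂ x) : torusSpan L Q₁ ≤ torusSpan L Q₂ :=
  fun _ ha x hx => h _ (ha x hx)

theorem torusSpan_disjoint (h : ∀ x, Q₁ x → ¬Q₂ x) {a : QuantumTorus L} (h₁ : a ∈ torusSpan L Q₁)
    (h₂ : a ∈ torusSpan L Q₂) : a = 0 := by
  by_contra h0
  have h1 : a.coeff ≠ 0 := fun h1 => h0 (MonoidAlgebra.coeff_injective h1)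
  obtain ⟨x, hx⟩ := Finsupp.support_nonempty_iff.2 h1
  exact h _ (h₁ x hx) (h₂ x hx)

/-- A quotient of elements without negative exponents has none, if the denominator has a term of
degree zero. -/
theorem mem_torusSpan_of_mul (i : ι) {a b : QuantumTorus L} (ha : a ∈ torusSpan L fun x => 0 ≤ x i)
    (ha' : a ∉ torusSpan L fun x => 0 < x i) (hab : a * b ∈ torusSpan L fun x => 0 ≤ x i) :
    b ∈ torusSpan L fun x => 0 ≤ x i := by
  by_contra hb
  rw [mem_torusSpan] at hb
  push Not at hb
  obtain ⟨h, hh, hneg⟩ := hb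
  obtain ⟨h', hh', hmin⟩ := b.coeff.support.exists_min_image (fun h => h.vec i) ⟨h, hh⟩
  set m := h'.vec i with hm
  have hm0 : m < 0 := (hmin h hh).trans_lt hneg
  have hb' : b ∈ torusSpan L fun x => m ≤ x i := hmin
  -- With `a₀` the part of `a` of degree `0` and `b₀` the part of `b` of lowest degree `m < 0`, the
  -- product `a₀ b₀` is the part of degree `m` of `a b`, hence zero. As the torus is a domain, one
  -- factor vanishes, and either case is excluded.
  obtain ⟨a₁, h₁, a₀, h₀, rfl⟩ := torusSpan_split (fun x => 0 < x i) ha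
  obtain ⟨b₁, h₁', b₀, h₀', rfl⟩ := torusSpan_split (fun x => m < x i) hb'
  have e1 : a₀ * b₀ ∈ torusSpan L fun x => x i ≤ m :=
    mul_mem_torusSpan (fun x y hx hy => by
      simp only [Pi.add_apply]
      omega) h₀ h₀'
  have e2 : a₀ * b₀ ∈ torusSpan L fun x => m < x i := by
    have : a₀ * b₀ = (a₁ + a₀) * (b₁ + b₀) - a₁ * (b₁ + b₀) - a₀ * b₁ := by noncomm_ring
    rw [this]
    refine sub_mem (sub_mem (torusSpan_mono (fun x hx => by omega) hab)
      (mul_mem_torusSpan (fun x y hx hy => ?_) h₁ hb'))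
      (mul_mem_torusSpan (fun x y hx hy => ?_) h₀ h₁') <;>
    · simp only [Pi.add_apply]
      omega
  rcases mul_eq_zero.1 (torusSpan_disjoint (fun x hx => by omega) e1 e2) with h | h
  · refine ha' ?_
    rw [h, add_zero]
    exact torusSpan_mono (fun x hx => hx.2) h₁
  · rw [h, add_zero] at hh'
    have := (h₁' h' hh').2
    omega

variable [DecidableEq ι]

theorem numer_mem_laurentSpan {a : QuantumTorus L} (ha : a ∈ torusSpan L Q) :
    numer L a ∈ laurentSpan (q L) (X L) Q := by
  induction ha using torusSpan_induction with
  | h0 => rw [map_zero]; exact zero_mem _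
  | hadd a b _ _ ha hb => rw [map_add]; exact add_mem ha hb
  | hsingle x z hx =>
    rw [← mul_one z, ← smul_eq_mul, ← MonoidAlgebra.smul_single, map_zsmul, numer_single]
    exact zsmul_mem (smul_mem_laurentSpan _ hx) _

theorem exists_numer_eq {z : QuantumField L} (hz : z ∈ laurentSpan (q L) (X L) Q) :
    ∃ a ∈ torusSpan L Q, numer L a = z := by
  have h : laurentSpan (q L) (X L) Q ≤
      (torusSpan L Q).map (numer L).toAddMonoidHom := laurentSpan_le fun s x hx =>
    ⟨MonoidAlgebra.single ⟨s, x⟩ 1, single_mem_torusSpan hx _, numer_single ⟨s, x⟩⟩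
  exact h hz

end TorusSpan

/-! ### Specialization of quantum cluster variables to classical ones -/

section Specialize

open QuantumField

variable {ι : Type} [Fintype ι] {L : Matrix ι ι ℤ} {F : Type} [Field F]

/-- The value at `q = 1` and `X_i = x_i`. -/
noncomputable def torusSpec (L : Matrix ι ι ℤ) (x : ι → F) : QuantumTorus L →+ F where
  toFun a := a.coeff.sum fun h z => (z : F) * ∏ i, x i ^ h.vec i
  map_zero' := Finsupp.sum_zero_index
  map_add' a b := by
    rw [MonoidAlgebra.coeff_add]
    refine Finsupp.sum_add_index' (fun h => ?_) fun h z z' => ?_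
    · rw [Int.cast_zero, zero_mul]
    · rw [Int.cast_add, add_mul]

theorem torusSpec_single (x : ι → F) (h : HeisenbergGroup L) (z : ℤ) :
    torusSpec L x (MonoidAlgebra.single h z) = z * ∏ i, x i ^ h.vec i := by
  change Finsupp.sum (Finsupp.single h z) (fun h z => (z : F) * ∏ i, x i ^ h.vec i) = _
  exact Finsupp.sum_single_index (by rw [Int.cast_zero, zero_mul])

/-- The exponents of monomials that can be evaluated at `x`. -/
def Evaluable (x : ι → F) (c : ι → ℤ) : Prop := ∀ i, x i = 0 → 0 ≤ c i

omit [Fintype ι] in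
theorem Evaluable.add {x : ι → F} {c c' : ι → ℤ} (hc : Evaluable x c) (hc' : Evaluable x c') :
    Evaluable x (c + c') := fun i hi => add_nonneg (hc i hi) (hc' i hi)

omit [Fintype ι] in
theorem Evaluable.zpow_add {x : ι → F} {c c' : ι → ℤ} (hc : Evaluable x c) (hc' : Evaluable x c')
    (i : ι) : x i ^ (c i + c' i) = x i ^ c i * x i ^ c' i := by
  by_cases hi : x i = 0
  · lift c i to ℕ using hc i hi with a
    lift c' i to ℕ using hc' i hi with b
    rw [← Nat.cast_add, zpow_natCast, zpow_natCast, zpow_natCast, pow_add]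
  · exact zpow_add₀ hi _ _

/-- At `q = 1` the relations become commutative. The restriction on supports is needed because at a
zero coordinate `x^(a+b) = x^a x^b` may fail for negative exponents. -/
theorem torusSpec_mul {x : ι → F} {a b : QuantumTorus L} (ha : a ∈ torusSpan L (Evaluable x))
    (hb : b ∈ torusSpan L (Evaluable x)) :
    torusSpec L x (a * b) = torusSpec L x a * torusSpec L x b := by
  induction ha using torusSpan_induction with
  | h0 => simp
  | hadd a a' _ _ h h' => rw [add_mul, map_add, map_add, add_mul, h, h']
  | hsingle h z hh =>
    induction hb using torusSpan_induction with
    | h0 => simp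
    | hadd b b' _ _ h h' => rw [mul_add, map_add, map_add, mul_add, h, h']
    | hsingle h' z' hh' =>
      rw [MonoidAlgebra.single_mul_single, torusSpec_single, torusSpec_single, torusSpec_single,
        HeisenbergGroup.mul_vec]
      simp only [Pi.add_apply, hh.zpow_add hh', Finset.prod_mul_distrib, Int.cast_mul]
      ring

/-- `y` is a Laurent polynomial with the value `m` at `q = 1` and `X_i = x_i`. -/
def HasValue (x : ι → F) (y : QuantumField L) (m : F) : Prop :=
  ∃ a ∈ torusSpan L (Evaluable x), numer L a = y ∧ torusSpec L x a = m

namespace HasValue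

variable {x : ι → F} {y y' : QuantumField L} {m m' : F}

theorem add (h : HasValue x y m) (h' : HasValue x y' m') : HasValue x (y + y') (m + m') := by
  obtain ⟨a, ha, rfl, rfl⟩ := h
  obtain ⟨b, hb, rfl, rfl⟩ := h'
  exact ⟨a + b, add_mem ha hb, map_add _ _ _, map_add _ _ _⟩

theorem mul (h : HasValue x y m) (h' : HasValue x y' m') : HasValue x (y * y') (m * m') := by
  obtain ⟨a, ha, rfl, rfl⟩ := h
  obtain ⟨b, hb, rfl, rfl⟩ := h'
  exact ⟨a * b, mul_mem_torusSpan (fun _ _ => Evaluable.add) ha hb, map_mul _ _ _,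
    torusSpec_mul ha hb⟩

theorem zsmul (h : HasValue x y m) (z : ℤ) : HasValue x (z • y) (z * m) := by
  obtain ⟨a, ha, rfl, rfl⟩ := h
  exact ⟨z • a, zsmul_mem ha z, map_zsmul _ _ _, by rw [map_zsmul, zsmul_eq_mul]⟩

theorem unique (h : HasValue x y m) (h' : HasValue x y m') : m = m' := by
  obtain ⟨a, ha, rfl, rfl⟩ := h
  obtain ⟨b, hb, hab, rfl⟩ := h'
  rw [numer_injective hab]

variable [DecidableEq ι]

theorem monomial (s : ℤ) {c : ι → ℤ} (hc : Evaluable x c) :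
    HasValue x (q L ^ s • X L c) (∏ i, x i ^ c i) :=
  ⟨MonoidAlgebra.single ⟨s, c⟩ 1, single_mem_torusSpan hc _, numer_single ⟨s, c⟩, by
    rw [torusSpec_single, Int.cast_one, one_mul]⟩

theorem qpow (s : ℤ) : HasValue x (qHalf L ^ s) 1 := by
  have := monomial (L := L) (x := x) s (c := 0) fun i _ => le_rfl
  rw [q_smul, show X L 0 = 1 from map_one (numer L), mul_one] at this
  simpa using this

theorem one : HasValue x (1 : QuantumField L) 1 := by simpa using qpow (L := L) (x := x) 0

theorem qsmul (s : ℤ) (h : HasValue x y m) : HasValue x (q L ^ s • y) m := by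
  rw [q_smul, ← one_mul m]
  exact (qpow s).mul h

theorem pow (h : HasValue x y m) (k : ℕ) : HasValue x (y ^ k) (m ^ k) := by
  induction k with
  | zero => simpa using one
  | succ k ih => rw [pow_succ, pow_succ]; exact ih.mul h

end HasValue

end Specialize

section SpecializeSeed

open QuantumField

variable {n r : ℕ} {d : Fin n → ℤ} {L : Matrix (Fin n ⊕ Fin r) (Fin n ⊕ Fin r) ℤ}
  {B : Matrix (Fin n ⊕ Fin r) (Fin n) ℤ} {Λ : LinearMap.BilinForm ℤ (Fin n ⊕ Fin r → ℤ)}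
  {F : Type} [Field F] {x : Fin n ⊕ Fin r → F}

theorem HasValue.frame {S : FrameSeed (QuantumField L) n r} (h : IsSeed (q L) d Λ S)
    {y : Fin n ⊕ Fin r → F} (hy : ∀ i, HasValue x (S.frame (Pi.single i 1)) (y i))
    {c : Fin n ⊕ Fin r → ℤ} (hc : ∀ i, 0 ≤ c i) :
    HasValue x (S.frame c) (∏ i, y i ^ (c i).toNat) := by
  have h1 : ∀ s : Finset (Fin n ⊕ Fin r),
      HasValue x (S.frame (∑ i ∈ s, c i • Pi.single i 1)) (∏ i ∈ s, y i ^ (c i).toNat) := by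
    intro s
    induction s using Finset.induction_on with
    | empty =>
      rw [Finset.sum_empty, Finset.prod_empty, h.map_zero]
      exact HasValue.one
    | insert i s hi ih =>
      rw [Finset.sum_insert hi, Finset.prod_insert hi, h.map_add]
      refine HasValue.qsmul _ (HasValue.mul ?_ ih)
      have h2 := (hy i).pow (c i).toNat
      rwa [← zpow_natCast, h.zpow, Int.toNat_of_nonneg (hc i)] at h2
  have h3 : ∑ i, c i • Pi.single i (1 : ℤ) = c := by
    ext j
    simp [Finset.sum_apply, Pi.single_apply]
  simpa only [h3] using h1 Finset.univ

theorem torusSpec_eq_zero {i : Fin n ⊕ Fin r} (hi : x i = 0) {a : QuantumTorus L}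
    (ha : a ∈ torusSpan L fun c => 0 < c i) : torusSpec L x a = 0 := by
  induction ha using torusSpan_induction with
  | h0 => simp
  | hadd a b _ _ ha hb => rw [map_add, ha, hb, add_zero]
  | hsingle h z hh =>
    rw [torusSpec_single, Finset.prod_eq_zero (Finset.mem_univ i), mul_zero]
    rw [hi, zero_zpow _ hh.ne']

theorem mapE_unitVec_add (k : Fin n) (hk : B (Sum.inl k) k = 0) :
    unitVec r k + mapE k B (unitVec r k) = fun i => max 0 (-B i k) := by
  ext i
  rw [Pi.add_apply, mapE_apply]
  split_ifs with h
  · simp [h, hk]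
  · simp [h]

theorem mapE_unitVec_add_col (k : Fin n) (hk : B (Sum.inl k) k = 0) :
    unitVec r k + (mapE k B (unitVec r k) + B.col k) = fun i => max 0 (B i k) := by
  rw [← add_assoc, mapE_unitVec_add k hk]
  ext i
  simp only [Pi.add_apply, Matrix.col_apply]
  omega

/-- The cluster variables of a quantum cluster algebra specialize to the classical ones. -/
theorem hasValue_along (h : IsSeed (q L) d Λ ⟨X L, B⟩) (hd : ∀ i, 0 < d i)
    (hne : ∀ w k, ((ClassicalSeed.mk x B).along w).cluster (Sum.inl k) ≠ 0) (w : List (Fin n))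
    (i : Fin n ⊕ Fin r) :
    HasValue x (((FrameSeed.mk (X L) B).along (qHalf L) d w).frame (Pi.single i 1))
      (((ClassicalSeed.mk x B).along w).cluster i) := by
  induction w generalizing i with
  | nil =>
    have := HasValue.monomial (L := L) (x := x) 0 (c := Pi.single i 1) fun j _ => by
      by_cases hij : j = i
      · subst hij; simp
      · simp [hij]
    rw [zpow_zero, one_smul] at this
    refine cast (congrArg _ ?_) this
    rw [Finset.prod_eq_single i (fun j _ hj => by simp [hj]) (by simp)]
    simp [ClassicalSeed.along]
  | cons k w ih =>
    obtain ⟨Λ', h'⟩ := h.along_isSeed w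
    rw [algebraMap_q] at h'
    set S := (FrameSeed.mk (X L) B).along (qHalf L) d w with hS
    set T := (ClassicalSeed.mk x B).along w with hT
    have hmat : T.matrix = S.matrix := by
      rw [hT, hS, along_matrix, classicalAlong_matrix]
    by_cases hi : i = Sum.inl k
    · subst hi
      have e1 : unitVec r k (Sum.inl k) = 1 := Pi.single_eq_same _ _
      have h1 := HasValue.frame h' ih (c := fun i => max 0 (-S.matrix i k)) fun i =>
        le_max_left _ _
      have h2 := HasValue.frame h' ih (c := fun i => max 0 (S.matrix i k)) fun i =>
        le_max_left _ _
      have h3 : S.frame (unitVec r k) * (seedMutate (q L) d k S).frame (unitVec r k) =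
          q L ^ Λ' (unitVec r k) (mapE k S.matrix (unitVec r k)) •
              S.frame (fun i => max 0 (-S.matrix i k)) +
            q L ^ Λ' (unitVec r k) (mapE k S.matrix (unitVec r k) + S.matrix.col k) •
              S.frame (fun i => max 0 (S.matrix i k)) := by
        rw [h'.frame_seedMutate_of_eq_one k e1, mul_add, h'.mul, h'.mul,
          mapE_unitVec_add k (h'.diag k), mapE_unitVec_add_col k (h'.diag k)]
      have h4 := (h1.qsmul (Λ' (unitVec r k) (mapE k S.matrix (unitVec r k)))).add
        (h2.qsmul (Λ' (unitVec r k) (mapE k S.matrix (unitVec r k) + S.matrix.col k)))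
      rw [← h3] at h4
      obtain ⟨a, ha, hav, has⟩ := ih (Sum.inl k)
      -- The Laurent phenomenon supplies a Laurent polynomial for the new variable, whose value can
      -- then be computed from the exchange relation `a * b = p`.
      obtain ⟨b, -, hb⟩ := exists_numer_eq (h.frame_along_mem hd (k :: w) k)
      obtain ⟨p, hp, hpv, hps⟩ := h4
      have hb' : numer L b = (seedMutate (q L) d k S).frame (unitVec r k) := hb
      have hab : a * b = p := numer_injective (by rw [map_mul, hav, hb', hpv])
      -- The old variable has a non-zero value at `x`, hence a term without the `i`-th variable
      -- whenever `x i = 0`. So the new variable cannot contain negative powers of that variable.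
      have hbQ : b ∈ torusSpan L (Evaluable x) := by
        have : ∀ i, x i = 0 → b ∈ torusSpan L fun c => 0 ≤ c i := by
          intro i hi
          refine mem_torusSpan_of_mul i (torusSpan_mono (fun c hc => hc i hi) ha)
            (fun ha' => hne w k ?_) (torusSpan_mono (fun c hc => hc i hi) (hab ▸ hp))
          rw [← hT, ← has, torusSpec_eq_zero hi ha']
        exact fun e he i hi => this i hi e he
      refine ⟨b, hbQ, hb', ?_⟩
      change _ = Function.update T.cluster _ _ _
      rw [Function.update_self, eq_inv_mul_iff_mul_eq₀ (hne w k), ← has, ← torusSpec_mul ha hbQ,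
        hab, hps, ← hT, hmat, add_comm]
      simp only [max_comm (0 : ℤ)]
    · have e1 : (Pi.single i 1 : Fin n ⊕ Fin r → ℤ) (Sum.inl k) = 0 :=
        Pi.single_eq_of_ne (Ne.symm hi) _
      have h1 := IsSeed.frame_seedMutate_of_eq_zero (v := q L) (d := d) (S := S) k e1
      have h2 : (T.mutate k).cluster i = T.cluster i := Function.update_of_ne hi _ _
      change HasValue x ((seedMutate (q L) d k S).frame _) ((T.mutate k).cluster i)
      rw [h1, h2]
      exact ih i

end SpecializeSeed

/-! ### Positivity of classical cluster variables -/

section Positivity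

variable {n r : ℕ} {F : Type} [Field F]

theorem ClassicalSeed.mutate_cluster_self (k : Fin n) (S : ClassicalSeed F n r) :
    (S.mutate k).cluster (Sum.inl k) = (S.cluster (Sum.inl k))⁻¹ *
      (∏ i, S.cluster i ^ (max (S.matrix i k) 0).toNat +
        ∏ i, S.cluster i ^ (max (-S.matrix i k) 0).toNat) :=
  Function.update_self _ _ _

theorem ClassicalSeed.mutate_cluster_of_ne {k : Fin n} {i : Fin n ⊕ Fin r} (hi : i ≠ Sum.inl k)
    (S : ClassicalSeed F n r) : (S.mutate k).cluster i = S.cluster i :=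
  Function.update_of_ne hi _ _

theorem classicalAlong_inr (S : ClassicalSeed F n r) (w : List (Fin n)) (i : Fin r) :
    (S.along w).cluster (Sum.inr i) = S.cluster (Sum.inr i) := by
  induction w with
  | nil => rfl
  | cons k w ih => exact (ClassicalSeed.mutate_cluster_of_ne Sum.inr_ne_inl _).trans ih

/-- A property stable under subtraction-free operations passes to all cluster variables. -/
theorem classicalAlong_induction {P : F → Prop} (hadd : ∀ a b, P a → P b → P (a + b))
    (hmul : ∀ a b, P a → P b → P (a * b)) (hinv : ∀ a, P a → P a⁻¹) (hone : P 1)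
    {S : ClassicalSeed F n r} (hS : ∀ i, P (S.cluster i)) (w : List (Fin n)) (i : Fin n ⊕ Fin r) :
    P ((S.along w).cluster i) := by
  have hpow : ∀ a (k : ℕ), P a → P (a ^ k) := by
    intro a k ha
    induction k with
    | zero => rwa [pow_zero]
    | succ k ih => rw [pow_succ]; exact hmul _ _ ih ha
  induction w generalizing i with
  | nil => exact hS i
  | cons k w ih =>
    have hprod : ∀ e : Fin n ⊕ Fin r → ℕ, P (∏ i, (S.along w).cluster i ^ e i) := fun e =>
      Finset.prod_induction _ P hmul hone fun i _ => hpow _ _ (ih i)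
    change P (((S.along w).mutate k).cluster i)
    by_cases hi : i = Sum.inl k
    · subst hi
      rw [ClassicalSeed.mutate_cluster_self]
      exact hmul _ _ (hinv _ (ih _)) (hadd _ _ (hprod _) (hprod _))
    · rw [ClassicalSeed.mutate_cluster_of_ne hi]
      exact ih i

/-- Cluster variables stay positive when one frozen variable vanishes. -/
theorem classicalAlong_pos {S : ClassicalSeed ℚ n r} (i₀ : Fin r)
    (h0 : S.cluster (Sum.inr i₀) = 0) (hS : ∀ i, i ≠ Sum.inr i₀ → 0 < S.cluster i)
    (w : List (Fin n)) (i : Fin n ⊕ Fin r) (hi : i ≠ Sum.inr i₀) :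
    0 < (S.along w).cluster i := by
  induction w generalizing i with
  | nil => exact hS i hi
  | cons k w ih =>
    change 0 < ((S.along w).mutate k).cluster i
    by_cases hik : i = Sum.inl k
    · subst hik
      rw [ClassicalSeed.mutate_cluster_self]
      refine mul_pos (inv_pos.2 (ih _ hi)) ?_
      have hnn : ∀ e : Fin n ⊕ Fin r → ℕ, 0 ≤ ∏ i, (S.along w).cluster i ^ e i := fun e =>
        Finset.prod_nonneg fun i _ => pow_nonneg (by
          by_cases hi : i = Sum.inr i₀
          · rw [hi, classicalAlong_inr, h0]
          · exact (ih i hi).le) _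
      have hp : ∀ e : Fin n ⊕ Fin r → ℕ, e (Sum.inr i₀) = 0 →
          0 < ∏ i, (S.along w).cluster i ^ e i := fun e he =>
        Finset.prod_pos fun i _ => by
          by_cases hi : i = Sum.inr i₀
          · rw [hi, he, pow_zero]; exact one_pos
          · exact pow_pos (ih i hi) _
      -- The vanishing variable occurs in at most one of the two exchange monomials, so the other
      -- one is strictly positive.
      rcases le_total ((S.along w).matrix (Sum.inr i₀) k) 0 with h | h
      · exact add_pos_of_pos_of_nonneg (hp _ (by simp [h])) (hnn _)
      · exact add_pos_of_nonneg_of_pos (hnn _) (hp _ (by simp [h]))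
    · rw [ClassicalSeed.mutate_cluster_of_ne hik]
      exact ih i hi

namespace RatFunField

variable {σ : Type}

/-- Quotients of polynomials that are positive at `(1, …, 1)`. -/
def IsPos (z : RatFunField σ) : Prop :=
  ∃ p q : MvPolynomial σ ℤ, 0 < MvPolynomial.eval (fun _ => 1) p ∧
    0 < MvPolynomial.eval (fun _ => 1) q ∧
    z = algebraMap _ (RatFunField σ) p / algebraMap _ (RatFunField σ) q

theorem algebraMap_ne_zero {p : MvPolynomial σ ℤ} (hp : 0 < MvPolynomial.eval (fun _ => 1) p) :
    algebraMap _ (RatFunField σ) p ≠ 0 := by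
  rw [Ne, FaithfulSMul.algebraMap_eq_zero_iff]
  rintro rfl
  simp at hp

theorem IsPos.ne_zero {z : RatFunField σ} (hz : IsPos z) : z ≠ 0 := by
  obtain ⟨p, q, hp, hq, rfl⟩ := hz
  exact div_ne_zero (algebraMap_ne_zero hp) (algebraMap_ne_zero hq)

theorem IsPos.add {z w : RatFunField σ} (hz : IsPos z) (hw : IsPos w) : IsPos (z + w) := by
  obtain ⟨p, q, hp, hq, rfl⟩ := hz
  obtain ⟨p', q', hp', hq', rfl⟩ := hw
  refine ⟨p * q' + q * p', q * q', ?_, ?_, ?_⟩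
  · rw [map_add, map_mul, map_mul]; positivity
  · rw [map_mul]; positivity
  · rw [div_add_div _ _ (algebraMap_ne_zero hq) (algebraMap_ne_zero hq'), map_add, map_mul, map_mul,
      map_mul]

theorem IsPos.mul {z w : RatFunField σ} (hz : IsPos z) (hw : IsPos w) : IsPos (z * w) := by
  obtain ⟨p, q, hp, hq, rfl⟩ := hz
  obtain ⟨p', q', hp', hq', rfl⟩ := hw
  refine ⟨p * p', q * q', ?_, ?_, ?_⟩
  · rw [map_mul]; positivity
  · rw [map_mul]; positivity
  · rw [div_mul_div_comm, map_mul, map_mul]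

theorem IsPos.inv {z : RatFunField σ} (hz : IsPos z) : IsPos z⁻¹ := by
  obtain ⟨p, q, hp, hq, rfl⟩ := hz
  exact ⟨q, p, hq, hp, inv_div _ _⟩

theorem IsPos.one : IsPos (1 : RatFunField σ) := ⟨1, 1, by simp, by simp, by simp⟩

theorem IsPos.var (i : σ) : IsPos (var i) :=
  ⟨MvPolynomial.X i, 1, by simp, by simp, by simp [RatFunField.var]⟩

theorem IsPos.zpow {z : RatFunField σ} (hz : IsPos z) (m : ℤ) : IsPos (z ^ m) := by
  have hpow : ∀ k : ℕ, IsPos (z ^ k) := by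
    intro k
    induction k with
    | zero => rw [pow_zero]; exact IsPos.one
    | succ k ih => rw [pow_succ]; exact ih.mul hz
  obtain ⟨k, rfl | rfl⟩ := m.eq_nat_or_neg
  · rw [zpow_natCast]; exact hpow k
  · rw [zpow_neg, zpow_natCast]; exact (hpow k).inv

theorem IsPos.prod {ι : Type} [Fintype ι] {z : ι → RatFunField σ} (hz : ∀ i, IsPos (z i)) :
    IsPos (∏ i, z i) :=
  Finset.prod_induction _ _ (fun _ _ => IsPos.mul) IsPos.one fun i _ => hz i

theorem IsPos.along {S : ClassicalSeed (RatFunField σ) n r} (hS : ∀ i, IsPos (S.cluster i))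
    (w : List (Fin n)) (i : Fin n ⊕ Fin r) : IsPos ((S.along w).cluster i) :=
  classicalAlong_induction (P := IsPos) (fun _ _ => IsPos.add) (fun _ _ => IsPos.mul)
    (fun _ => IsPos.inv) IsPos.one hS w i

end RatFunField

end Positivity

/-! ### The quantum cluster algebra with principal coefficients -/

section Principal

open QuantumField

variable {n r : ℕ} {d : Fin n → ℤ} {B0 : Matrix (Fin n) (Fin n) ℤ}

theorem principalForm_transpose (hDB : (zForm B0 d).transpose = -zForm B0 d) :
    (principalForm B0 d 0).transpose = -principalForm B0 d 0 := by
  have h1 : B0.transpose * Matrix.diagonal d = -(Matrix.diagonal d * B0) := by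
    rw [← hDB, Matrix.transpose_mul, Matrix.diagonal_transpose]
  rw [principalForm, Matrix.fromBlocks_transpose, Matrix.fromBlocks_neg]
  congr 1 <;> simp [h1]

/-- The choice `Λ = 0` suffices: the element to be shown polynomial is the same for all
coefficients, so one principal algebra decides. -/
theorem principal_isQuantumSeed (hDB : (zForm B0 d).transpose = -zForm B0 d) :
    IsQuantumSeed d (principalForm B0 d 0) (X _) (principalMatrix B0) (principalForm B0 d 0) := by
  refine ⟨principalForm_transpose hDB,
    ⟨RingEquiv.refl _, AddEquiv.refl _, rfl, fun _ => rfl, fun i j => ?_⟩, ?_⟩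
  · simp
  · rw [IsCompatible, principalMatrix, principalForm, Matrix.transpose_fromRows,
      Matrix.transpose_one, ← Matrix.fromCols_fromRows_eq_fromBlocks,
      Matrix.mul_fromCols, Matrix.fromCols_mul_fromRows, Matrix.fromCols_mul_fromRows,
      Matrix.zero_mul, Matrix.mul_zero, neg_zero, zero_sub, Matrix.mul_neg]
    simp

theorem IsQuantumSeed.exists_isSubst {L Λ : Matrix (Fin n ⊕ Fin r) (Fin n ⊕ Fin r) ℤ}
    {M : (Fin n ⊕ Fin r → ℤ) → QuantumField L} {B : Matrix (Fin n ⊕ Fin r) (Fin n) ℤ}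
    (hd : ∀ i, 0 < d i) (h : IsQuantumSeed d L M B Λ) (hB : principalPart B = B0) :
    ∃ φ : QuantumField (zForm B0 d) →+* QuantumField L, IsSubst (q L) ⟨M, B⟩ φ := by
  obtain ⟨h', hinj, -⟩ := h.2.1.exists_isToric h.1
  have hS := h.isSeed hd
  exact hS.exists_isSubst hB (torusHom_comp_injective h' hinj _ hS.mulVec_injective _)

/-- Subtracting the column combination with the same frozen coordinates leaves a vector `γ`
supported on the mutable part. Its pairing with the `i`-th frozen basis vector is `d_i γ_i`, since
`Λ = 0` and column combinations pair to zero with frozen vectors. -/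
theorem principal_eq_mulVec (hd : ∀ i, 0 < d i) (hDB : (zForm B0 d).transpose = -zForm B0 d)
    {c : Fin n ⊕ Fin n → ℤ}
    (hc : ∀ i, matForm (principalForm B0 d 0) (Pi.single (Sum.inr i) 1) c = 0) :
    c = (principalMatrix B0).mulVec (c ∘ Sum.inr) := by
  have hS := (principal_isQuantumSeed hDB).isSeed hd
  have h1 : ∀ e i, (principalMatrix B0).mulVec e (Sum.inr i) = e i := fun e i => by
    simp [principalMatrix, Matrix.fromRows_mulVec]
  have h2 : ∀ i, (c - (principalMatrix B0).mulVec (c ∘ Sum.inr)) (Sum.inr i) = 0 := fun i => by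
    rw [Pi.sub_apply, h1]; exact sub_self _
  have h3 : ∀ (γ : Fin n ⊕ Fin n → ℤ) i, (∀ i, γ (Sum.inr i) = 0) →
      matForm (principalForm B0 d 0) (Pi.single (Sum.inr i) 1) γ = d i * γ (Sum.inl i) := by
    intro γ i hγ
    rw [matForm_apply, single_one_dotProduct, Matrix.mulVec, dotProduct, Fintype.sum_sum_type]
    simp [principalForm, hγ, Matrix.diagonal_apply]
  rw [← sub_eq_zero]
  ext i
  rcases i with i | i
  · have h4 := h3 _ i h2
    rw [map_sub, hc, hS.skew, hS.form_mulVec] at h4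
    simp only [Pi.single_apply, reduceCtorEq, if_false, mul_zero, Finset.sum_const_zero, neg_zero,
      sub_zero] at h4
    exact (mul_eq_zero.1 h4.symm).resolve_left (hd i).ne'
  · exact h2 i

theorem gMap_principal_unitVec (w : List (Fin n)) (j : Fin n) :
    gMap (principalMatrix B0) w (unitVec n j) =
      Sum.elim (gMap (principalMatrix B0) w (unitVec n j) ∘ Sum.inl) 0 := by
  ext i
  rcases i with i | i
  · rfl
  · rw [gMap_principal_inr]
    simp

theorem IsSubst.numer_single {L : Matrix (Fin n ⊕ Fin r) (Fin n ⊕ Fin r) ℤ}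
    {B : Matrix (Fin n ⊕ Fin r) (Fin n) ℤ}
    {φ : QuantumField (zForm B0 d) →+* QuantumField L} (hφ : IsSubst (q L) ⟨X L, B⟩ φ)
    (x : HeisenbergGroup (zForm B0 d)) (z : ℤ) :
    φ (QuantumField.numer _ (MonoidAlgebra.single x z)) =
      z • q L ^ x.half • QuantumField.X L (B.mulVec x.vec) := by
  rw [numer_single_int, map_zsmul, map_mul, map_zpow₀, hφ.map_qHalf, hφ.map_X, q_smul, algebraMap_q]

/-- The quantum F-polynomial. -/
theorem exists_isPolynomial (hd : ∀ i, 0 < d i) (hDB : (zForm B0 d).transpose = -zForm B0 d)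
    (w : List (Fin n)) (j : Fin n)
    {φ : QuantumField (zForm B0 d) →+* QuantumField (principalForm B0 d 0)}
    (hφ : IsSubst (q (principalForm B0 d 0)) ⟨X (principalForm B0 d 0), principalMatrix B0⟩ φ)
    {z : QuantumField (zForm B0 d)}
    (hz : ((FrameSeed.mk (X (principalForm B0 d 0)) (principalMatrix B0)).along
        (qHalf _) d w).frame (unitVec n j) =
      φ z * X _ (gMap (principalMatrix B0) w (unitVec n j))) :
    ∃ F : QuantumTorus (zForm B0 d), F.IsPolynomial ∧ numer _ F = z := by
  have hL : (principalForm B0 d 0).transpose = -(principalForm B0 d 0) :=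
    principalForm_transpose hDB
  have hS : IsSeed (q (principalForm B0 d 0)) d (matForm (principalForm B0 d 0))
      ⟨X (principalForm B0 d 0), principalMatrix B0⟩ :=
    (principal_isQuantumSeed hDB).isSeed hd
  set G := gMap (principalMatrix B0) w (unitVec n j) with hG
  have hG0 : ∀ i, G (Sum.inr i) = 0 := fun i => by
    rw [hG, gMap_principal_unitVec]; rfl
  obtain ⟨a, -, ha⟩ := exists_numer_eq (hS.frame_along_mem hd w j)
  rw [algebraMap_q, hz] at ha
  have ha1 : ∀ i₀, a ∈ torusSpan (principalForm B0 d 0) fun c => 0 ≤ c (Sum.inr i₀) := by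
    intro i₀
    -- At this point all mutable cluster variables are positive, while evaluability excludes
    -- negative powers of the one vanishing frozen variable.
    let x : Fin n ⊕ Fin n → ℚ := Function.update 1 (Sum.inr i₀) 0
    have hne : ∀ w k, ((ClassicalSeed.mk x (principalMatrix B0)).along w).cluster (Sum.inl k) ≠ 0 :=
      fun w k => (classicalAlong_pos i₀ (Function.update_self _ _ _)
        (fun i hi => by simp [x, hi]) w _ Sum.inl_ne_inr).ne'
    obtain ⟨a', ha', h1, -⟩ := hasValue_along hS hd hne w (Sum.inl j)
    have h2 : a' = a := numer_injective (h1.trans (hz.trans ha.symm))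
    subst h2
    exact torusSpan_mono (fun c hc => hc _ (Function.update_self _ _ _)) ha'
  set b : QuantumTorus (principalForm B0 d 0) := a * MonoidAlgebra.single ⟨0, -G⟩ 1 with hb
  have hbz : numer (principalForm B0 d 0) b = φ z := by
    rw [hb, map_mul, ha, numer_single, zpow_zero, one_smul, mul_assoc]
    have := (X_isToric hL).mul_neg_cancel G
    rw [this, mul_one]
  have hb1 : ∀ i₀, b ∈ torusSpan (principalForm B0 d 0) fun c => 0 ≤ c (Sum.inr i₀) := by
    intro i₀
    have h1 : MonoidAlgebra.single ⟨0, -G⟩ 1 ∈ torusSpan (principalForm B0 d 0)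
        fun c => 0 ≤ c (Sum.inr i₀) := single_mem_torusSpan (by simp [hG0]) 1
    exact mul_mem_torusSpan (fun x y hx hy => by
      simp only [Pi.add_apply]
      omega) (ha1 i₀) h1
  -- The twist attached to a frozen basis vector is trivial, so `φ z` commutes with every frozen
  -- variable and so does each monomial occurring in it.
  have hb2 : ∀ i₀, b ∈ torusSpan (principalForm B0 d 0) fun c =>
      matForm (principalForm B0 d 0) (Pi.single (Sum.inr i₀) 1) c = 0 := by
    intro i₀
    have h0 : ∀ c, RingHom.id (QuantumField (zForm B0 d)) (X _ c) = qHalf _ ^ (-(2 * ∑ j, c j *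
        (d j * (Pi.single (Sum.inr i₀) 1 : Fin n ⊕ Fin n → ℤ) (Sum.inl j)))) * X _ c := fun c => by
      simp
    have h1 := hφ.frame_mul hS (Pi.single (Sum.inr i₀) 1) (τ := RingHom.id _) rfl h0 z
    rw [RingHom.id_apply, ← hbz] at h1
    have h2 := (X_isToric hL).mem_laurentSpan_of_eigen (Pi.single (Sum.inr i₀) 1) (m := 0)
      (numer_mem_laurentSpan (Q := fun _ => True) (a := b) fun _ _ => trivial)
      (by rw [mul_zero, zpow_zero, one_smul]; exact h1)
    obtain ⟨b', hb', hbb⟩ := exists_numer_eq h2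
    rw [← numer_injective hbb]
    exact torusSpan_mono (fun c hc => hc.2) hb'
  have hb3 : b ∈ torusSpan (principalForm B0 d 0) fun c => ∃ e : Fin n → ℤ, (∀ i, 0 ≤ e i) ∧
      c = (principalMatrix B0).mulVec e := fun h hh =>
    ⟨h.vec ∘ Sum.inr, fun i => hb1 i h hh, principal_eq_mulVec hd hDB fun i => hb2 i h hh⟩
  have key : ∀ b ∈ torusSpan (principalForm B0 d 0) fun c => ∃ e : Fin n → ℤ, (∀ i, 0 ≤ e i) ∧
      c = (principalMatrix B0).mulVec e,
      ∃ F ∈ torusSpan (zForm B0 d) (fun e => ∀ i, 0 ≤ e i),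
        φ (numer _ F) = numer (principalForm B0 d 0) b := by
    intro b hb
    induction hb using torusSpan_induction with
    | h0 => exact ⟨0, zero_mem _, by simp only [map_zero]⟩
    | hadd a b _ _ ha hb =>
      obtain ⟨F, hF, h1⟩ := ha
      obtain ⟨F', hF', h2⟩ := hb
      exact ⟨F + F', add_mem hF hF', by simp only [map_add, h1, h2]⟩
    | hsingle x y hx =>
      obtain ⟨e, he, hxe⟩ := hx
      refine ⟨MonoidAlgebra.single ⟨x.half, e⟩ y, single_mem_torusSpan he y, ?_⟩
      rw [hφ.numer_single, ← hxe, ← numer_single, ← map_zsmul, MonoidAlgebra.smul_single,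
        smul_eq_mul, mul_one]
  obtain ⟨F, hF, h1⟩ := key b hb3
  exact ⟨F, hF, φ.injective (h1.trans hbz)⟩

/-- The commutative counterpart of the expression by the quantum F-polynomial. -/
theorem classical_expression (hd : ∀ i, 0 < d i) (hDB : (zForm B0 d).transpose = -zForm B0 d)
    (w : List (Fin n)) (j : Fin n)
    {φ : QuantumField (zForm B0 d) →+* QuantumField (principalForm B0 d 0)}
    (hφ : IsSubst (q (principalForm B0 d 0)) ⟨X (principalForm B0 d 0), principalMatrix B0⟩ φ)
    {F : QuantumTorus (zForm B0 d)}
    (hF : ((FrameSeed.mk (X (principalForm B0 d 0)) (principalMatrix B0)).along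
        (qHalf _) d w).frame (unitVec n j) =
      φ (numer _ F) * X _ (gMap (principalMatrix B0) w (unitVec n j)))
    {R : Type} [Field R] {x : Fin n ⊕ Fin n → R} (hx : ∀ i, x i ≠ 0)
    (hne : ∀ w k, ((ClassicalSeed.mk x (principalMatrix B0)).along w).cluster (Sum.inl k) ≠ 0) :
    ((ClassicalSeed.mk x (principalMatrix B0)).along w).cluster (Sum.inl j) =
      torusSpec (zForm B0 d) (fun k => ∏ i, x i ^ principalMatrix B0 i k) F *
        ∏ i, x i ^ gMap (principalMatrix B0) w (unitVec n j) i := by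
  have hS := (principal_isQuantumSeed hDB).isSeed hd
  have hev : ∀ c, Evaluable x c := fun c i hi => absurd hi (hx i)
  have h1 := hasValue_along hS hd hne w (Sum.inl j)
  rw [hF] at h1
  have h2 : HasValue x (φ (numer _ F))
      (torusSpec (zForm B0 d) (fun k => ∏ i, x i ^ principalMatrix B0 i k) F) := by
    clear hF h1
    induction F using MonoidAlgebra.induction_linear with
    | zero =>
      rw [map_zero, map_zero, map_zero]
      exact ⟨0, zero_mem _, map_zero _, map_zero _⟩
    | add a b ha hb => rw [map_add, map_add, map_add]; exact ha.add hb
    | single h z =>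
      rw [hφ.numer_single, torusSpec_single]
      have h3 := (HasValue.monomial (L := principalForm B0 d 0) h.half
        (hev ((principalMatrix B0).mulVec h.vec))).zsmul z
      refine cast (congrArg _ ?_) h3
      congr 1
      simp only [← Finset.prod_zpow]
      rw [Finset.prod_comm]
      refine Finset.prod_congr rfl fun i _ => ?_
      rw [Matrix.mulVec, dotProduct, ← Finset.prod_congr rfl fun k _ => zpow_mul (x i) _ _]
      generalize (Finset.univ : Finset (Fin n)) = s
      induction s using Finset.induction_on with
      | empty => simp
      | insert k s hk ih => rw [Finset.sum_insert hk, Finset.prod_insert hk, zpow_add₀ (hx i), ih]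
  have h3 := HasValue.monomial (L := principalForm B0 d 0) 0
    (hev (gMap (principalMatrix B0) w (unitVec n j)))
  rw [zpow_zero, one_smul] at h3
  exact h1.unique (h2.mul h3)

end Principal

/-! ### Separation of additions for classical cluster variables -/

section Separation

variable {n r : ℕ} {R : Type} [Field R]

/-- The Laurent monomial `x^c`. -/
def laurentMonomial {ι : Type} [Fintype ι] (x : ι → R) (c : ι → ℤ) : R := ∏ i, x i ^ c i

theorem laurentMonomial_add {ι : Type} [Fintype ι] {x : ι → R} (hx : ∀ i, x i ≠ 0) (c c' : ι → ℤ) :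
    laurentMonomial x (c + c') = laurentMonomial x c * laurentMonomial x c' := by
  simp only [laurentMonomial, Pi.add_apply, zpow_add₀ (hx _), Finset.prod_mul_distrib]

theorem laurentMonomial_zero {ι : Type} [Fintype ι] (x : ι → R) : laurentMonomial x 0 = 1 := by
  simp [laurentMonomial]

theorem laurentMonomial_ne_zero {ι : Type} [Fintype ι] {x : ι → R} (hx : ∀ i, x i ≠ 0)
    (c : ι → ℤ) : laurentMonomial x c ≠ 0 :=
  Finset.prod_ne_zero_iff.2 fun i _ => zpow_ne_zero _ (hx i)

theorem laurentMonomial_neg {ι : Type} [Fintype ι] (x : ι → R) (c : ι → ℤ) :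
    laurentMonomial x (-c) = (laurentMonomial x c)⁻¹ := by
  simp [laurentMonomial, Finset.prod_inv_distrib]

theorem laurentMonomial_smul {ι : Type} [Fintype ι] (x : ι → R) (m : ℤ) (c : ι → ℤ) :
    laurentMonomial x (m • c) = laurentMonomial x c ^ m := by
  simp only [laurentMonomial, Pi.smul_apply, smul_eq_mul, mul_comm m, zpow_mul, Finset.prod_zpow]

theorem laurentMonomial_sum {ι κ : Type} [Fintype ι] {x : ι → R} (hx : ∀ i, x i ≠ 0)
    (s : Finset κ) (c : κ → ι → ℤ) :
    laurentMonomial x (∑ k ∈ s, c k) = ∏ k ∈ s, laurentMonomial x (c k) := by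
  classical
  induction s using Finset.induction_on with
  | empty => simp [laurentMonomial_zero]
  | insert k s hk ih =>
    rw [Finset.sum_insert hk, Finset.prod_insert hk, laurentMonomial_add hx, ih]

/-- The elements `ŷ_k`. -/
def yHat (B : Matrix (Fin n ⊕ Fin r) (Fin n) ℤ) (x : Fin n ⊕ Fin r → R) (k : Fin n) : R :=
  ∏ i, x i ^ B i k

theorem laurentMonomial_mulVec {B : Matrix (Fin n ⊕ Fin r) (Fin n) ℤ} {x : Fin n ⊕ Fin r → R}
    (hx : ∀ i, x i ≠ 0) (e : Fin n → ℤ) :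
    laurentMonomial x (B.mulVec e) = laurentMonomial (yHat B x) e := by
  have : B.mulVec e = ∑ j, e j • B.col j := by
    ext i
    simp [Matrix.mulVec, dotProduct, mul_comm]
  rw [this, laurentMonomial_sum hx]
  simp only [laurentMonomial_smul]
  rfl

/-- `gMap` is linear and fixes the frozen basis vectors, so the factorization of the single
variables multiplies up. -/
theorem classicalAlong_prod {B : Matrix (Fin n ⊕ Fin r) (Fin n) ℤ} {x : Fin n ⊕ Fin r → R}
    (hx : ∀ i, x i ≠ 0) {w : List (Fin n)} {p : Fin n → R}
    (hp : ∀ i, ((ClassicalSeed.mk x B).along w).cluster (Sum.inl i) =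
      p i * laurentMonomial x (gMap B w (unitVec r i))) {c : Fin n ⊕ Fin r → ℤ}
    (hc : ∀ i, 0 ≤ c i) :
    ∏ i, ((ClassicalSeed.mk x B).along w).cluster i ^ (c i).toNat =
      (∏ i, p i ^ (c (Sum.inl i)).toNat) * laurentMonomial x (gMap B w c) := by
  have hfrozen : ∀ i : Fin r, gMap B w (Pi.single (Sum.inr i) 1) = Pi.single (Sum.inr i) 1 := by
    intro i
    clear hp
    induction w with
    | nil => rfl
    | cons k w ih =>
      have h0 : (Pi.single (Sum.inr i) 1 : Fin n ⊕ Fin r → ℤ) (Sum.inl k) = 0 := by simp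
      rw [gMap_cons, mapE_of_eq_zero _ _ h0, h0, zero_smul, sub_zero, ih]
  have hcl : ∀ i, ((ClassicalSeed.mk x B).along w).cluster i =
      Sum.elim p 1 i * laurentMonomial x (gMap B w (Pi.single i 1)) := by
    rintro (i | i)
    · exact hp i
    · rw [classicalAlong_inr, hfrozen, Sum.elim_inr, Pi.one_apply, one_mul, laurentMonomial,
        Finset.prod_eq_single (Sum.inr i) (fun j _ hj => by simp [hj]) (by simp)]
      simp
  have hsum : gMap B w c = ∑ i, c i • gMap B w (Pi.single i 1) := by
    have h3 : ∑ i, c i • Pi.single i (1 : ℤ) = c := by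
      ext j
      simp [Finset.sum_apply, Pi.single_apply]
    conv_lhs => rw [← h3, map_sum]
    simp only [map_smul]
  rw [hsum, laurentMonomial_sum hx, Fintype.prod_sum_type, Fintype.prod_sum_type,
    ← mul_assoc, ← Finset.prod_mul_distrib]
  congr 1
  · refine Finset.prod_congr rfl fun i _ => ?_
    rw [hcl, mul_pow, laurentMonomial_smul, ← zpow_natCast (laurentMonomial _ _),
      Int.toNat_of_nonneg (hc _)]
    rfl
  · refine Finset.prod_congr rfl fun i _ => ?_
    rw [hcl, mul_pow, laurentMonomial_smul, ← zpow_natCast (laurentMonomial _ _),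
      Int.toNat_of_nonneg (hc _)]
    simp

/-- The cluster variables of an arbitrary cluster algebra in terms of those with principal
coefficients. -/
theorem classicalAlong_separation {B : Matrix (Fin n ⊕ Fin r) (Fin n) ℤ} {x : Fin n ⊕ Fin r → R}
    (hx : ∀ i, x i ≠ 0) (hdiag : ∀ w k, mutateAlong B w (Sum.inl k) k = 0)
    (hne : ∀ w k, ((ClassicalSeed.mk (Sum.elim (fun _ => 1) (yHat B x))
      (principalMatrix (principalPart B))).along w).cluster (Sum.inl k) ≠ 0)
    (w : List (Fin n)) (j : Fin n) :
    ((ClassicalSeed.mk x B).along w).cluster (Sum.inl j) =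
      ((ClassicalSeed.mk (Sum.elim (fun _ => 1) (yHat B x))
        (principalMatrix (principalPart B))).along w).cluster (Sum.inl j) *
        laurentMonomial x (gMap B w (unitVec r j)) := by
  induction w generalizing j with
  | nil =>
    change x (Sum.inl j) = 1 * laurentMonomial x (Pi.single _ _)
    rw [one_mul, laurentMonomial,
        Finset.prod_eq_single (Sum.inl j) (fun i _ hi => by simp [hi]) (by simp)]
    simp
  | cons k w ih =>
    set S := (ClassicalSeed.mk x B).along w with hS
    set T := (ClassicalSeed.mk (Sum.elim (fun _ => 1) (yHat B x))
      (principalMatrix (principalPart B))).along w with hT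
    have hSm : S.matrix = mutateAlong B w := by rw [hS, classicalAlong_matrix]
    have hTm : T.matrix = mutateAlong (principalMatrix (principalPart B)) w := by
      rw [hT, classicalAlong_matrix]
    change (S.mutate k).cluster _ = (T.mutate k).cluster _ * _
    by_cases hj : j = k
    · subst hj
      have hy : ∀ i, yHat B x i ≠ 0 := fun i =>
        Finset.prod_ne_zero_iff.2 fun i' _ => zpow_ne_zero _ (hx i')
      have hinl : ∀ i, mutateAlong (principalMatrix (principalPart B)) w (Sum.inl i) j =
          mutateAlong B w (Sum.inl i) j := fun i =>
        mutateAlong_inl (principalPart_principalMatrix _) w i j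
      have h1 := classicalAlong_prod hx ih (c := fun i => max (mutateAlong B w i j) 0)
        fun i => le_max_right _ _
      have h2 := classicalAlong_prod hx ih (c := fun i => max (-mutateAlong B w i j) 0)
        fun i => le_max_right _ _
      have hT' : ∀ e : Fin n ⊕ Fin n → ℤ, (∀ i, 0 ≤ e i) → ∏ i, T.cluster i ^ (e i).toNat =
          (∏ i, T.cluster (Sum.inl i) ^ (e (Sum.inl i)).toNat) *
            laurentMonomial (yHat B x) (e ∘ Sum.inr) := by
        intro e he
        rw [Fintype.prod_sum_type]
        congr 1
        refine Finset.prod_congr rfl fun i _ => ?_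
        rw [hT, classicalAlong_inr, ← zpow_natCast, Int.toNat_of_nonneg (he _)]
        rfl
      have h3 := hT' (fun i => max (mutateAlong (principalMatrix (principalPart B)) w i j) 0)
        fun i => le_max_right _ _
      have h4 := hT' (fun i => max (-mutateAlong (principalMatrix (principalPart B)) w i j) 0)
        fun i => le_max_right _ _
      simp only [hinl] at h3 h4
      rw [ClassicalSeed.mutate_cluster_self, ClassicalSeed.mutate_cluster_self, hSm, hTm, h1, h2,
        h3, h4, ih]
      set N := cNeg (principalPart B) w j with hN
      set c := cCol (principalPart B) w j with hc
      -- The two exchange monomials of the general algebra equal those of the principal one up to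
      -- the same Laurent monomial: their exponents differ by the mutated column, whose `gMap` value
      -- accounts for the c-vector exponent of `ŷ`. The common factor is the one in `e4`.
      have e1 : (fun i => max (mutateAlong (principalMatrix (principalPart B)) w i j) 0) ∘ Sum.inr =
          N + c := by
        ext i
        simp only [Function.comp, hN, hc, cNeg, cCol, Pi.add_apply]
        omega
      have e2 : (fun i => max (-mutateAlong (principalMatrix (principalPart B)) w i j) 0) ∘
          Sum.inr = N := by
        ext i
        simp only [Function.comp, hN, cNeg, cCol]
        omega
      have e3 : (fun i => max (mutateAlong B w i j) 0) =
          (fun i => max (-mutateAlong B w i j) 0) + (mutateAlong B w).col j := by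
        ext i
        simp only [Pi.add_apply, Matrix.col_apply]
        omega
      have e4 : gMap B (j :: w) (unitVec r j) =
          gMap B w (fun i => max (-mutateAlong B w i j) 0) + -gMap B w (unitVec r j) +
            -B.mulVec N := by
        have h5 := mapE_unitVec_add j (hdiag w j)
        have h6 : (fun i => max (-mutateAlong B w i j) 0) =
            unitVec r j + mapE j (mutateAlong B w) (unitVec r j) := by
          rw [h5]
          simp only [max_comm]
        have h7 : unitVec r j (Sum.inl j) = 1 := Pi.single_eq_same _ _
        rw [gMap_cons, h6, map_add, h7, one_smul]
        abel
      rw [e1, e2, e3, e4, map_add, gMap_col hdiag, laurentMonomial_add hx, laurentMonomial_add hx,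
        laurentMonomial_add hx, laurentMonomial_neg, laurentMonomial_neg, laurentMonomial_add hy,
        laurentMonomial_mulVec hx, laurentMonomial_mulVec hx]
      have n1 := laurentMonomial_ne_zero hy N
      have n2 := laurentMonomial_ne_zero hx (gMap B w (unitVec r j))
      have n3 := hne w j
      rw [← hT] at n3
      rw [← hc]
      field_simp
    · have hj' : (Sum.inl j : Fin n ⊕ Fin r) ≠ Sum.inl k := fun h => hj (Sum.inl_injective h)
      have hj'' : (Sum.inl j : Fin n ⊕ Fin n) ≠ Sum.inl k := fun h => hj (Sum.inl_injective h)
      have h0 : unitVec r j (Sum.inl k) = 0 := by simp [Ne.symm hj]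
      rw [ClassicalSeed.mutate_cluster_of_ne hj', ClassicalSeed.mutate_cluster_of_ne hj'', ih,
        gMap_cons, mapE_of_eq_zero _ _ h0, h0, zero_smul, sub_zero]

end Separation

/-! ### Homogeneity -/

section Homogeneous

variable {n : ℕ} {σ : Type} {w : σ → Fin n → ℤ} {g : Fin n → ℤ}

theorem IsLaurentHomogeneous.zero : IsLaurentHomogeneous w 0 g :=
  ⟨0, 0, MvPolynomial.isWeightedHomogeneous_zero _ _ _, by simp⟩

theorem IsLaurentHomogeneous.add {x y : RatFunField σ} (hx : IsLaurentHomogeneous w x g)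
    (hy : IsLaurentHomogeneous w y g) : IsLaurentHomogeneous w (x + y) g := by
  obtain ⟨N, P, hP, hxP⟩ := hx
  obtain ⟨N', P', hP', hyP⟩ := hy
  have hmon : (MvPolynomial.monomial (N + N') 1 : MvPolynomial σ ℤ) =
      MvPolynomial.monomial N 1 * MvPolynomial.monomial N' 1 := by
    rw [MvPolynomial.monomial_mul, one_mul]
  have hh : ∀ N : σ →₀ ℕ, (MvPolynomial.monomial N (1 : ℤ)).IsWeightedHomogeneous w
      (Finsupp.weight w N) := fun N => MvPolynomial.isWeightedHomogeneous_monomial _ _ _ rfl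
  refine ⟨N + N', P * MvPolynomial.monomial N' 1 + P' * MvPolynomial.monomial N 1, ?_, ?_⟩
  · refine MvPolynomial.IsWeightedHomogeneous.add ?_ ?_
    · have := hP.mul (hh N')
      rwa [add_assoc, ← map_add] at this
    · have := hP'.mul (hh N)
      rwa [add_assoc, ← map_add, add_comm N'] at this
  · rw [hmon, map_mul, map_add, map_mul, map_mul, ← hxP, ← hyP]
    ring

theorem IsLaurentHomogeneous.monomial [Fintype σ] (z : ℤ) (c : σ → ℤ) (hc : ∑ i, c i • w i = g) :
    IsLaurentHomogeneous w (z * laurentMonomial RatFunField.var c) g := by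
  classical
  -- The denominator carries the negative part of `c` and the numerator its positive part.
  let N : σ →₀ ℕ := Finsupp.equivFunOnFinite.symm fun i => (-c i).toNat
  let P : σ →₀ ℕ := Finsupp.equivFunOnFinite.symm fun i => (c i).toNat
  have hmon : ∀ Q : σ →₀ ℕ, algebraMap (MvPolynomial σ ℤ) (RatFunField σ)
      (MvPolynomial.monomial Q 1) = laurentMonomial RatFunField.var fun i => (Q i : ℤ) := by
    intro Q
    rw [MvPolynomial.monomial_eq, Finsupp.prod_fintype _ _ (by simp), MvPolynomial.C_1, one_mul,
      map_prod]
    simp only [map_pow, laurentMonomial, zpow_natCast]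
    rfl
  have hvar : ∀ i : σ, (RatFunField.var i : RatFunField σ) ≠ 0 := fun i =>
    (RatFunField.IsPos.var i).ne_zero
  refine ⟨N, MvPolynomial.monomial P z, MvPolynomial.isWeightedHomogeneous_monomial _ _ _ ?_, ?_⟩
  · rw [Finsupp.weight_apply, Finsupp.weight_apply, Finsupp.sum_fintype _ _ (by simp),
      Finsupp.sum_fintype _ _ (by simp), ← hc, ← Finset.sum_add_distrib]
    refine Finset.sum_congr rfl fun i _ => ?_
    have h1 : ((P i : ℕ) : ℤ) = c i + (N i : ℕ) := by
      change ((c i).toNat : ℤ) = c i + ((-c i).toNat : ℤ)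
      omega
    rw [← natCast_zsmul, ← natCast_zsmul, h1, add_smul]
  · have h2 : (MvPolynomial.monomial P z : MvPolynomial σ ℤ) =
        (z : MvPolynomial σ ℤ) * MvPolynomial.monomial P 1 := by
      rw [← eq_intCast (MvPolynomial.C (σ := σ)) z, MvPolynomial.C_mul_monomial, mul_one]
    rw [h2, map_mul, map_intCast, hmon, hmon, mul_assoc, ← laurentMonomial_add hvar]
    congr 2
    ext i
    change c i + ((-c i).toNat : ℤ) = ((c i).toNat : ℤ)
    omega

end Homogeneous

/-! ### Quantum F-polynomials -/

section Final

open QuantumField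

variable {n r : ℕ} {d : Fin n → ℤ} {B0 : Matrix (Fin n) (Fin n) ℤ}

theorem bar_eq_torusBar {Λ : Matrix (Fin n) (Fin n) ℤ} (F : QuantumTorus Λ) :
    F.bar = torusBar F := rfl

theorem bar_isPolynomial {Λ : Matrix (Fin n) (Fin n) ℤ} {F : QuantumTorus Λ}
    (hF : F.IsPolynomial) : F.bar.IsPolynomial := by
  classical
  intro h hh
  obtain ⟨h', hh', rfl⟩ := Finset.mem_image.1 (Finsupp.mapDomain_support hh)
  exact hF h' hh'

theorem torusSpec_bar {Λ : Matrix (Fin n) (Fin n) ℤ} {R : Type} [Field R] (x : Fin n → R)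
    (F : QuantumTorus Λ) : torusSpec Λ x F.bar = torusSpec Λ x F := by
  rw [bar_eq_torusBar]
  induction F using MonoidAlgebra.induction_linear with
  | zero => simp [torusBar]
  | add a b ha hb => rw [torusBar, MonoidAlgebra.mapDomain_add, map_add, map_add, ← ha, ← hb]; rfl
  | single x z => rw [torusBar, MonoidAlgebra.mapDomain_single, torusSpec_single, torusSpec_single]

theorem exists_mvPolynomial {Λ : Matrix (Fin n) (Fin n) ℤ} {F : QuantumTorus Λ}
    (hF : F.IsPolynomial) : ∃ P : MvPolynomial (Fin n) ℤ,
      ∀ (R : Type) [Field R] [Algebra ℤ R] (y : Fin n → R),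
        MvPolynomial.aeval y P = torusSpec Λ y F := by
  have hF' : F ∈ torusSpan Λ fun e => ∀ i, 0 ≤ e i := hF
  clear hF
  induction hF' using torusSpan_induction with
  | h0 => exact ⟨0, fun R _ _ y => by rw [map_zero, map_zero]⟩
  | hadd a b _ _ ha hb =>
    obtain ⟨P, hP⟩ := ha
    obtain ⟨P', hP'⟩ := hb
    exact ⟨P + P', fun R _ _ y => by rw [map_add, map_add, hP, hP']⟩
  | hsingle x z hx =>
    refine ⟨MvPolynomial.C z * ∏ i, MvPolynomial.X i ^ (x.vec i).toNat, fun R _ _ y => ?_⟩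
    rw [torusSpec_single, map_mul, map_prod, MvPolynomial.aeval_C, eq_intCast]
    congr 1
    refine Finset.prod_congr rfl fun i _ => ?_
    rw [map_pow, MvPolynomial.aeval_X, ← zpow_natCast, Int.toNat_of_nonneg (hx i)]

theorem aeval_var {σ : Type} (P : MvPolynomial σ ℤ) :
    MvPolynomial.aeval (RatFunField.var : σ → RatFunField σ) P =
      algebraMap _ (RatFunField σ) P := by
  induction P using MvPolynomial.induction_on with
  | C a => rw [MvPolynomial.aeval_C, eq_intCast, eq_intCast (MvPolynomial.C (σ := σ)), map_intCast]
  | add p q hp hq => rw [map_add, map_add, hp, hq]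
  | mul_X p i hp => rw [map_mul, map_mul, hp, MvPolynomial.aeval_X]; rfl

theorem evalYHat_eq {L Λ : Matrix (Fin n ⊕ Fin r) (Fin n ⊕ Fin r) ℤ}
    {M : (Fin n ⊕ Fin r → ℤ) → QuantumField L} {B : Matrix (Fin n ⊕ Fin r) (Fin n) ℤ}
    (hd : ∀ i, 0 < d i) (h : IsQuantumSeed d L M B Λ) (hB : principalPart B = B0)
    (F : QuantumTorus (zForm B0 d)) :
    evalYHat M B F = torusHom ((h.isSeed hd).isToric_yHat hB) F := by
  rw [← eval_eq_torusHom (h.isSeed hd).toIsToric, algebraMap_q, evalYHat]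
  congr 1
  ext k
  congr 1
  exact (Matrix.mulVec_single_one _ _).symm

/-- The classical cluster variables with principal coefficients at `x = 1`. -/
theorem torusSpec_eq_cluster {w : List (Fin n)} {j : Fin n} {F : QuantumTorus (zForm B0 d)}
    (hF : ∀ {R : Type} [Field R] {x : Fin n ⊕ Fin n → R}, (∀ i, x i ≠ 0) →
      (∀ w k, ((ClassicalSeed.mk x (principalMatrix B0)).along w).cluster (Sum.inl k) ≠ 0) →
      ((ClassicalSeed.mk x (principalMatrix B0)).along w).cluster (Sum.inl j) =
        torusSpec (zForm B0 d) (yHat (principalMatrix B0) x) F *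
          laurentMonomial x (gMap (principalMatrix B0) w (unitVec n j)))
    {σ : Type} {y : Fin n → RatFunField σ} (hy : ∀ i, (y i).IsPos) :
    ((ClassicalSeed.mk (Sum.elim (fun _ => 1) y) (principalMatrix B0)).along w).cluster
      (Sum.inl j) = torusSpec (zForm B0 d) y F := by
  have hpos : ∀ i, RatFunField.IsPos (Sum.elim (fun _ : Fin n => (1 : RatFunField σ)) y i) := by
    rintro (i | i)
    · exact RatFunField.IsPos.one
    · exact hy i
  rw [hF (fun i => (hpos i).ne_zero) fun w k => (RatFunField.IsPos.along hpos w _).ne_zero]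
  have h1 : yHat (principalMatrix B0) (Sum.elim (fun _ => 1) y) = y := by
    ext k
    rw [yHat, Fintype.prod_sum_type]
    simp only [Sum.elim_inl, one_zpow, Finset.prod_const_one, one_mul, Sum.elim_inr]
    rw [Finset.prod_eq_single k (fun i _ hi => by simp [principalMatrix, hi]) (by simp)]
    simp [principalMatrix]
  have h2 : laurentMonomial (Sum.elim (fun _ => 1) y)
      (gMap (principalMatrix B0) w (unitVec n j)) = 1 := by
    rw [gMap_principal_unitVec, laurentMonomial, Fintype.prod_sum_type]
    simp
  rw [h1, h2, mul_one]

/-- Each `ŷ_k` has degree zero, as the degree of `y_k` is minus that of its mutable part; hence only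
the monomial with exponent `G` contributes to the degree. -/
theorem isLaurentHomogeneous_torusSpec (G : Fin n → ℤ) (F : QuantumTorus (zForm B0 d)) :
    IsLaurentHomogeneous (Sum.elim (fun i => Pi.single i 1) (fun k => -fun i => B0 i k))
      (torusSpec (zForm B0 d) (yHat (principalMatrix B0) RatFunField.var) F *
        laurentMonomial RatFunField.var (Sum.elim G 0)) G := by
  have hvar : ∀ i : Fin n ⊕ Fin n, (RatFunField.var i : RatFunField (Fin n ⊕ Fin n)) ≠ 0 :=
    fun i => (RatFunField.IsPos.var i).ne_zero
  induction F using MonoidAlgebra.induction_linear with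
  | zero => rw [map_zero, zero_mul]; exact IsLaurentHomogeneous.zero
  | add a b ha hb => rw [map_add, add_mul]; exact ha.add hb
  | single h z =>
    rw [torusSpec_single, mul_assoc]
    change IsLaurentHomogeneous _ (z * (laurentMonomial (yHat _ _) h.vec * _)) _
    rw [← laurentMonomial_mulVec hvar, ← laurentMonomial_add hvar]
    refine IsLaurentHomogeneous.monomial z _ ?_
    rw [Fintype.sum_sum_type]
    ext i
    have h1 : ∀ k, (principalMatrix B0).mulVec h.vec (Sum.inr k) = h.vec k := fun k => by
      simp [principalMatrix, Matrix.fromRows_mulVec]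
    have h2 : ∀ k, (principalMatrix B0).mulVec h.vec (Sum.inl k) = B0.mulVec h.vec k := fun k => by
      simp [principalMatrix, Matrix.fromRows_mulVec]
    simp only [Pi.add_apply, Finset.sum_apply, Pi.smul_apply, Sum.elim_inl, Sum.elim_inr, h1, h2,
      Pi.neg_apply, smul_eq_mul, Pi.single_apply, Pi.zero_apply, add_zero, mul_ite, mul_one,
      mul_zero, Finset.sum_ite_eq, Finset.mem_univ, if_true]
    rw [Matrix.mulVec, dotProduct, add_right_comm, ← Finset.sum_add_distrib]
    rw [Finset.sum_eq_zero (fun k _ => by ring), zero_add]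

end Final

theorem mainTheorem5 (n : ℕ) (B0 : Matrix (Fin n) (Fin n) ℤ) (d : Fin n → ℤ)
    (hd : ∀ i, 0 < d i)
    (hDB : (Matrix.diagonal d * B0).transpose = -(Matrix.diagonal d * B0))
    (t : TreeVertex n) (j : Fin n) :
    ∃ (g : Fin n → ℤ) (F : QuantumTorus (Matrix.diagonal d * B0)),
      IsGVector B0 t j g ∧
      -- `F` is the left quantum F-polynomial and `F.bar` the right one
      F.IsPolynomial ∧ F.bar.IsPolynomial ∧
      (∀ (Λ : Matrix (Fin n) (Fin n) ℤ), Λ.transpose = -Λ →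
        ∀ (L : Matrix (Fin n ⊕ Fin n) (Fin n ⊕ Fin n) ℤ)
          (M0 : (Fin n ⊕ Fin n → ℤ) → QuantumField L),
          IsQuantumSeed d L M0 (principalMatrix B0) (principalForm B0 d Λ) →
          (∀ P : QuantumTorus (Matrix.diagonal d * B0), P.IsPolynomial →
            (quantumClusterVariable d M0 (principalMatrix B0) t j =
                evalYHat M0 (principalMatrix B0) P * M0 (Sum.elim g 0) ↔ P = F)) ∧
          (∀ P : QuantumTorus (Matrix.diagonal d * B0), P.IsPolynomial →
            (quantumClusterVariable d M0 (principalMatrix B0) t j =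
                M0 (Sum.elim g 0) * evalYHat M0 (principalMatrix B0) P ↔ P = F.bar))) ∧
      -- arbitrary coefficients; `l = 2 λ_{j;t}`
      (∀ (r : ℕ) (B : Matrix (Fin n ⊕ Fin r) (Fin n) ℤ), principalPart B = B0 →
        ∃ (gt : Fin n ⊕ Fin r → ℤ) (l : ℤ), IsExtendedGVector B t j gt ∧
          ∀ (L Λ0 : Matrix (Fin n ⊕ Fin r) (Fin n ⊕ Fin r) ℤ)
            (M0 : (Fin n ⊕ Fin r → ℤ) → QuantumField L), IsQuantumSeed d L M0 B Λ0 →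
            quantumClusterVariable d M0 B t j =
                QuantumField.qHalf L ^ l * evalYHat M0 B F * M0 gt ∧
              quantumClusterVariable d M0 B t j =
                QuantumField.qHalf L ^ (-l) * M0 gt * evalYHat M0 B F.bar) ∧
      F.bar.classicalLimit = classicalF B0 t j := by
  obtain ⟨w, hw⟩ := t
  obtain ⟨N, hN⟩ := exists_transfer hDB w
  have hprin := principal_isQuantumSeed hDB
  have hprinS := hprin.isSeed hd
  obtain ⟨φ, hφ⟩ := hprin.exists_isSubst hd (principalPart_principalMatrix B0)
  have hdiag' : ∀ w k, mutateAlong (principalMatrix B0) w (Sum.inl k) k = 0 := by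
    intro w k
    obtain ⟨Λ', h'⟩ := hprinS.along_isSeed w
    have := h'.diag k
    rwa [along_matrix] at this
  have hsingle : ∀ r : ℕ, unitVec r j ∘ Sum.inl = Pi.single j 1 := by
    intro r
    ext i
    simp [Pi.single_apply]
  have hN1 := hN n _ _ _ _ _ _ hprinS (principalPart_principalMatrix B0) hφ (unitVec n j)
  rw [QuantumField.algebraMap_q, hsingle] at hN1
  obtain ⟨F, hFpol, hFN⟩ := exists_isPolynomial hd hDB w j hφ hN1
  rw [← hFN] at hN1
  set g : Fin n → ℤ := gMap (principalMatrix B0) w (unitVec n j) ∘ Sum.inl with hg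
  have hcl := fun {R : Type} [Field R] {x : Fin n ⊕ Fin n → R} (hx : ∀ i, x i ≠ 0)
    (hne : ∀ w k, ((ClassicalSeed.mk x (principalMatrix B0)).along w).cluster (Sum.inl k) ≠ 0) =>
    classical_expression hd hDB w j hφ hN1 hx hne
  have hclF : classicalF B0 ⟨w, hw⟩ j =
      torusSpec (zForm B0 d) (RatFunField.var : Fin n → RatFunField (Fin n)) F :=
    torusSpec_eq_cluster hcl RatFunField.IsPos.var
  have hvarpos : ∀ {σ : Type} (i : σ), RatFunField.IsPos (RatFunField.var i) :=
    fun i => RatFunField.IsPos.var i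
  -- the expressions of the quantum cluster variables
  have hquantum : ∀ {r : ℕ} {B : Matrix (Fin n ⊕ Fin r) (Fin n) ℤ} (_ : principalPart B = B0)
      {L Λ0 : Matrix (Fin n ⊕ Fin r) (Fin n ⊕ Fin r) ℤ}
      {M0 : (Fin n ⊕ Fin r → ℤ) → QuantumField L}, IsQuantumSeed d L M0 B Λ0 →
      (quantumClusterVariable d M0 B ⟨w, hw⟩ j =
        evalYHat M0 B F * M0 (gMap B w (unitVec r j)) ∧
      quantumClusterVariable d M0 B ⟨w, hw⟩ j =
        M0 (gMap B w (unitVec r j)) * evalYHat M0 B F.bar) := by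
    intro r B hB L Λ0 M0 hM
    have hS := hM.isSeed hd
    obtain ⟨ψ, hψ⟩ := hM.exists_isSubst hd hB
    have h1 := hN r _ _ _ _ _ _ hS hB hψ (unitVec r j)
    rw [QuantumField.algebraMap_q, hsingle, ← hFN, hψ.numer hS hB, ← evalYHat_eq hd hM hB] at h1
    refine ⟨h1, ?_⟩
    obtain ⟨-, -, σ, hσ, hσM⟩ := hM.2.1.exists_isToric hM.1
    -- Applying the anti-automorphism to the left formula reverses the product, replaces `F` by its
    -- bar and fixes the cluster variable.
    have h2 := bar_frame_along (d := d) (S := ⟨M0, B⟩) hσ hσM w (unitVec r j)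
    rw [QuantumField.algebraMap_q, h1, map_mul, hσM, evalYHat_eq hd hM hB,
      bar_torusHom (hS.isToric_yHat hB) hσ (fun c => hσM _), ← MulOpposite.op_mul] at h2
    have h3 := MulOpposite.op_injective h2
    rw [evalYHat_eq hd hM hB, bar_eq_torusBar]
    refine h1.trans ?_
    rw [evalYHat_eq hd hM hB]
    exact h3.symm
  have heval : ∀ {L Λ0 : Matrix (Fin n ⊕ Fin n) (Fin n ⊕ Fin n) ℤ}
      {M0 : (Fin n ⊕ Fin n → ℤ) → QuantumField L},
      IsQuantumSeed d L M0 (principalMatrix B0) Λ0 →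
      ∀ P P' : QuantumTorus (zForm B0 d), evalYHat M0 (principalMatrix B0) P =
        evalYHat M0 (principalMatrix B0) P' → P = P' := by
    intro L Λ0 M0 hM P P' h
    obtain ⟨ψ, hψ⟩ := hM.exists_isSubst hd (principalPart_principalMatrix B0)
    rw [evalYHat_eq hd hM (principalPart_principalMatrix B0),
      evalYHat_eq hd hM (principalPart_principalMatrix B0),
      ← hψ.numer (hM.isSeed hd) (principalPart_principalMatrix B0),
      ← hψ.numer (hM.isSeed hd) (principalPart_principalMatrix B0)] at h
    exact QuantumField.numer_injective (ψ.injective h)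
  have hgG : Sum.elim g 0 = gMap (principalMatrix B0) w (unitVec n j) :=
    (gMap_principal_unitVec w j).symm
  refine ⟨g, F, ?_, hFpol, bar_isPolynomial hFpol, ?_, ?_, ?_⟩
  · change IsLaurentHomogeneous _
      (((ClassicalSeed.mk RatFunField.var (principalMatrix B0)).along w).cluster (Sum.inl j)) g
    rw [hcl (fun i => (hvarpos i).ne_zero) fun w k => (RatFunField.IsPos.along hvarpos w _).ne_zero]
    have := isLaurentHomogeneous_torusSpec g F
    rwa [hgG] at this
  · intro Λ _ L M0 hM
    obtain ⟨h1, h2⟩ := hquantum (principalPart_principalMatrix B0) hM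
    have hne := (hM.isSeed hd).ne_zero (Sum.elim g 0)
    rw [← hgG] at h1 h2
    refine ⟨fun P _ => ⟨fun hP => ?_, fun hP => hP ▸ h1⟩,
      fun P _ => ⟨fun hP => ?_, fun hP => hP ▸ h2⟩⟩
    · exact heval hM _ _ (mul_right_cancel₀ hne (hP.symm.trans h1))
    · exact heval hM _ _ (mul_left_cancel₀ hne (hP.symm.trans h2))
  · intro r B hB
    -- No power of `q` is left over: `hquantum` gives both formulas exactly, whence `λ = 0`.
    refine ⟨gMap B w (unitVec r j), 0, ?_, fun L Λ0 M0 hM => ?_⟩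
    · obtain ⟨P, hP⟩ := exists_mvPolynomial hFpol
      refine ⟨P, ?_, ?_⟩
      · rw [hB, hclF, ← hP, aeval_var]
      · have hdiag : ∀ w k, mutateAlong B w (Sum.inl k) k = 0 := fun w k => by
          rw [mutateAlong_inl (hB.trans (principalPart_principalMatrix B0).symm), hdiag']
        have hy : ∀ i, RatFunField.IsPos
            (yHat B (RatFunField.var : Fin n ⊕ Fin r → RatFunField _) i) := fun i =>
          RatFunField.IsPos.prod fun i' => (hvarpos i').zpow _
        have hpos : ∀ i, RatFunField.IsPos (Sum.elim (fun _ : Fin n => 1)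
            (yHat B (RatFunField.var : Fin n ⊕ Fin r → RatFunField _)) i) := by
          rintro (i | i)
          · exact RatFunField.IsPos.one
          · exact hy i
        refine (classicalAlong_separation (fun i => (hvarpos i).ne_zero) hdiag
          (fun w k => (RatFunField.IsPos.along hpos w _).ne_zero) w j).trans ?_
        rw [hB, torusSpec_eq_cluster hcl hy, ← hP]
        rfl
    · obtain ⟨h1, h2⟩ := hquantum hB hM
      rw [neg_zero, zpow_zero, one_mul, one_mul]
      exact ⟨h1, h2⟩
  · exact (torusSpec_bar _ F).trans hclF.symm
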